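/- Let $M$ be a smooth manifold of dimension $n\ge 3$, let $q$ be a real number with $q\ne 1,-1$, let $\alpha=\sqrt{a_{ij}y^iy^j}$ and $\bar\alpha=\sqrt{\bar a_{ij}y^iy^j}$ be (smooth) Riemannian metrics on $M$, and let $\beta=b_iy^i$ and $\bar\beta=\bar b_iy^i$ be smooth, nowhere vanishing, collinear 1-forms on $M$ (at each point $\bar\beta$ is a multiple of $\beta$). Let $$F=\frac{\beta^q}{(\beta-\alpha)^{q-1}},\qquad \bar F=\frac{\bar\alpha^2}{\bar\beta},$$ where $F$ is considered on the cone of tangent vectors with $\alpha<\beta$ at which its fundamental tensor $g_{ij}=\frac12\,\partial^2F^2/\partial y^i\partial y^j$ is nondegenerate, and the Kropina metric $\bar F$ on the tangent vectors with $\bar\beta\neq0$; assume that the cone $\alpha<\beta$ is non-empty at every point of $M$ (that is, $\|\beta\|_\alpha>1$). For a metric $F$ with fundamental tensor $g_{ij}$ let $G^i=\frac14 g^{il}\big\{\frac{\partial^2F^2}{\partial x^k\partial y^l}y^k-\frac{\partial F^2}{\partial x^l}\big\}$ be its spray coefficients in local coordinates; $G^i_\alpha$ and $\bar G^i_{\bar\alpha}$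 denote those of $\alpha$ and $\bar\alpha$. $F$ and $\bar F$ are projectively related if there is a scalar function $P(x,y)$ with $G^i=\bar G^i+Py^i$ wherever both are defined; a metric is a Douglas metric if $\frac{\partial^3}{\partial y^j\partial y^k\partial y^l}\big(G^i-\frac1{n+1}\frac{\partial G^m}{\partial y^m}y^i\big)=0$ for all $i,j,k,l$ on its domain. Let $b_{i|j}$ be the covariant derivative of $\beta$ with respect to the Levi-Civita connection of $\alpha$, and put $r_{ij}=\frac12(b_{i|j}+b_{j|i})$, $s_{ij}=\frac12(b_{i|j}-b_{j|i})$, $r_{00}=r_{ij}y^iy^j$, $b^i=a^{ij}b_j$, $b^2=\|\beta\|_\alpha^2=b^ib_i$, $s_j=b^is_{ij}$, $s^i=a^{ij}s_j$; barred symbols are the same objects built from $\bar\alpha$ and $\bar\beta$. Then $F$ is projectively related to $\bar F$ if and only if $F$ and $\bar F$ are both Douglas metrics and there is a smooth 1-form $\theta=\theta_iy^i$ on $M$ such that, in all local coordinates and on the domain of $F$, $$G^i_{\alpha}-\bar G^i_{\bar\alpha}=\frac{1}{2\bar b^2}\big(\bar\alpha^2\bar s^i+\bar r_{00}\bar b^i\big)+\theta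 y^i-\frac{q\,\alpha^3r_{00}}{2\big[\beta^2(\beta-\alpha)+q(b^2\alpha^2-\beta^2)\alpha\big]}\,b^i .$$ -/

import Mathlib

open scoped Manifold ContDiff Bundle Topology

noncomputable section

namespace Kropina

/-- The model space of an `n`-dimensional manifold. -/
abbrev Model (n : ℕ) : Type := EuclideanSpace ℝ (Fin n)

section Objects

variable (n : ℕ) (M : Type*) [TopologicalSpace M] [ChartedSpace (Model n) M]

/-- A chart of `M`, with values in the model space. -/
abbrev Chart : Type _ := OpenPartialHomeomorph M (Model n)

/-- A (not necessarily linear) real function on the tangent bundle of `M`. -/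
abbrev TFun : Type _ := ∀ x : M, TangentSpace 𝓘(ℝ, Model n) x → ℝ

/-- A subset of the tangent bundle of `M`, fibre by fibre. -/
abbrev TDom : Type _ := ∀ x : M, Set (TangentSpace 𝓘(ℝ, Model n) x)

variable [IsManifold 𝓘(ℝ, Model n) ∞ M]

/-- A smooth Riemannian metric on `M`. -/
abbrev RMetric : Type _ :=
  Bundle.ContMDiffRiemannianMetric 𝓘(ℝ, Model n) ∞ (Model n)
    (fun x : M => TangentSpace 𝓘(ℝ, Model n) x)

/-- A smooth 1-form on `M`. -/
abbrev OneForm : Type _ :=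
  Cₛ^∞⟮𝓘(ℝ, Model n); Model n →L[ℝ] ℝ,
    fun x : M => TangentSpace 𝓘(ℝ, Model n) x →L[ℝ] Bundle.Trivial M ℝ x⟯

end Objects

/-! Partial derivatives of functions of `(x, y)` in local coordinates. -/

section Coordinates

variable {n : ℕ}

/-- `∂f/∂xᵏ` for a function of the position `x`. -/
def partialD (k : Fin n) (f : Model n → ℝ) (z : Model n) : ℝ :=
  fderiv ℝ f z (EuclideanSpace.single k 1)

/-- `∂L/∂xᵏ` for a function `L(x, y)`. -/
def dX (k : Fin n) (L : Model n → Model n → ℝ) (z v : Model n) : ℝ :=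
  partialD k (fun z' => L z' v) z

/-- `∂L/∂yᵏ` for a function `L(x, y)`. -/
def dY (k : Fin n) (L : Model n → Model n → ℝ) (z v : Model n) : ℝ :=
  partialD k (fun v' => L z v') v

/-- The matrix `g_{ij} = ½ ∂²L/∂yⁱ∂yʲ` (with `L = F²`). -/
def fundMatrix (L : Model n → Model n → ℝ) (z v : Model n) : Matrix (Fin n) (Fin n) ℝ :=
  Matrix.of fun i j => (1 / 2 : ℝ) * dY i (dY j L) z v

/-- `Gⁱ = ¼ gⁱˡ { ∂²L/∂xᵏ∂yˡ yᵏ - ∂L/∂xˡ }` (with `L = F²`). -/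
def sprayOf (L : Model n → Model n → ℝ) (i : Fin n) (z v : Model n) : ℝ :=
  (1 / 4 : ℝ) * ∑ l, (fundMatrix L z v)⁻¹ i l *
    ((∑ k, dX k (dY l L) z v * v k) - dX l L z v)

/-- `Dⁱ_{jkl} = ∂³/∂yʲ∂yᵏ∂yˡ (Gⁱ - (1/(n+1)) (∂Gᵐ/∂yᵐ) yⁱ)`. -/
def douglasOf (G : Fin n → Model n → Model n → ℝ) (i j k l : Fin n) (z v : Model n) : ℝ :=
  dY j (dY k (dY l (fun z' v' =>
    G i z' v' - (1 / ((n : ℝ) + 1)) * (∑ m, dY m (G m) z' v') * v' i))) z v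

end Coordinates

section Manifold

variable {n : ℕ} {M : Type*} [TopologicalSpace M] [ChartedSpace (Model n) M]

/-- The tangent vector at `e.symm z` whose coordinates in the chart `e` are `v`. -/
def vec (e : Chart n M) (z v : Model n) : TangentSpace 𝓘(ℝ, Model n) (e.symm z) :=
  mfderiv 𝓘(ℝ, Model n) 𝓘(ℝ, Model n) e.symm z v

/-- The coordinate vector field `∂_i` of the chart `e`. -/
def coordVec (e : Chart n M) (i : Fin n) (z : Model n) :
    TangentSpace 𝓘(ℝ, Model n) (e.symm z) :=
  vec e z (EuclideanSpace.single i 1)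

/-- The spray (geodesic) coefficients `Gⁱ(x, y)` of the metric `F` in the chart `e`. -/
def spray (e : Chart n M) (F : TFun n M) : Fin n → Model n → Model n → ℝ :=
  sprayOf fun z v => F (e.symm z) (vec e z v) ^ 2

/-- The fundamental tensor `g_y(u, w) = ½ ∂²/∂s∂t F²(y + s u + t w)` at `s = t = 0`. -/
def fundTensor (F : TFun n M) (x : M) (y u w : TangentSpace 𝓘(ℝ, Model n) x) : ℝ :=
  (1 / 2 : ℝ) * deriv (fun s : ℝ => deriv (fun t : ℝ => F x (y + s • u + t • w) ^ 2) 0) 0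

/-- The fundamental tensor of `F` at `y ∈ T_x M` is nondegenerate. -/
def Nondeg (F : TFun n M) (x : M) (y : TangentSpace 𝓘(ℝ, Model n) x) : Prop :=
  ∀ u : TangentSpace 𝓘(ℝ, Model n) x, (∀ w, fundTensor F x y u w = 0) → u = 0

variable [IsManifold 𝓘(ℝ, Model n) ∞ M]

/-- `F`, with domain `D`, and `F'`, with domain `D'`, are projectively related: there is a scalar
function `P(x, y)` with `Gⁱ = G'ⁱ + P yⁱ` in every local coordinate system, wherever both metrics
are defined. -/
def ProjectivelyRelated (F : TFun n M) (D : TDom n M) (F' : TFun n M) (D' : TDom n M) : Prop :=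
  ∃ P : TFun n M, ∀ e ∈ IsManifold.maximalAtlas 𝓘(ℝ, Model n) ∞ M, ∀ z ∈ e.target,
    ∀ v : Model n, vec e z v ∈ D (e.symm z) → vec e z v ∈ D' (e.symm z) →
      ∀ i, spray e F i z v = spray e F' i z v + P (e.symm z) (vec e z v) * v i

/-- `F`, with domain `D`, is a Douglas metric: its Douglas tensor vanishes on `D`. -/
def IsDouglas (F : TFun n M) (D : TDom n M) : Prop :=
  ∀ e ∈ IsManifold.maximalAtlas 𝓘(ℝ, Model n) ∞ M, ∀ z ∈ e.target,
    ∀ v : Model n, vec e z v ∈ D (e.symm z) →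
      ∀ i j k l, douglasOf (spray e F) i j k l z v = 0

/-- `α(y) = √(a_{ij} yⁱ yʲ)`. -/
def alpha (a : RMetric n M) : TFun n M := fun x y => Real.sqrt (a.inner x y y)

/-- `β(y) = b_i yⁱ`. -/
def beta (β : OneForm n M) : TFun n M := fun x y => β x y

/-- `F = β^q / (β - α)^(q-1)`, meaningful where `α < β`. -/
def qMetric (q : ℝ) (a : RMetric n M) (β : OneForm n M) : TFun n M := fun x y =>
  beta β x y ^ q / (beta β x y - alpha a x y) ^ (q - 1)

/-- The domain of `F = β^q / (β - α)^(q-1)`: the tangent vectors with `α < β` at which the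
fundamental tensor is nondegenerate, so that the spray coefficients are defined. -/
def qDomain (q : ℝ) (a : RMetric n M) (β : OneForm n M) : TDom n M := fun x =>
  {y | alpha a x y < beta β x y ∧ Nondeg (qMetric q a β) x y}

/-- The Kropina metric `F = α² / β`, meaningful where `β ≠ 0`. -/
def kropina (a : RMetric n M) (β : OneForm n M) : TFun n M := fun x y =>
  alpha a x y ^ 2 / beta β x y

/-- The domain of the Kropina metric: the tangent vectors with `β ≠ 0`. -/
def kropinaDomain (β : OneForm n M) : TDom n M := fun x => {y | beta β x y ≠ 0}

/-! Coordinate expressions, in the chart `e`, of the tensors attached to a Riemannian metric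
`α` (with coefficients `a_{ij}`) and a 1-form `β` (with coefficients `b_i`). -/

/-- `a_{ij}` -/
def aLow (e : Chart n M) (a : RMetric n M) (z : Model n) : Matrix (Fin n) (Fin n) ℝ :=
  Matrix.of fun i j => a.inner (e.symm z) (coordVec e i z) (coordVec e j z)

/-- `b_i` -/
def bLow (e : Chart n M) (β : OneForm n M) (i : Fin n) (z : Model n) : ℝ :=
  beta β (e.symm z) (coordVec e i z)

/-- `bⁱ = aⁱʲ b_j` -/
def bUp (e : Chart n M) (a : RMetric n M) (β : OneForm n M) (i : Fin n) (z : Model n) : ℝ :=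
  ∑ j, (aLow e a z)⁻¹ i j * bLow e β j z

/-- `b² = ‖β‖_α² = bⁱ b_i` -/
def bSq (e : Chart n M) (a : RMetric n M) (β : OneForm n M) (z : Model n) : ℝ :=
  ∑ i, bUp e a β i z * bLow e β i z

/-- The Christoffel symbols `Γᵏ_{ij}` of the Levi-Civita connection of `α`. -/
def christoffel (e : Chart n M) (a : RMetric n M) (k i j : Fin n) (z : Model n) : ℝ :=
  (1 / 2 : ℝ) * ∑ l, (aLow e a z)⁻¹ k l *
    (partialD i (fun z' => aLow e a z' l j) z + partialD j (fun z' => aLow e a z' l i) z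
      - partialD l (fun z' => aLow e a z' i j) z)

/-- The covariant derivative `b_{i|j} = ∂b_i/∂xʲ - Γᵏ_{ij} b_k`. -/
def bCov (e : Chart n M) (a : RMetric n M) (β : OneForm n M) (i j : Fin n) (z : Model n) : ℝ :=
  partialD j (bLow e β i) z - ∑ k, christoffel e a k i j z * bLow e β k z

/-- `r_{ij} = ½ (b_{i|j} + b_{j|i})` -/
def rLow (e : Chart n M) (a : RMetric n M) (β : OneForm n M) (i j : Fin n) (z : Model n) : ℝ :=
  (1 / 2 : ℝ) * (bCov e a β i j z + bCov e a β j i z)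

/-- `s_{ij} = ½ (b_{i|j} - b_{j|i})` -/
def sLow (e : Chart n M) (a : RMetric n M) (β : OneForm n M) (i j : Fin n) (z : Model n) : ℝ :=
  (1 / 2 : ℝ) * (bCov e a β i j z - bCov e a β j i z)

/-- `r₀₀ = r_{ij} yⁱ yʲ` -/
def r00 (e : Chart n M) (a : RMetric n M) (β : OneForm n M) (z v : Model n) : ℝ :=
  ∑ i, ∑ j, rLow e a β i j z * v i * v j

/-- `s_j = bⁱ s_{ij}` -/
def sVecLow (e : Chart n M) (a : RMetric n M) (β : OneForm n M) (j : Fin n) (z : Model n) : ℝ :=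
  ∑ i, bUp e a β i z * sLow e a β i j z

/-- `sⁱ = aⁱʲ s_j` -/
def sVecUp (e : Chart n M) (a : RMetric n M) (β : OneForm n M) (i : Fin n) (z : Model n) : ℝ :=
  ∑ j, (aLow e a z)⁻¹ i j * sVecLow e a β j z

end Manifold

end Kropina

end

set_option linter.unusedSectionVars false

/-! Each of the two metrics is a function of a Riemannian metric and a 1-form, so its spray is the
spray of the Riemannian metric plus an explicit correction in the directions `y`, `b` and `sⁱ₀`
(`IsFrame.isSpray_q`, `IsFrame.isSpray_kropina`). Projective relatedness only sees `G ∧ y`, and so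
does the Douglas condition: it makes `G ∧ y` polynomial along lines in a tangent space
(`exists_isPoly_wedge_of_douglas`).

The core is a rigidity statement for `F` at a single point. Whether `F` is Douglas or projectively
related to the Kropina metric, `β` times (correction of `F`) `∧ y` is polynomial along lines through
the domain. In the projective case this uses collinearity: the only denominator in the Kropina wedge
is `β̄`, a multiple of `β`. But the correction of `F` contains `α`, the square root of a quadratic
polynomial of negative discriminant on suitable lines, which is irrational over the polynomials
(`IsPoly.eq_zero_of_add_sqrt_mul`). Separating the parts even and odd in `α` and eliminating the
unknown polynomial gives `FibreData.parity_identity`, valid for all `y` with `β² < α²`, hence far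
outside the cone where `F` lives. Evaluating it on and near the hyperplane `β = 0`, with a vector
orthogonal to both `b` and `sⁱ` (here `n ≥ 3` enters), forces `s_{ij} = 0`; then `b² > 1` forces `q
r₀₀ = 0` (`sOp_eq_zero_and_r00_eq_zero`). So the correction of `F` is a multiple of `y`, and the
last term of the asserted formula vanishes.

The same line argument for the Kropina metric yields `b̄² s̄ = b̄ ∧ s̄` (`sOp_eq_of_poly`), and then
its correction is the quadratic field in the formula plus a multiple of `y`. A spray which is
quadratic up to a degree-one multiple of `y` is Douglas (`douglasOf_eq_zero`), so projectively
related metrics of this kind are both Douglas.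

What remains of the projective relation is that `G_α - Ḡ_ᾱ` minus the quadratic field is
proportional to `y`. A quadratic field proportional to `y` is `θ y` with `θ` linear and determined
by the divergence (`quad_of_wedge_eq_zero`). That divergence is an exact differential: `θ` is
`1/(2(n+1))` times the differential of `log (det a / (det ā · b̄²))`, a function that does not
depend on the chart. This makes `θ` a smooth global 1-form (`exists_oneForm`).

Conversely, the Douglas conditions give the same rigidity (`isRigid_of_douglas`), after which the
formula is the projective relation chart by chart. The transformation law of sprays shows that the
factor is a function on the tangent bundle (`projectivelyRelated_of_forall`). -/

namespace Kropina

/-! ### Second derivatives of composite maps -/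

section SecondDerivatives

variable {E F G : Type*} [NormedAddCommGroup E] [NormedSpace ℝ E] [NormedAddCommGroup F]
  [NormedSpace ℝ F] [NormedAddCommGroup G] [NormedSpace ℝ G]

lemma ContDiffAt.differentiableAt_fderiv {f : E → F} {x : E} (hf : ContDiffAt ℝ 2 f x) :
    DifferentiableAt ℝ (fderiv ℝ f) x :=
  (hf.fderiv_right (m := 1) (by norm_num)).differentiableAt (by norm_num)

lemma ContDiffAt.eventually_differentiableAt {f : E → F} {x : E} (hf : ContDiffAt ℝ 2 f x) :
    ∀ᶠ x' in 𝓝 x, DifferentiableAt ℝ f x' := by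
  filter_upwards [hf.eventually (by simp)] with x' hx'
  exact hx'.differentiableAt (by norm_num)

lemma fderiv_fderiv_comp {f : F → G} {m : E → F} {x : E} (hf : ContDiffAt ℝ 2 f (m x))
    (hm : ContDiffAt ℝ 2 m x) (a b : E) :
    fderiv ℝ (fderiv ℝ (fun x => f (m x))) x a b =
      fderiv ℝ (fderiv ℝ f) (m x) (fderiv ℝ m x a) (fderiv ℝ m x b) +
        fderiv ℝ f (m x) (fderiv ℝ (fderiv ℝ m) x a b) := by
  have h1 : fderiv ℝ (fun x => f (m x)) =ᶠ[𝓝 x]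
      fun x' => (fderiv ℝ f (m x')).comp (fderiv ℝ m x') := by
    filter_upwards [hm.continuousAt.eventually (ContDiffAt.eventually_differentiableAt hf),
      ContDiffAt.eventually_differentiableAt hm] with x' h1 h2
    exact fderiv_comp x' h1 h2
  have hm1 : DifferentiableAt ℝ m x := hm.differentiableAt (by norm_num)
  have h2 := ((ContDiffAt.differentiableAt_fderiv hf).hasFDerivAt.comp x hm1.hasFDerivAt)
  have h3 := (ContDiffAt.differentiableAt_fderiv hm).hasFDerivAt
  have h4 := HasFDerivAt.clm_comp h2 h3
  rw [h1.fderiv_eq]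
  erw [h4.fderiv]
  simp [add_comm]

/-- The second derivative of `L`, evaluated on two directions, as an iterated directional
derivative. -/
lemma fderiv_fderiv_apply {f : E → F} {x : E} (hf : ContDiffAt ℝ 2 f x) (a b : E) :
    fderiv ℝ (fun x' => fderiv ℝ f x' b) x a = fderiv ℝ (fderiv ℝ f) x a b := by
  rw [fderiv_clm_apply (ContDiffAt.differentiableAt_fderiv hf) (by fun_prop)]
  simp

lemma fderiv_fderiv_symm {f : E → F} {x : E} (hf : ContDiffAt ℝ 2 f x) (a b : E) :
    fderiv ℝ (fderiv ℝ f) x a b = fderiv ℝ (fderiv ℝ f) x b a :=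
  (hf.isSymmSndFDerivAt (by simp)).eq a b

end SecondDerivatives

/-! ### The geodesic equation without coordinates -/

section Spray

variable {E : Type*} [NormedAddCommGroup E] [NormedSpace ℝ E]

/-- The vector `G` satisfies the geodesic equation `2 L_{yy} G = L_{xy} y - L_x` at `(z, v)`. -/
def IsSpray (L : E × E → ℝ) (z v G : E) : Prop :=
  ∀ w, fderiv ℝ (fderiv ℝ L) (z, v) (0, (2 : ℝ) • G) (0, w) =
    fderiv ℝ (fderiv ℝ L) (z, v) (v, 0) (0, w) - fderiv ℝ L (z, v) (w, 0)

/-- The fibre Hessian of `L` is nondegenerate. -/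
def FibreNondeg (L : E × E → ℝ) (z v : E) : Prop :=
  ∀ u, (∀ w, fderiv ℝ (fderiv ℝ L) (z, v) (0, u) (0, w) = 0) → u = 0

/-- The equation is affine in `G` with linear part the fibre Hessian, so two solutions differ by an
element of its kernel. -/
lemma IsSpray.unique {L : E × E → ℝ} {z v G G' : E} (hL : FibreNondeg L z v)
    (h : IsSpray L z v G) (h' : IsSpray L z v G') : G = G' := by
  have := hL ((2 : ℝ) • (G - G')) fun w => by
    have e : ((0 : E), (2 : ℝ) • (G - G')) = (0, (2 : ℝ) • G) - (0, (2 : ℝ) • G') := by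
      simp [smul_sub]
    rw [e, map_sub, _root_.sub_apply, h w, h' w, sub_self]
  simpa [sub_eq_zero] using this

/-- Naturality of the geodesic equation under the change of coordinates `ψ`. -/
lemma IsSpray.pullback {L : E × E → ℝ} {ψ : E → E} {z v G : E}
    (hψ : ContDiffAt ℝ 3 ψ z) (hsurj : Function.Surjective (fderiv ℝ ψ z))
    (hL : ContDiffAt ℝ 2 L (ψ z, fderiv ℝ ψ z v))
    (h : IsSpray (fun x : E × E => L (ψ x.1, fderiv ℝ ψ x.1 x.2)) z v G) :
    IsSpray L (ψ z) (fderiv ℝ ψ z v)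
      (fderiv ℝ ψ z G - (1 / 2 : ℝ) • fderiv ℝ (fderiv ℝ ψ) z v v) := by
  set m : E × E → E × E := fun x => (ψ x.1, fderiv ℝ ψ x.1 x.2) with hm
  have hψ1 : ContDiffAt ℝ 2 (fderiv ℝ ψ) z := hψ.fderiv_right (by norm_num)
  have hψ2 : ContDiffAt ℝ 2 ψ z := hψ.of_le (by norm_num)
  have hm2 : ContDiffAt ℝ 2 m (z, v) := by
    refine ContDiffAt.prodMk (hψ2.comp (z, v) contDiffAt_fst) ?_
    exact ContDiffAt.clm_apply (hψ1.comp (z, v) contDiffAt_fst) contDiffAt_snd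
  -- first derivative
  have hD : ∀ᶠ x in 𝓝 (z, v), ∀ b, fderiv ℝ m x b =
      (fderiv ℝ ψ x.1 b.1, fderiv ℝ (fderiv ℝ ψ) x.1 b.1 x.2 + fderiv ℝ ψ x.1 b.2) := by
    have h1 : ∀ᶠ x : E × E in 𝓝 (z, v), ContDiffAt ℝ 3 ψ x.1 :=
      continuousAt_fst.eventually (hψ.eventually (by simp))
    filter_upwards [h1] with x hx b
    have d1 : HasFDerivAt ψ (fderiv ℝ ψ x.1) x.1 :=
      (hx.differentiableAt (by norm_num)).hasFDerivAt
    have d2 : HasFDerivAt (fderiv ℝ ψ) (fderiv ℝ (fderiv ℝ ψ) x.1) x.1 :=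
      (ContDiffAt.differentiableAt_fderiv (hx.of_le (by norm_num))).hasFDerivAt
    have d3 := (d1.comp x (hasFDerivAt_fst)).prodMk
      (HasFDerivAt.clm_apply (d2.comp x hasFDerivAt_fst) (hasFDerivAt_snd (p := x)))
    have : fderiv ℝ m x = _ := d3.fderiv
    rw [this]
    simp [add_comm]
  have hDz := hD.self_of_nhds
  -- The vertical derivative of `m` depends on the base point only, so no third derivative of `ψ`
  -- survives.
  have hDD : ∀ a w, fderiv ℝ (fderiv ℝ m) (z, v) a (0, w) =
      (0, fderiv ℝ (fderiv ℝ ψ) z a.1 w) := by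
    intro a w
    rw [← fderiv_fderiv_apply hm2]
    have : (fun x => fderiv ℝ m x (0, w)) =ᶠ[𝓝 (z, v)] fun x => (0, fderiv ℝ ψ x.1 w) := by
      filter_upwards [hD] with x hx
      rw [hx]; simp
    rw [this.fderiv_eq]
    have d2 : HasFDerivAt (fderiv ℝ ψ) (fderiv ℝ (fderiv ℝ ψ) z) z :=
      (ContDiffAt.differentiableAt_fderiv hψ2).hasFDerivAt
    have d4 := HasFDerivAt.comp (g := fderiv ℝ ψ) (f := Prod.fst) (z, v) d2 hasFDerivAt_fst
    have d3 := (hasFDerivAt_const (0 : E) (z, v)).prodMk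
      (HasFDerivAt.clm_apply d4 (hasFDerivAt_const w (z, v)))
    refine (congrArg (fun φ => φ a) (HasFDerivAt.fderiv d3)).trans ?_
    simp
  intro w'
  -- Surjectivity of the derivative of `ψ` lets every test vector be pulled back.
  obtain ⟨w, rfl⟩ := hsurj w'
  have hw := h w
  have hL' : ContDiffAt ℝ 2 L (m (z, v)) := hL
  have e1 := fderiv_fderiv_comp hL' hm2 (0, (2 : ℝ) • G) (0, w)
  have e2 := fderiv_fderiv_comp hL' hm2 (v, 0) (0, w)
  have e3 : fderiv ℝ (fun x => L (m x)) (z, v) (w, 0) =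
      fderiv ℝ L (m (z, v)) (fderiv ℝ m (z, v) (w, 0)) := by
    rw [fderiv_fun_comp (z, v) (hL'.differentiableAt (by norm_num))
      (hm2.differentiableAt (by norm_num))]
    rfl
  rw [e1, e2, e3] at hw
  simp only [hDz, hDD, map_zero, zero_add, add_zero, _root_.zero_apply] at hw
  have s1 := fderiv_fderiv_symm hψ2 v w
  have split1 : ∀ c d : E, ((c, d) : E × E) = (c, 0) + (0, d) := by intro c d; simp
  rw [split1 (fderiv ℝ ψ z v), split1 (fderiv ℝ ψ z w)] at hw
  have e4 : ((0 : E), (2 : ℝ) • (fderiv ℝ ψ z G - (1 / 2 : ℝ) • fderiv ℝ (fderiv ℝ ψ) z v v)) =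
      (0, fderiv ℝ ψ z ((2 : ℝ) • G)) - (0, fderiv ℝ (fderiv ℝ ψ) z v v) := by
    simp [smul_sub, smul_smul]
  rw [e4, map_sub, _root_.sub_apply]
  simp only [map_add, _root_.add_apply, s1] at hw
  simp only [Prod.mk_zero_zero, map_zero] at hw
  change _ = fderiv ℝ (fderiv ℝ L) (m (z, v)) _ _ - fderiv ℝ L (m (z, v)) _
  change fderiv ℝ (fderiv ℝ L) (m (z, v)) _ _ - fderiv ℝ (fderiv ℝ L) (m (z, v)) _ _ = _
  linarith

end Spray

/-! ### The coordinate formula for the spray solves the geodesic equation -/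

section SprayOf

variable {n : ℕ}

lemma dY_eq_fderiv {L : Model n → Model n → ℝ} {x : Model n × Model n}
    (hL : DifferentiableAt ℝ (fun x : Model n × Model n => L x.1 x.2) x) (k : Fin n) :
    dY k L x.1 x.2 = fderiv ℝ (fun x : Model n × Model n => L x.1 x.2) x
      (0, EuclideanSpace.single k 1) := by
  have h := HasFDerivAt.comp (f := fun v => (x.1, v)) x.2 hL.hasFDerivAt
    (hasFDerivAt_prodMk_right x.1 x.2)
  unfold dY partialD
  erw [h.fderiv]
  simp

lemma dX_eq_fderiv {L : Model n → Model n → ℝ} {x : Model n × Model n}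
    (hL : DifferentiableAt ℝ (fun x : Model n × Model n => L x.1 x.2) x) (k : Fin n) :
    dX k L x.1 x.2 = fderiv ℝ (fun x : Model n × Model n => L x.1 x.2) x
      (EuclideanSpace.single k 1, 0) := by
  have h := HasFDerivAt.comp (f := fun z => (z, x.2)) x.1 hL.hasFDerivAt
    (hasFDerivAt_prodMk_left x.1 x.2)
  unfold dX partialD
  erw [h.fderiv]
  simp

variable {L : Model n → Model n → ℝ} {z v : Model n}

lemma eventuallyEq_dY (hL : ContDiffAt ℝ 2 (fun x : Model n × Model n => L x.1 x.2) (z, v))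
    (k : Fin n) : (fun x : Model n × Model n => dY k L x.1 x.2) =ᶠ[𝓝 (z, v)]
      fun x => fderiv ℝ (fun x : Model n × Model n => L x.1 x.2) x
        (0, EuclideanSpace.single k 1) := by
  filter_upwards [ContDiffAt.eventually_differentiableAt hL] with x hx
  exact dY_eq_fderiv hx k

lemma differentiableAt_dY (hL : ContDiffAt ℝ 2 (fun x : Model n × Model n => L x.1 x.2) (z, v))
    (k : Fin n) :
    DifferentiableAt ℝ (fun x : Model n × Model n => dY k L x.1 x.2) (z, v) := by
  rw [(eventuallyEq_dY hL k).differentiableAt_iff]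
  exact (ContDiffAt.differentiableAt_fderiv hL).clm_apply (by fun_prop)

lemma dY_dY (hL : ContDiffAt ℝ 2 (fun x : Model n × Model n => L x.1 x.2) (z, v))
    (i j : Fin n) : dY i (dY j L) z v =
      fderiv ℝ (fderiv ℝ (fun x : Model n × Model n => L x.1 x.2)) (z, v)
        (0, EuclideanSpace.single i 1) (0, EuclideanSpace.single j 1) := by
  rw [← fderiv_fderiv_apply hL, ← (eventuallyEq_dY hL j).fderiv_eq]
  exact dY_eq_fderiv (x := (z, v)) (differentiableAt_dY hL j) i

lemma dX_dY (hL : ContDiffAt ℝ 2 (fun x : Model n × Model n => L x.1 x.2) (z, v))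
    (i j : Fin n) : dX i (dY j L) z v =
      fderiv ℝ (fderiv ℝ (fun x : Model n × Model n => L x.1 x.2)) (z, v)
        (EuclideanSpace.single i 1, 0) (0, EuclideanSpace.single j 1) := by
  rw [← fderiv_fderiv_apply hL, ← (eventuallyEq_dY hL j).fderiv_eq]
  exact dX_eq_fderiv (x := (z, v)) (differentiableAt_dY hL j) i

lemma sum_smul_single (v : Model n) : ∑ k, v k • EuclideanSpace.single k (1 : ℝ) = v := by
  ext i
  simp [Finset.sum_apply, Pi.single_apply]

lemma clm_eq_sum {F : Type*} [NormedAddCommGroup F] [NormedSpace ℝ F] (φ : Model n →L[ℝ] F)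
    (v : Model n) : φ v = ∑ k, v k • φ (EuclideanSpace.single k 1) := by
  conv_lhs => rw [← sum_smul_single v]
  simp

lemma clm_ext_single {F : Type*} [NormedAddCommGroup F] [NormedSpace ℝ F] {φ ψ : Model n →L[ℝ] F}
    (h : ∀ k, φ (EuclideanSpace.single k 1) = ψ (EuclideanSpace.single k 1)) : φ = ψ := by
  ext v
  rw [clm_eq_sum φ, clm_eq_sum ψ]
  simp [h]

/-- The fibre Hessian as a bilinear map. -/
noncomputable def fibreHess (L : Model n → Model n → ℝ) (z v : Model n) :
    Model n →L[ℝ] Model n →L[ℝ] ℝ :=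
  (fderiv ℝ (fderiv ℝ (fun x : Model n × Model n => L x.1 x.2)) (z, v)).bilinearComp
    (ContinuousLinearMap.inr ℝ (Model n) (Model n)) (ContinuousLinearMap.inr ℝ (Model n) (Model n))

lemma fibreHess_apply (L : Model n → Model n → ℝ) (z v u w : Model n) : fibreHess L z v u w =
    fderiv ℝ (fderiv ℝ (fun x : Model n × Model n => L x.1 x.2)) (z, v) (0, u) (0, w) := by
  simp [fibreHess]

lemma fundMatrix_mulVec (hL : ContDiffAt ℝ 2 (fun x : Model n × Model n => L x.1 x.2) (z, v))
    (u : Model n) (j : Fin n) : ((fundMatrix L z v).mulVec u.ofLp) j =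
      (1 / 2 : ℝ) * fibreHess L z v u (EuclideanSpace.single j 1) := by
  have h : fibreHess L z v u (EuclideanSpace.single j 1) =
      ∑ k, u k * fibreHess L z v (EuclideanSpace.single k 1) (EuclideanSpace.single j 1) := by
    rw [clm_eq_sum (fibreHess L z v) u]
    simp
  rw [h, Finset.mul_sum]
  simp only [Matrix.mulVec, dotProduct, fundMatrix, Matrix.of_apply]
  refine Finset.sum_congr rfl fun k _ => ?_
  rw [dY_dY hL, fderiv_fderiv_symm hL, fibreHess_apply]
  ring

lemma isUnit_det_fundMatrix (hL : ContDiffAt ℝ 2 (fun x : Model n × Model n => L x.1 x.2) (z, v))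
    (hn : FibreNondeg (fun x : Model n × Model n => L x.1 x.2) z v) :
    IsUnit (fundMatrix L z v).det := by
  rw [isUnit_iff_ne_zero]
  intro h0
  obtain ⟨u, hu, hu0⟩ := Matrix.exists_mulVec_eq_zero_iff.2 h0
  refine hu ?_
  have := hn (WithLp.toLp 2 u) fun w => ?_
  · simpa using congrArg WithLp.ofLp this
  · rw [← fibreHess_apply]
    have : fibreHess L z v (WithLp.toLp 2 u) = 0 := clm_ext_single fun k => by
      have h := fundMatrix_mulVec hL (WithLp.toLp 2 u) k
      rw [show (WithLp.toLp 2 u).ofLp = u from rfl, hu0] at h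
      simp only [Pi.zero_apply] at h
      simp only [_root_.zero_apply]
      linarith
    rw [this]; simp

/-- The spray coefficients solve the geodesic equation. -/
lemma isSpray_sprayOf (hL : ContDiffAt ℝ 2 (fun x : Model n × Model n => L x.1 x.2) (z, v))
    (hn : FibreNondeg (fun x : Model n × Model n => L x.1 x.2) z v) :
    IsSpray (fun x : Model n × Model n => L x.1 x.2) z v
      (WithLp.toLp 2 fun i => sprayOf L i z v) := by
  set Lc := fun x : Model n × Model n => L x.1 x.2
  set G : Model n := WithLp.toLp 2 fun i => sprayOf L i z v
  have hu := isUnit_det_fundMatrix hL hn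
  set q : Fin n → ℝ := fun l => (∑ k, dX k (dY l L) z v * v k) - dX l L z v with hq
  have hG : G.ofLp = (1 / 4 : ℝ) • (fundMatrix L z v)⁻¹.mulVec q := by
    ext i
    simp [G, sprayOf, Matrix.mulVec, dotProduct, hq]
  have h1 : (fundMatrix L z v).mulVec G.ofLp = (1 / 4 : ℝ) • q := by
    rw [hG, Matrix.mulVec_smul, Matrix.mulVec_mulVec, Matrix.mul_nonsing_inv _ hu,
      Matrix.one_mulVec]
  have key : (2 : ℝ) • fibreHess L z v G =
      (fderiv ℝ (fderiv ℝ Lc) (z, v) (v, 0)).comp (ContinuousLinearMap.inr ℝ _ _) -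
        (fderiv ℝ Lc (z, v)).comp (ContinuousLinearMap.inl ℝ _ _) := by
    refine clm_ext_single fun l => ?_
    have h2 := fundMatrix_mulVec hL G l
    rw [h1] at h2
    have h3 : fderiv ℝ (fderiv ℝ Lc) (z, v) (v, 0) (0, EuclideanSpace.single l 1) =
        ∑ k, dX k (dY l L) z v * v k := by
      have := clm_eq_sum ((fderiv ℝ (fderiv ℝ Lc) (z, v)).comp
        (ContinuousLinearMap.inl ℝ (Model n) (Model n))) v
      simp only [ContinuousLinearMap.comp_apply, ContinuousLinearMap.inl_apply] at this
      rw [this, _root_.sum_apply]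
      refine Finset.sum_congr rfl fun k _ => ?_
      rw [dX_dY hL]
      simp [mul_comm, Lc]
    have h4 := dX_eq_fderiv (hL.differentiableAt (by norm_num)) l
    simp only [_root_.smul_apply, _root_.sub_apply,
      ContinuousLinearMap.comp_apply, ContinuousLinearMap.inr_apply, ContinuousLinearMap.inl_apply]
    simp only [Pi.smul_apply, hq, smul_eq_mul] at h2 ⊢
    rw [h3, ← h4]
    linarith
  intro w
  have := congrArg (fun φ => φ w) key
  simp only [_root_.smul_apply, _root_.sub_apply,
      ContinuousLinearMap.comp_apply, ContinuousLinearMap.inr_apply,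
      ContinuousLinearMap.inl_apply] at this
  rw [← this, ← fibreHess_apply, map_smul, _root_.smul_apply]

lemma sprayOf_eq_of_isSpray
    (hL : ContDiffAt ℝ 2 (fun x : Model n × Model n => L x.1 x.2) (z, v))
    (hn : FibreNondeg (fun x : Model n × Model n => L x.1 x.2) z v) {G : Model n}
    (hG : IsSpray (fun x : Model n × Model n => L x.1 x.2) z v G) (i : Fin n) :
    sprayOf L i z v = G i := by
  rw [← (isSpray_sprayOf hL hn).unique hn hG]

end SprayOf

/-! ### The normed space of bilinear forms -/

section Instances

variable (E : Type*) [NormedAddCommGroup E] [NormedSpace ℝ E]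

noncomputable abbrev instNormedAddCommGroupBilin :
    NormedAddCommGroup (E →L[ℝ] E →L[ℝ] ℝ) := inferInstance

noncomputable abbrev instNormedSpaceBilin : NormedSpace ℝ (E →L[ℝ] E →L[ℝ] ℝ) := inferInstance

end Instances

attribute [local instance] instNormedAddCommGroupBilin instNormedSpaceBilin

/-! ### The fibre Hessian as a derivative in two parameters -/

section FibreDerivatives

variable {E : Type*} [NormedAddCommGroup E] [NormedSpace ℝ E]

/-- The fibre Hessian as an iterated derivative along two parameters. -/
lemma deriv_deriv_fibre {L : E × E → ℝ} {z v : E} (hL : ContDiffAt ℝ 2 L (z, v)) (u w : E) :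
    deriv (fun s : ℝ => deriv (fun t : ℝ => L (z, v + s • u + t • w)) 0) 0 =
      fderiv ℝ (fderiv ℝ L) (z, v) (0, u) (0, w) := by
  have hc : ∀ a b : E, HasDerivAt (fun t : ℝ => ((z, a + t • b) : E × E)) (0, b) 0 := by
    intro a b
    have h1 : HasDerivAt (fun t : ℝ => a + t • b) b 0 := by
      simpa using ((hasDerivAt_id (0 : ℝ)).smul_const b).const_add a
    exact (hasDerivAt_const (0 : ℝ) z).prodMk h1
  have h1 : (fun s : ℝ => deriv (fun t : ℝ => L (z, v + s • u + t • w)) 0) =ᶠ[𝓝 0]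
      fun s => fderiv ℝ L (z, v + s • u) (0, w) := by
    have hcont : Filter.Tendsto (fun s : ℝ => ((z, v + s • u) : E × E)) (𝓝 0) (𝓝 (z, v)) := by
      have := (hc v u).continuousAt.tendsto
      simpa using this
    filter_upwards [hcont.eventually (ContDiffAt.eventually_differentiableAt hL)] with s hs
    have hs' : HasFDerivAt L (fderiv ℝ L (z, v + s • u)) (z, v + s • u + (0 : ℝ) • w) := by
      simpa using hs.hasFDerivAt
    exact (hs'.comp_hasDerivAt (0 : ℝ) (hc (v + s • u) w)).deriv
  rw [h1.deriv_eq]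
  have h2 : HasFDerivAt (fderiv ℝ L) (fderiv ℝ (fderiv ℝ L) (z, v)) (z, v + (0 : ℝ) • u) := by
    simpa using (ContDiffAt.differentiableAt_fderiv hL).hasFDerivAt
  have h3 := (h2.comp_hasDerivAt (0 : ℝ) (hc v u)).clm_apply (hasDerivAt_const (0 : ℝ) ((0 : E), w))
  have h4 := h3.deriv
  simp only [map_zero, add_zero] at h4
  exact h4

end FibreDerivatives

/-! ### Sprays and nondegeneracy of `f(α², β)` from the 2-jet of `f` -/

section QuadraticData

variable {E : Type*} [NormedAddCommGroup E] [NormedSpace ℝ E]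
  {A : E → E →L[ℝ] E →L[ℝ] ℝ} {B : E → E →L[ℝ] ℝ} {z v : E}

lemma contDiffAt_quad {k : WithTop ℕ∞} (hA : ContDiffAt ℝ k A z) :
    ContDiffAt ℝ k (fun x : E × E => A x.1 x.2 x.2) (z, v) := by
  have h1 : ContDiffAt ℝ k (fun x : E × E => A x.1) (z, v) := hA.comp (z, v) contDiffAt_fst
  exact (h1.clm_apply contDiffAt_snd).clm_apply contDiffAt_snd

lemma contDiffAt_lin {k : WithTop ℕ∞} (hB : ContDiffAt ℝ k B z) :
    ContDiffAt ℝ k (fun x : E × E => B x.1 x.2) (z, v) := by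
  have h1 : ContDiffAt ℝ k (fun x : E × E => B x.1) (z, v) := hB.comp (z, v) contDiffAt_fst
  exact h1.clm_apply contDiffAt_snd

lemma fderiv_quad (hsymm : ∀ z u w, A z u w = A z w u) (hA : DifferentiableAt ℝ A z) (b : E × E) :
    fderiv ℝ (fun x : E × E => A x.1 x.2 x.2) (z, v) b =
      fderiv ℝ A z b.1 v v + 2 * A z v b.2 := by
  have h1 : HasFDerivAt (fun x : E × E => A x.1) _ (z, v) :=
    HasFDerivAt.comp (g := A) (f := Prod.fst) (z, v) hA.hasFDerivAt (hasFDerivAt_fst (p := (z, v)))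
  have h2 := (h1.clm_apply (hasFDerivAt_snd (p := (z, v)))).clm_apply
    (hasFDerivAt_snd (p := (z, v)))
  rw [h2.fderiv]
  simp [hsymm z b.2 v]
  ring

lemma fderiv_lin (hB : DifferentiableAt ℝ B z) (b : E × E) :
    fderiv ℝ (fun x : E × E => B x.1 x.2) (z, v) b = fderiv ℝ B z b.1 v + B z b.2 := by
  have h1 : HasFDerivAt (fun x : E × E => B x.1) _ (z, v) :=
    HasFDerivAt.comp (g := B) (f := Prod.fst) (z, v) hB.hasFDerivAt hasFDerivAt_fst
  have h2 := (h1.clm_apply (hasFDerivAt_snd (p := (z, v))))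
  rw [h2.fderiv]
  simp
  ring

/-- The geodesic equation and the fibre Hessian only involve second derivatives with one vertical
direction, so second derivatives of `A` in the base never enter. -/
lemma fderiv_fderiv_quad (hsymm : ∀ z u w, A z u w = A z w u) (hA : ContDiffAt ℝ 2 A z)
    (a : E × E) (w : E) :
    fderiv ℝ (fderiv ℝ (fun x : E × E => A x.1 x.2 x.2)) (z, v) a (0, w) =
      2 * (fderiv ℝ A z a.1 v w + A z a.2 w) := by
  rw [← fderiv_fderiv_apply (contDiffAt_quad hA)]
  have h0 : (fun x : E × E => fderiv ℝ (fun x : E × E => A x.1 x.2 x.2) x (0, w)) =ᶠ[𝓝 (z, v)]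
      fun x => 2 * A x.1 x.2 w := by
    have h1 : ∀ᶠ x : E × E in 𝓝 (z, v), DifferentiableAt ℝ A x.1 :=
      continuousAt_fst.eventually (ContDiffAt.eventually_differentiableAt hA)
    filter_upwards [h1] with x hx
    rw [show x = (x.1, x.2) from rfl, fderiv_quad hsymm hx]
    simp
  rw [h0.fderiv_eq]
  have h1 : HasFDerivAt (fun x : E × E => A x.1) _ (z, v) :=
    HasFDerivAt.comp (g := A) (f := Prod.fst) (z, v)
      (hA.differentiableAt (by norm_num)).hasFDerivAt hasFDerivAt_fst
  have h2 := ((h1.clm_apply (hasFDerivAt_snd (p := (z, v)))).clm_apply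
    (hasFDerivAt_const w (z, v))).const_mul 2
  rw [h2.fderiv]
  simp
  ring

lemma fderiv_fderiv_lin (hB : ContDiffAt ℝ 2 B z) (a : E × E) (w : E) :
    fderiv ℝ (fderiv ℝ (fun x : E × E => B x.1 x.2)) (z, v) a (0, w) = fderiv ℝ B z a.1 w := by
  rw [← fderiv_fderiv_apply (contDiffAt_lin hB)]
  have h0 : (fun x : E × E => fderiv ℝ (fun x : E × E => B x.1 x.2) x (0, w)) =ᶠ[𝓝 (z, v)]
      fun x => B x.1 w := by
    have h1 : ∀ᶠ x : E × E in 𝓝 (z, v), DifferentiableAt ℝ B x.1 :=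
      continuousAt_fst.eventually (ContDiffAt.eventually_differentiableAt hB)
    filter_upwards [h1] with x hx
    rw [show x = (x.1, x.2) from rfl, fderiv_lin hx]
    simp
  rw [h0.fderiv_eq]
  have h1 : HasFDerivAt (fun x : E × E => B x.1) _ (z, v) :=
    HasFDerivAt.comp (g := B) (f := Prod.fst) (z, v)
      (hB.differentiableAt (by norm_num)).hasFDerivAt hasFDerivAt_fst
  have h2 := (h1.clm_apply (hasFDerivAt_const w (z, v)))
  rw [h2.fderiv]
  simp

/-- The 2-jet of `f : ℝ × ℝ → ℝ` at a point. -/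
structure HasJet (f : ℝ × ℝ → ℝ) (m : ℝ × ℝ) (fp fb fpp fpb fbb : ℝ) : Prop where
  contDiffAt : ContDiffAt ℝ 2 f m
  fst : ∀ c, fderiv ℝ f m c = fp * c.1 + fb * c.2
  snd : ∀ c d, fderiv ℝ (fderiv ℝ f) m c d =
    fpp * (c.1 * d.1) + fpb * (c.1 * d.2 + c.2 * d.1) + fbb * (c.2 * d.2)

lemma HasJet.of_hasFDerivAt {f Fp Fb : ℝ × ℝ → ℝ} {m : ℝ × ℝ} {fpp fpb fbb : ℝ}
    (hf : ContDiffAt ℝ 2 f m)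
    (h : ∀ᶠ x in 𝓝 m, HasFDerivAt f
      (Fp x • ContinuousLinearMap.fst ℝ ℝ ℝ + Fb x • ContinuousLinearMap.snd ℝ ℝ ℝ) x)
    (hp : HasFDerivAt Fp
      (fpp • ContinuousLinearMap.fst ℝ ℝ ℝ + fpb • ContinuousLinearMap.snd ℝ ℝ ℝ) m)
    (hb : HasFDerivAt Fb
      (fpb • ContinuousLinearMap.fst ℝ ℝ ℝ + fbb • ContinuousLinearMap.snd ℝ ℝ ℝ) m) :
    HasJet f m (Fp m) (Fb m) fpp fpb fbb where
  contDiffAt := hf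
  fst c := by rw [h.self_of_nhds.fderiv]; simp
  snd c d := by
    have h1 : fderiv ℝ f =ᶠ[𝓝 m] fun x =>
        Fp x • ContinuousLinearMap.fst ℝ ℝ ℝ + Fb x • ContinuousLinearMap.snd ℝ ℝ ℝ := by
      filter_upwards [h] with x hx using hx.fderiv
    rw [h1.fderiv_eq]
    have h2 := (hp.smul_const (ContinuousLinearMap.fst ℝ ℝ ℝ)).add
      (hb.smul_const (ContinuousLinearMap.snd ℝ ℝ ℝ))
    refine (congrArg (fun φ => φ c d) h2.fderiv).trans ?_
    simp
    ring

variable {f : ℝ × ℝ → ℝ} {fp fb fpp fpb fbb : ℝ}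

lemma contDiffAt_data {k : WithTop ℕ∞} (hA : ContDiffAt ℝ k A z) (hB : ContDiffAt ℝ k B z) :
    ContDiffAt ℝ k (fun x : E × E => ((A x.1 x.2 x.2, B x.1 x.2) : ℝ × ℝ)) (z, v) :=
  (contDiffAt_quad hA).prodMk (contDiffAt_lin hB)

section Jet

variable (hsymm : ∀ z u w, A z u w = A z w u) (hA : ContDiffAt ℝ 2 A z) (hB : ContDiffAt ℝ 2 B z)

include hsymm hA hB

lemma fderiv_data (b : E × E) :
    fderiv ℝ (fun x : E × E => ((A x.1 x.2 x.2, B x.1 x.2) : ℝ × ℝ)) (z, v) b =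
      (fderiv ℝ A z b.1 v v + 2 * A z v b.2, fderiv ℝ B z b.1 v + B z b.2) := by
  have h1 := ((contDiffAt_quad (v := v) hA).differentiableAt (by norm_num)).hasFDerivAt.prodMk
    ((contDiffAt_lin (v := v) hB).differentiableAt (by norm_num)).hasFDerivAt
  rw [h1.fderiv, ContinuousLinearMap.prod_apply,
    fderiv_quad hsymm (hA.differentiableAt (by norm_num)),
    fderiv_lin (hB.differentiableAt (by norm_num))]

lemma fderiv_fderiv_data (a : E × E) (w : E) :
    fderiv ℝ (fderiv ℝ (fun x : E × E => ((A x.1 x.2 x.2, B x.1 x.2) : ℝ × ℝ))) (z, v) a (0, w) =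
      (2 * (fderiv ℝ A z a.1 v w + A z a.2 w), fderiv ℝ B z a.1 w) := by
  have hp := contDiffAt_quad (v := v) hA
  have hb := contDiffAt_lin (v := v) hB
  rw [← fderiv_fderiv_apply (contDiffAt_data hA hB)]
  have h0 : (fun x : E × E => fderiv ℝ (fun x : E × E => ((A x.1 x.2 x.2, B x.1 x.2) : ℝ × ℝ)) x
      (0, w)) =ᶠ[𝓝 (z, v)] fun x => (fderiv ℝ (fun x : E × E => A x.1 x.2 x.2) x (0, w),
        fderiv ℝ (fun x : E × E => B x.1 x.2) x (0, w)) := by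
    filter_upwards [ContDiffAt.eventually_differentiableAt hp,
      ContDiffAt.eventually_differentiableAt hb] with x h1 h2
    rw [(h1.hasFDerivAt.prodMk h2.hasFDerivAt).fderiv, ContinuousLinearMap.prod_apply]
  rw [h0.fderiv_eq]
  have d1 : DifferentiableAt ℝ (fun x => fderiv ℝ (fun x : E × E => A x.1 x.2 x.2) x (0, w))
      (z, v) := (ContDiffAt.differentiableAt_fderiv hp).clm_apply (by fun_prop)
  have d2 : DifferentiableAt ℝ (fun x => fderiv ℝ (fun x : E × E => B x.1 x.2) x (0, w))
      (z, v) := (ContDiffAt.differentiableAt_fderiv hb).clm_apply (by fun_prop)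
  rw [(d1.hasFDerivAt.prodMk d2.hasFDerivAt).fderiv, ContinuousLinearMap.prod_apply,
    fderiv_fderiv_apply hp, fderiv_fderiv_apply hb, fderiv_fderiv_quad hsymm hA,
    fderiv_fderiv_lin hB]

variable (hf : HasJet f (A z v v, B z v) fp fb fpp fpb fbb)

include hf

lemma HasJet.fderiv_fderiv_comp (a : E × E) (w : E) :
    fderiv ℝ (fderiv ℝ (fun x : E × E => f (A x.1 x.2 x.2, B x.1 x.2))) (z, v) a (0, w) =
      (fpp * (fderiv ℝ A z a.1 v v + 2 * A z v a.2) + fpb * (fderiv ℝ B z a.1 v + B z a.2)) *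
          (2 * A z v w) +
        (fpb * (fderiv ℝ A z a.1 v v + 2 * A z v a.2) + fbb * (fderiv ℝ B z a.1 v + B z a.2)) *
          B z w +
        fp * (2 * (fderiv ℝ A z a.1 v w + A z a.2 w)) + fb * fderiv ℝ B z a.1 w := by
  have h := Kropina.fderiv_fderiv_comp (f := f) (m := fun x : E × E => (A x.1 x.2 x.2, B x.1 x.2))
    (x := (z, v)) hf.contDiffAt (contDiffAt_data hA hB) a (0, w)
  rw [h, fderiv_data hsymm hA hB, fderiv_data hsymm hA hB, fderiv_fderiv_data hsymm hA hB,
    hf.fst, hf.snd]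
  simp
  ring

lemma HasJet.fderiv_comp (b : E × E) :
    fderiv ℝ (fun x : E × E => f (A x.1 x.2 x.2, B x.1 x.2)) (z, v) b =
      fp * (fderiv ℝ A z b.1 v v + 2 * A z v b.2) + fb * (fderiv ℝ B z b.1 v + B z b.2) := by
  have h := fderiv_fun_comp (g := f) (f := fun x : E × E => (A x.1 x.2 x.2, B x.1 x.2)) (z, v)
    (hf.contDiffAt.differentiableAt (by norm_num))
    ((contDiffAt_data hA hB).differentiableAt (by norm_num))
  rw [h, ContinuousLinearMap.comp_apply, fderiv_data hsymm hA hB, hf.fst]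

end Jet

/-- `G` is the vector of spray coefficients, at `(z, v)`, of the quadratic form `A`. -/
def IsGeod (A : E → E →L[ℝ] E →L[ℝ] ℝ) (z v G : E) : Prop :=
  ∀ w, 4 * A z G w = 2 * fderiv ℝ A z v v w - fderiv ℝ A z w v v

lemma isSpray_quad_iff (hsymm : ∀ z u w, A z u w = A z w u) (hA : ContDiffAt ℝ 2 A z) {G : E} :
    IsSpray (fun x : E × E => A x.1 x.2 x.2) z v G ↔ IsGeod A z v G := by
  refine forall_congr' fun w => ?_
  rw [fderiv_fderiv_quad hsymm hA, fderiv_fderiv_quad hsymm hA,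
    fderiv_quad hsymm (hA.differentiableAt (by norm_num))]
  simp only [map_zero, map_smul, _root_.zero_apply, _root_.smul_apply, smul_eq_mul]
  constructor <;> intro h <;> linarith

lemma fibreNondeg_quad (hsymm : ∀ z u w, A z u w = A z w u) (hA : ContDiffAt ℝ 2 A z)
    (hpos : ∀ u, u ≠ 0 → 0 < A z u u) :
    FibreNondeg (fun x : E × E => A x.1 x.2 x.2) z v := by
  intro u hu
  by_contra h0
  have := hu u
  rw [fderiv_fderiv_quad hsymm hA] at this
  simp only [map_zero, _root_.zero_apply] at this
  linarith [hpos u h0]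

/-- The components of an `(α, β)`-metric, at a fixed tangent vector `v`: the metric, the 1-form,
the vector `b` dual to the 1-form, the vector `σ v` with components `sⁱ₀`, and `r₀₀`. -/
structure IsFrame (A : E → E →L[ℝ] E →L[ℝ] ℝ) (B : E → E →L[ℝ] ℝ) (z v b sv Ga : E) (r : ℝ) :
    Prop where
  symm : ∀ z u w, A z u w = A z w u
  pos : ∀ u, u ≠ 0 → 0 < A z u u
  contDiffAt_left : ContDiffAt ℝ 2 A z
  contDiffAt_right : ContDiffAt ℝ 2 B z
  dual : ∀ w, A z b w = B z w
  curl : ∀ w, 2 * A z sv w = fderiv ℝ B z v w - fderiv ℝ B z w v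
  geod : IsGeod A z v Ga
  sym : r = fderiv ℝ B z v v - 2 * B z Ga

variable {b sv Ga X : E} {r : ℝ}

/-- Write the unknown spray as that of `α` plus `X`. The geodesic equation of `α` absorbs the
derivatives of `A`; those of `B` combine into their curl, which is `sv`, and into `r`. What is left
is the purely algebraic equation `hX`. -/
lemma IsFrame.isSpray (h : IsFrame A B z v b sv Ga r)
    (hf : HasJet f (A z v v, B z v) fp fb fpp fpb fbb)
    (hX : ∀ w, (fpp * (4 * A z v X) + fpb * (2 * B z X - r)) * (2 * A z v w) +
      (fpb * (4 * A z v X) + fbb * (2 * B z X - r)) * B z w + 4 * fp * A z X w =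
        2 * fb * A z sv w) :
    IsSpray (fun x : E × E => f (A x.1 x.2 x.2, B x.1 x.2)) z v (Ga + X) := by
  intro w
  rw [hf.fderiv_fderiv_comp h.symm h.contDiffAt_left h.contDiffAt_right,
    hf.fderiv_fderiv_comp h.symm h.contDiffAt_left h.contDiffAt_right,
    hf.fderiv_comp h.symm h.contDiffAt_left h.contDiffAt_right]
  have h1 := hX w
  have h2 := h.geod w
  have h3 := h.geod v
  have h4 := h.curl w
  have h5 := h.sym
  have h6 := h.symm z Ga v
  simp only [map_zero, map_smul, map_add, _root_.zero_apply, _root_.smul_apply, smul_eq_mul,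
    _root_.add_apply]
  rw [h5] at h1
  linear_combination h1 + fp * h2 + fb * h4 + (fpp * 2 * A z v w + fpb * B z w) * h3 -
    4 * (fpp * 2 * A z v w + fpb * B z w) * h6

/-- The denominator of the spray coefficients of `F² = f(α², β)`. -/
noncomputable def sprayDen (fp fb fpp fpb fbb β b2 : ℝ) : ℝ :=
  2 * fp + (fbb - fpb * fb / fp) * b2 + 2 * β * (fpb - fpp * fb / fp)

/-- The correction to the spray of `α` in the spray coefficients of `F² = f(α², β)`. -/
noncomputable def sprayCorr (fp fb fpp fpb fbb ρ : ℝ) (v b sv : E) : E :=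
  (1 / (4 * fp)) • ((2 * fb) • sv + (ρ * (fbb - fpb * fb / fp)) • b +
    (2 * ρ * (fpb - fpp * fb / fp)) • v)

/-- `e1` and `e2` are the Euler relations expressing that `f` is homogeneous of degree two in `y`
when `α²` has weight two and `β` weight one. They reduce the algebraic equation to one scalar
unknown `ρ`, the value of `r - 2β(X)`, and `hρ` is the linear equation for it. -/
lemma IsFrame.isSpray_sprayCorr (h : IsFrame A B z v b sv Ga r)
    (hf : HasJet f (A z v v, B z v) fp fb fpp fpb fbb) (hfp : fp ≠ 0)
    (e1 : 2 * A z v v * fpp + B z v * fpb = 0) (e2 : 2 * A z v v * fpb + B z v * fbb = fb)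
    {ρ : ℝ} (hρ : ρ * sprayDen fp fb fpp fpb fbb (B z v) (B z b) = 2 * fp * r - 2 * fb * B z sv) :
    IsSpray (fun x : E × E => f (A x.1 x.2 x.2, B x.1 x.2)) z v
      (Ga + sprayCorr fp fb fpp fpb fbb ρ v b sv) := by
  refine h.isSpray hf fun w => ?_
  set X := sprayCorr fp fb fpp fpb fbb ρ v b sv with hX
  set κ := fbb - fpb * fb / fp with hκ
  set ν := fpb - fpp * fb / fp with hν
  have hsv : A z v sv = 0 := by
    have := h.curl v
    rw [h.symm z v sv]; linarith
  have hlin : ∀ φ : E →L[ℝ] ℝ, 4 * fp * φ X = 2 * fb * φ sv + ρ * κ * φ b + 2 * ρ * ν * φ v := by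
    intro φ
    rw [hX, sprayCorr]
    simp only [map_smul, map_add, smul_eq_mul]
    field_simp
    rw [hκ, hν]
    field_simp
  -- Pairing the ansatz for `X` with `β` turns `hρ` into the consistency condition for `ρ`.
  have hη : 2 * B z X - r = - ρ := by
    have h1 := hlin (B z)
    rw [sprayDen, ← hκ, ← hν] at hρ
    have : 2 * fp * (2 * B z X - r) = 2 * fp * (-ρ) := by linarith
    exact mul_left_cancel₀ (by simpa using hfp) this
  have hβ : A z v b = B z v := by rw [h.symm z v b, h.dual]
  have hfb : κ * B z v + 2 * ν * A z v v = fb := by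
    rw [hκ, hν]
    have : (fbb - fpb * fb / fp) * B z v + 2 * (fpb - fpp * fb / fp) * A z v v =
      (2 * A z v v * fpb + B z v * fbb) - fb / fp * (2 * A z v v * fpp + B z v * fpb) := by ring
    rw [this, e1, e2]; ring
  have hξ : 4 * A z v X = ρ * fb / fp := by
    have h1 := hlin (A z v)
    rw [hsv, hβ] at h1
    rw [eq_div_iff hfp]
    linear_combination h1 + ρ * hfb
  have hw : 4 * fp * A z X w = 2 * fb * A z sv w + ρ * κ * B z w + 2 * ρ * ν * A z v w := by
    have h1 := hlin ((A z).flip w)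
    simpa [h.dual] using h1
  rw [hη, hξ, hw, hκ, hν]
  field_simp
  ring

/-- The fibre Hessian is `2 f_p A` plus a form of rank at most two built from `α² ` and `β`, so a
kernel vector lies in the span of `v` and `b`. The Euler relations fix its direction, and pairing
with `b` leaves the scalar condition on `sprayDen`. -/
lemma IsFrame.fibreNondeg (h : IsFrame A B z v b sv Ga r)
    (hf : HasJet f (A z v v, B z v) fp fb fpp fpb fbb) (hfp : fp ≠ 0)
    (e1 : 2 * A z v v * fpp + B z v * fpb = 0) (e2 : 2 * A z v v * fpb + B z v * fbb = fb) :
    FibreNondeg (fun x : E × E => f (A x.1 x.2 x.2, B x.1 x.2)) z v ↔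
      sprayDen fp fb fpp fpb fbb (B z v) (B z b) ≠ 0 := by
  have hess : ∀ u w,
      fderiv ℝ (fderiv ℝ (fun x : E × E => f (A x.1 x.2 x.2, B x.1 x.2))) (z, v) (0, u) (0, w) =
      (fpp * (2 * A z v u) + fpb * B z u) * (2 * A z v w) +
        (fpb * (2 * A z v u) + fbb * B z u) * B z w + 2 * fp * A z u w := by
    intro u w
    rw [hf.fderiv_fderiv_comp h.symm h.contDiffAt_left h.contDiffAt_right]
    simp only [map_zero, _root_.zero_apply]
    ring
  have hb : A z v b = B z v := by rw [h.symm z v b, h.dual]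
  constructor
  · intro hn h0
    -- When the denominator vanishes this vector is in the kernel; it is nonzero because `β` takes
    -- the value `-2 f_p` on it.
    have hu := hn ((2 * (fpb - fpp * fb / fp)) • v + (fbb - fpb * fb / fp) • b) fun w => by
      rw [hess]
      simp only [map_smul, map_add, smul_eq_mul, _root_.smul_apply, _root_.add_apply, h.dual, hb]
      have hη : 2 * (fpb - fpp * fb / fp) * B z v + (fbb - fpb * fb / fp) * B z b = - (2 * fp) := by
        rw [sprayDen] at h0; linarith
      have hξ : 2 * (fpb - fpp * fb / fp) * A z v v + (fbb - fpb * fb / fp) * B z v = fb := by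
        have : 2 * (fpb - fpp * fb / fp) * A z v v + (fbb - fpb * fb / fp) * B z v =
          (2 * A z v v * fpb + B z v * fbb) - fb / fp * (2 * A z v v * fpp + B z v * fpb) := by ring
        rw [this, e1, e2]; ring
      rw [hη, hξ]
      field_simp
      ring
    have h1 := congrArg (B z) hu
    simp only [map_smul, map_add, smul_eq_mul, map_zero] at h1
    rw [sprayDen] at h0
    exact hfp (by linarith)
  · intro hD u hu
    set ξ := 2 * A z v u with hξ
    set η := B z u with hη
    have h1 := hu v
    rw [hess, h.symm z u v] at h1
    -- Testing against `v` itself: by the Euler relations all second-order terms collapse to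
    -- first-order ones.
    have h2 : fp * ξ + fb * η = 0 := by
      linear_combination h1 - ξ * e1 - η * e2
    have h3 : ξ = - (fb * η) / fp := by
      rw [eq_div_iff hfp]; linarith
    have h4 : ∀ w, 2 * fp * A z u w =
        - η * (2 * (fpb - fpp * fb / fp) * A z v w + (fbb - fpb * fb / fp) * B z w) := by
      intro w
      have h5 := hu w
      rw [hess, ← hξ, ← hη, h3] at h5
      have : (fpp * (-(fb * η) / fp) + fpb * η) * (2 * A z v w) +
        (fpb * (-(fb * η) / fp) + fbb * η) * B z w =
        η * (2 * (fpb - fpp * fb / fp) * A z v w + (fbb - fpb * fb / fp) * B z w) := by ring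
      linarith
    have h5 := h4 b
    rw [h.symm z u b, h.dual, hb, ← hη] at h5
    have h6 : η * sprayDen fp fb fpp fpb fbb (B z v) (B z b) = 0 := by
      rw [sprayDen]; linarith
    have h7 : η = 0 := (mul_eq_zero.1 h6).resolve_right hD
    by_contra h0
    have h8 := h4 u
    rw [h7] at h8
    have := h.pos u h0
    have h9 : fp * A z u u = 0 := by linarith
    exact (mul_ne_zero hfp this.ne') h9

end QuadraticData

/-! ### The 2-jet of the squared Kropina metric -/

section KropinaJet

lemma HasFDerivAt.fun_quot {f g : ℝ × ℝ → ℝ} {f' g' : ℝ × ℝ →L[ℝ] ℝ} {m : ℝ × ℝ}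
    (hf : HasFDerivAt f f' m) (hg : HasFDerivAt g g' m) (h0 : g m ≠ 0) :
    HasFDerivAt (fun x => f x / g x) ((1 / g m) • f' - (f m / g m ^ 2) • g') m := by
  have h1 := hf.fun_mul ((hasDerivAt_inv h0).comp_hasFDerivAt m hg)
  refine h1.congr_fderiv ?_
  ext <;> simp <;> ring


/-- The function of `(α², β)` giving the square of the Kropina metric. -/
noncomputable def kropinaFun (m : ℝ × ℝ) : ℝ := (m.1 / m.2) ^ 2

lemma hasFDerivAt_of_partials {f : ℝ × ℝ → ℝ} {f' : ℝ × ℝ →L[ℝ] ℝ} {m : ℝ × ℝ} {a b : ℝ}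
    (h : HasFDerivAt f f' m) (ha : f' (1, 0) = a) (hb : f' (0, 1) = b) :
    HasFDerivAt f (a • ContinuousLinearMap.fst ℝ ℝ ℝ + b • ContinuousLinearMap.snd ℝ ℝ ℝ) m := by
  convert h using 1
  ext <;> simp [ha, hb]

lemma hasJet_kropinaFun {p β : ℝ} (hβ : β ≠ 0) :
    HasJet kropinaFun (p, β) (2 * p / β ^ 2) (-2 * p ^ 2 / β ^ 3) (2 / β ^ 2) (-4 * p / β ^ 3)
      (6 * p ^ 2 / β ^ 4) := by
  refine HasJet.of_hasFDerivAt (Fp := fun m => 2 * m.1 / m.2 ^ 2)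
    (Fb := fun m => -2 * m.1 ^ 2 / m.2 ^ 3) ?_ ?_ ?_ ?_
  · exact (contDiffAt_fst.div contDiffAt_snd hβ).pow 2
  · have : ∀ᶠ m : ℝ × ℝ in 𝓝 (p, β), m.2 ≠ 0 := continuousAt_snd.eventually_ne hβ
    filter_upwards [this] with m hm
    refine hasFDerivAt_of_partials ((HasFDerivAt.fun_quot (hasFDerivAt_fst (𝕜 := ℝ) (p := m))
      (hasFDerivAt_snd (𝕜 := ℝ) (p := m)) hm).pow 2) ?_ ?_
    · simp; field_simp
    · simp; field_simp
  · refine hasFDerivAt_of_partials (HasFDerivAt.fun_quot ((hasFDerivAt_fst (𝕜 := ℝ) (p := (p, β))).const_mul 2)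
      ((hasFDerivAt_snd (𝕜 := ℝ) (p := (p, β))).pow 2) (pow_ne_zero 2 hβ)) ?_ ?_
    · simp; field_simp
    · simp; field_simp; ring
  · refine hasFDerivAt_of_partials (HasFDerivAt.fun_quot (((hasFDerivAt_fst (𝕜 := ℝ) (p := (p, β))).pow 2).const_mul
      (-2)) ((hasFDerivAt_snd (𝕜 := ℝ) (p := (p, β))).pow 3) (pow_ne_zero 3 hβ)) ?_ ?_
    · simp; field_simp; ring
    · simp; field_simp; ring

end KropinaJet

/-! ### The 2-jet of the square of `β^q / (β - α)^(q-1)` -/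

section QJet

/-- The function of `(α², β)` giving the metric `β^q / (β - α)^(q-1)`. -/
noncomputable def qRoot (q : ℝ) (m : ℝ × ℝ) : ℝ := m.2 ^ q / (m.2 - √m.1) ^ (q - 1)

/-- The function of `(α², β)` giving the square of the metric `β^q / (β - α)^(q-1)`. -/
noncomputable def qFun (q : ℝ) (m : ℝ × ℝ) : ℝ := qRoot q m ^ 2

variable {q : ℝ} {m : ℝ × ℝ}

lemma contDiffAt_qRoot (hp : 0 < m.1) (hm : √m.1 < m.2) {k : WithTop ℕ∞} :
    ContDiffAt ℝ k (qRoot q) m := by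
  have h0 : 0 < m.2 := (Real.sqrt_nonneg _).trans_lt hm
  refine ContDiffAt.div ?_ ?_ (Real.rpow_pos_of_pos (by linarith) _).ne'
  · exact contDiffAt_snd.rpow_const_of_ne h0.ne'
  · exact (contDiffAt_snd.sub (contDiffAt_fst.sqrt hp.ne')).rpow_const_of_ne (by
      have : 0 < m.2 - √m.1 := by linarith
      exact this.ne')

lemma qRoot_pos (hm : √m.1 < m.2) : 0 < qRoot q m := by
  have h0 : 0 < m.2 := (Real.sqrt_nonneg _).trans_lt hm
  exact div_pos (Real.rpow_pos_of_pos h0 _) (Real.rpow_pos_of_pos (by linarith) _)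

lemma qFun_pos (hm : √m.1 < m.2) : 0 < qFun q m := pow_pos (qRoot_pos hm) 2

lemma hasFDerivAt_sqrt_fst (hp : 0 < m.1) :
    HasFDerivAt (fun m : ℝ × ℝ => √m.1) ((1 / (2 * √m.1)) • ContinuousLinearMap.fst ℝ ℝ ℝ) m :=
  (hasFDerivAt_fst (𝕜 := ℝ) (p := m)).sqrt hp.ne'

lemma hasFDerivAt_qRoot (hp : 0 < m.1) (hm : √m.1 < m.2) :
    HasFDerivAt (qRoot q)
      ((qRoot q m * (q - 1) / (2 * √m.1 * (m.2 - √m.1))) • ContinuousLinearMap.fst ℝ ℝ ℝ +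
       (qRoot q m * (m.2 - q * √m.1) / (m.2 * (m.2 - √m.1))) •
        ContinuousLinearMap.snd ℝ ℝ ℝ) m := by
  have h0 : 0 < m.2 := (Real.sqrt_nonneg _).trans_lt hm
  have hα : 0 < √m.1 := Real.sqrt_pos.2 hp
  have hγ : 0 < m.2 - √m.1 := by linarith
  have h1 := (hasFDerivAt_snd (𝕜 := ℝ) (p := m)).rpow_const (p := q) (Or.inl h0.ne')
  have h2 := ((hasFDerivAt_snd (𝕜 := ℝ) (p := m)).fun_sub (hasFDerivAt_sqrt_fst hp)).rpow_const
    (p := q - 1) (Or.inl hγ.ne')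
  have hγ1 : (m.2 - √m.1) ^ (q - 1) ≠ 0 := (Real.rpow_pos_of_pos hγ _).ne'
  have h3 := HasFDerivAt.fun_quot h1 h2 hγ1
  have e1 : m.2 ^ (q - 1) = m.2 ^ q / m.2 := Real.rpow_sub_one h0.ne' q
  have e2 : (m.2 - √m.1) ^ (q - 1 - 1) = (m.2 - √m.1) ^ (q - 1) / (m.2 - √m.1) :=
    Real.rpow_sub_one hγ.ne' (q - 1)
  refine hasFDerivAt_of_partials h3 ?_ ?_
  · simp only [e1, e2, qRoot]
    simp
    field_simp
  · simp only [e1, e2, qRoot]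
    simp
    field_simp
    ring

/-- The derivative of `qFun` along `α²`. -/
noncomputable def qFunP (q : ℝ) (m : ℝ × ℝ) : ℝ :=
  qRoot q m ^ 2 * ((q - 1) / (√m.1 * (m.2 - √m.1)))

/-- The derivative of `qFun` along `β`. -/
noncomputable def qFunB (q : ℝ) (m : ℝ × ℝ) : ℝ :=
  qRoot q m ^ 2 * (2 * (m.2 - q * √m.1) / (m.2 * (m.2 - √m.1)))

/-- The pure second derivative along `α²` is given through the mixed one by the Euler relation, so
that this relation later holds by cancellation. -/
lemma hasJet_qFun (hp : 0 < m.1) (hm : √m.1 < m.2) :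
    HasJet (qFun q) m (qFunP q m) (qFunB q m)
      (-(m.2 * ((q - 1) * qFun q m * (m.2 - 2 * q * √m.1) /
        (√m.1 * m.2 * (m.2 - √m.1) ^ 2))) / (2 * m.1))
      ((q - 1) * qFun q m * (m.2 - 2 * q * √m.1) / (√m.1 * m.2 * (m.2 - √m.1) ^ 2))
      (2 * qFun q m / (m.2 ^ 2 * (m.2 - √m.1) ^ 2) *
        (m.2 ^ 2 - 2 * q * √m.1 * m.2 + q * (2 * q - 1) * √m.1 ^ 2)) := by
  have h0 : 0 < m.2 := (Real.sqrt_nonneg _).trans_lt hm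
  have hα : 0 < √m.1 := Real.sqrt_pos.2 hp
  have hγ : 0 < m.2 - √m.1 := by linarith
  have hsq : m.1 = √m.1 ^ 2 := (Real.sq_sqrt hp.le).symm
  have hR := hasFDerivAt_qRoot (q := q) hp hm
  have hS := hasFDerivAt_sqrt_fst hp
  have hb := hasFDerivAt_snd (𝕜 := ℝ) (p := m)
  refine HasJet.of_hasFDerivAt (Fp := qFunP q) (Fb := qFunB q)
    ((contDiffAt_qRoot hp hm).pow 2) ?_ ?_ ?_
  · have hev : ∀ᶠ m' : ℝ × ℝ in 𝓝 m, 0 < m'.1 ∧ √m'.1 < m'.2 :=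
      (continuousAt_fst.eventually_const_lt hp).and
        ((Real.continuous_sqrt.continuousAt.comp continuousAt_fst).eventually_lt
          continuousAt_snd hm)
    filter_upwards [hev] with m' ⟨hp', hm'⟩
    have h0 : 0 < m'.2 := (Real.sqrt_nonneg _).trans_lt hm'
    have hα : 0 < √m'.1 := Real.sqrt_pos.2 hp'
    have hγ : 0 < m'.2 - √m'.1 := by linarith
    refine hasFDerivAt_of_partials ((hasFDerivAt_qRoot (q := q) hp' hm').pow 2) ?_ ?_
    · simp [qFunP]; field_simp
    · simp [qFunB]; field_simp
  · refine hasFDerivAt_of_partials ((hR.pow 2).fun_mul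
      (HasFDerivAt.fun_quot (hasFDerivAt_const (q - 1) m) (hS.fun_mul (hb.fun_sub hS))
        (mul_pos hα hγ).ne')) ?_ ?_
    · simp [qFun]
      rw [hsq, Real.sqrt_sq hα.le]
      generalize √m.1 = α at *
      field_simp
      ring
    · simp [qFun]
      generalize √m.1 = α at *
      field_simp
      ring
  · refine hasFDerivAt_of_partials ((hR.pow 2).fun_mul
      (HasFDerivAt.fun_quot ((hb.fun_sub (hS.const_mul q)).const_mul 2) (hb.fun_mul (hb.fun_sub hS))
        (mul_pos h0 hγ).ne')) ?_ ?_
    · simp [qFun]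
      generalize √m.1 = α at *
      field_simp
      ring
    · simp [qFun]
      generalize √m.1 = α at *
      field_simp
      ring

end QJet

/-! ### Explicit spray corrections of the two metrics -/

section Explicit

attribute [local instance] instNormedAddCommGroupBilin instNormedSpaceBilin

variable {E : Type*} [NormedAddCommGroup E] [NormedSpace ℝ E]

/-- The difference of the spray coefficients of the Kropina metric and of `α`, in terms of
`p = α²`, `β`, `b2 = b²`, `r = r₀₀`, `s0 = s₀`, and the vectors `v`, `b`, `sv = sⁱ₀`. -/
noncomputable def kropinaCorr (p β b2 r s0 : ℝ) (v b sv : E) : E :=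
  (-(p / (2 * β))) • sv + ((r + p * s0 / β) / (2 * b2)) • b + (-((s0 + β * r / p) / b2)) • v

/-- The denominator `Δ` of the spray coefficients of `β^q / (β - α)^(q-1)`. -/
noncomputable def qDen (q α β b2 : ℝ) : ℝ := β ^ 3 - (1 + q) * α * β ^ 2 + q * α ^ 3 * b2

/-- The difference of the spray coefficients of `β^q / (β - α)^(q-1)` and of `α`. -/
noncomputable def qCorr (q α β b2 r s0 : ℝ) (v b sv : E) : E :=
  (α * (β - q * α) / (β * (q - 1))) • sv +
    (q * α ^ 3 * ((q - 1) * β * r - 2 * α * (β - q * α) * s0) /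
      (2 * (q - 1) * β * qDen q α β b2)) • b +
    ((β - 2 * q * α) * ((q - 1) * β * r - 2 * α * (β - q * α) * s0) /
      (2 * (q - 1) * qDen q α β b2)) • v

variable {A : E → E →L[ℝ] E →L[ℝ] ℝ} {B : E → E →L[ℝ] ℝ} {z v b sv Ga : E} {r : ℝ}

lemma IsFrame.ne_zero_of_right (h : B z v ≠ 0) : v ≠ 0 := by
  rintro rfl; simp at h

lemma IsFrame.bSq_pos (h : IsFrame A B z v b sv Ga r) (hv : B z v ≠ 0) : 0 < B z b := by
  have hb : b ≠ 0 := by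
    rintro rfl
    have := h.dual v
    simp at this
    exact hv this.symm
  have := h.pos b hb
  rwa [h.dual] at this

lemma IsFrame.sprayDen_kropina (h : IsFrame A B z v b sv Ga r) (hv : B z v ≠ 0) :
    sprayDen (2 * A z v v / B z v ^ 2) (-2 * A z v v ^ 2 / B z v ^ 3) (2 / B z v ^ 2)
      (-4 * A z v v / B z v ^ 3) (6 * A z v v ^ 2 / B z v ^ 4) (B z v) (B z b) =
      2 * A z v v ^ 2 * B z b / B z v ^ 4 := by
  have hp : A z v v ≠ 0 := (h.pos v (IsFrame.ne_zero_of_right hv)).ne'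
  rw [sprayDen]
  field_simp
  ring

/-- The denominator is `2 α⁴ b² / β⁴`, so the Kropina metric needs no domain restriction besides `β
≠ 0`. -/
lemma IsFrame.fibreNondeg_kropina (h : IsFrame A B z v b sv Ga r) (hv : B z v ≠ 0) :
    FibreNondeg (fun x : E × E => kropinaFun (A x.1 x.2 x.2, B x.1 x.2)) z v := by
  have hp : A z v v ≠ 0 := (h.pos v (IsFrame.ne_zero_of_right hv)).ne'
  have hb := (h.bSq_pos hv).ne'
  rw [h.fibreNondeg (hasJet_kropinaFun hv) (by positivity) (by field_simp; ring)
    (by field_simp; ring), h.sprayDen_kropina hv]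
  positivity

lemma IsFrame.isSpray_kropina (h : IsFrame A B z v b sv Ga r) (hv : B z v ≠ 0) :
    IsSpray (fun x : E × E => kropinaFun (A x.1 x.2 x.2, B x.1 x.2)) z v
      (Ga + kropinaCorr (A z v v) (B z v) (B z b) r (B z sv) v b sv) := by
  have hp : A z v v ≠ 0 := (h.pos v (IsFrame.ne_zero_of_right hv)).ne'
  have hb := (h.bSq_pos hv).ne'
  have := h.isSpray_sprayCorr (hasJet_kropinaFun hv) (by positivity) (by field_simp; ring)
    (by field_simp; ring)
    -- This is the solution of the scalar equation `hρ` for the Kropina jet.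
    (ρ := 2 * B z v ^ 2 * (r + A z v v * B z sv / B z v) / (A z v v * B z b)) (by
      rw [h.sprayDen_kropina hv]; field_simp; ring)
  convert this using 2
  rw [sprayCorr, kropinaCorr, smul_add, smul_add, smul_smul, smul_smul, smul_smul]
  congr 1
  · congr 1
    · congr 1; field_simp; ring
    · congr 1; field_simp; ring
  · congr 1; field_simp; ring

variable {q : ℝ}

section Q

variable (h : IsFrame A B z v b sv Ga r) (hq : q ≠ 1) (hv : √(A z v v) < B z v)

include h

lemma IsFrame.sq_pos (hv : √(A z v v) < B z v) : 0 < A z v v := by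
  refine h.pos v ?_
  rintro rfl
  simp at hv

include hq hv

/-- All factors except `qDen` are nonzero on the cone `α < β`, so `qDen` alone governs
nondegeneracy. It is also the bracket in the denominator of the final formula. -/
lemma IsFrame.sprayDen_q :
    sprayDen (qFunP q (A z v v, B z v)) (qFunB q (A z v v, B z v))
      (-(B z v * ((q - 1) * qFun q (A z v v, B z v) * (B z v - 2 * q * √(A z v v)) /
        (√(A z v v) * B z v * (B z v - √(A z v v)) ^ 2))) / (2 * A z v v))
      ((q - 1) * qFun q (A z v v, B z v) * (B z v - 2 * q * √(A z v v)) /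
        (√(A z v v) * B z v * (B z v - √(A z v v)) ^ 2))
      (2 * qFun q (A z v v, B z v) / (B z v ^ 2 * (B z v - √(A z v v)) ^ 2) *
        (B z v ^ 2 - 2 * q * √(A z v v) * B z v + q * (2 * q - 1) * √(A z v v) ^ 2))
      (B z v) (B z b) =
    2 * qFun q (A z v v, B z v) * qDen q √(A z v v) (B z v) (B z b) /
      ((B z v - √(A z v v)) * √(A z v v) ^ 2 * B z v ^ 2) := by
  have hp := h.sq_pos hv
  have hf := qFun_pos (q := q) (m := (A z v v, B z v)) hv
  have hα := Real.sqrt_pos.2 hp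
  have hβ : 0 < B z v := hα.trans hv
  have hγ : 0 < B z v - √(A z v v) := by linarith
  have hsq : A z v v = √(A z v v) ^ 2 := (Real.sq_sqrt hp.le).symm
  have hq' : q - 1 ≠ 0 := sub_ne_zero.2 hq
  rw [sprayDen, qDen, qFunP, qFunB]
  rw [show qRoot q (A z v v, B z v) ^ 2 = qFun q (A z v v, B z v) from rfl]
  generalize qFun q (A z v v, B z v) = f at *
  dsimp only
  rw [show (2 * A z v v) = 2 * √(A z v v) ^ 2 by rw [← hsq]]
  generalize √(A z v v) = α at *
  generalize B z v = β at *
  have hαβ : β - α ≠ 0 := hγ.ne'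
  field_simp
  ring

lemma IsFrame.qJet_euler :
    qFunP q (A z v v, B z v) ≠ 0 ∧
    2 * A z v v * (-(B z v * ((q - 1) * qFun q (A z v v, B z v) * (B z v - 2 * q * √(A z v v)) /
        (√(A z v v) * B z v * (B z v - √(A z v v)) ^ 2))) / (2 * A z v v)) +
      B z v * ((q - 1) * qFun q (A z v v, B z v) * (B z v - 2 * q * √(A z v v)) /
        (√(A z v v) * B z v * (B z v - √(A z v v)) ^ 2)) = 0 ∧
    2 * A z v v * ((q - 1) * qFun q (A z v v, B z v) * (B z v - 2 * q * √(A z v v)) /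
        (√(A z v v) * B z v * (B z v - √(A z v v)) ^ 2)) +
      B z v * (2 * qFun q (A z v v, B z v) / (B z v ^ 2 * (B z v - √(A z v v)) ^ 2) *
        (B z v ^ 2 - 2 * q * √(A z v v) * B z v + q * (2 * q - 1) * √(A z v v) ^ 2)) =
      qFunB q (A z v v, B z v) := by
  have hp := h.sq_pos hv
  have hf := qFun_pos (q := q) (m := (A z v v, B z v)) hv
  have hα := Real.sqrt_pos.2 hp
  have hβ : 0 < B z v := hα.trans hv
  have hγ : 0 < B z v - √(A z v v) := by linarith
  have hsq : A z v v = √(A z v v) ^ 2 := (Real.sq_sqrt hp.le).symm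
  have hq' : q - 1 ≠ 0 := sub_ne_zero.2 hq
  have hαβ : B z v - √(A z v v) ≠ 0 := hγ.ne'
  refine ⟨?_, ?_, ?_⟩
  · rw [qFunP]
    exact mul_ne_zero hf.ne' (div_ne_zero hq' (mul_pos hα hγ).ne')
  · field_simp; ring
  · rw [qFunB, show qRoot q (A z v v, B z v) ^ 2 = qFun q (A z v v, B z v) from rfl]
    rw [show (2 * A z v v) = 2 * √(A z v v) ^ 2 by rw [← hsq]]
    dsimp only
    generalize qFun q (A z v v, B z v) = f at *
    generalize √(A z v v) = α at *
    generalize B z v = β at *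
    field_simp
    ring

lemma IsFrame.fibreNondeg_q :
    FibreNondeg (fun x : E × E => qFun q (A x.1 x.2 x.2, B x.1 x.2)) z v ↔
      qDen q √(A z v v) (B z v) (B z b) ≠ 0 := by
  have hp := h.sq_pos hv
  have hf := qFun_pos (q := q) (m := (A z v v, B z v)) hv
  have hα := Real.sqrt_pos.2 hp
  have hβ : 0 < B z v := hα.trans hv
  have hγ : 0 < B z v - √(A z v v) := by linarith
  obtain ⟨h1, h2, h3⟩ := h.qJet_euler hq hv
  rw [h.fibreNondeg (hasJet_qFun hp hv) h1 h2 h3]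
  dsimp only
  rw [h.sprayDen_q hq hv, not_iff_not]
  have : (B z v - √(A z v v)) * √(A z v v) ^ 2 * B z v ^ 2 ≠ 0 := by positivity
  simp [this, hf.ne']

lemma IsFrame.isSpray_q (hΔ : qDen q √(A z v v) (B z v) (B z b) ≠ 0) :
    IsSpray (fun x : E × E => qFun q (A x.1 x.2 x.2, B x.1 x.2)) z v
      (Ga + qCorr q √(A z v v) (B z v) (B z b) r (B z sv) v b sv) := by
  have hp := h.sq_pos hv
  have hf := qFun_pos (q := q) (m := (A z v v, B z v)) hv
  have hα := Real.sqrt_pos.2 hp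
  have hβ : 0 < B z v := hα.trans hv
  have hγ : 0 < B z v - √(A z v v) := by linarith
  have hq' : q - 1 ≠ 0 := sub_ne_zero.2 hq
  have hsq : A z v v = √(A z v v) ^ 2 := (Real.sq_sqrt hp.le).symm
  have hαβ : B z v - √(A z v v) ≠ 0 := hγ.ne'
  obtain ⟨h1, h2, h3⟩ := h.qJet_euler hq hv
  have key := h.isSpray_sprayCorr (hasJet_qFun hp hv) h1 h2 h3
    (ρ := √(A z v v) * B z v * ((q - 1) * B z v * r -
      2 * √(A z v v) * (B z v - q * √(A z v v)) * B z sv) / qDen q √(A z v v) (B z v) (B z b)) (by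
      dsimp only
      rw [h.sprayDen_q hq hv, qFunP, qFunB]
      rw [show qRoot q (A z v v, B z v) ^ 2 = qFun q (A z v v, B z v) from rfl]
      dsimp only
      generalize qDen q √(A z v v) (B z v) (B z b) = D at *
      generalize qFun q (A z v v, B z v) = f at *
      generalize √(A z v v) = α at *
      generalize B z v = β at *
      field_simp)
  convert key using 2
  rw [sprayCorr, qCorr, smul_add, smul_add, smul_smul, smul_smul, smul_smul]
  dsimp only
  rw [qFunP, qFunB, show qRoot q (A z v v, B z v) ^ 2 = qFun q (A z v v, B z v) from rfl]
  dsimp only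
  rw [show (2 * A z v v) = 2 * √(A z v v) ^ 2 by rw [← hsq]]
  generalize qDen q √(A z v v) (B z v) (B z b) = D at *
  generalize qFun q (A z v v, B z v) = f at *
  generalize √(A z v v) = α at *
  generalize B z v = β at *
  have hf0 := hf.ne'
  congr 1
  · congr 1
    · congr 1; field_simp; ring
    · congr 1; field_simp; ring
  · congr 1; field_simp; ring

end Q

end Explicit

/-! ### Polynomial functions of one variable and irrational square roots -/

section PolynomialFunctions

/-- A real function given by a polynomial. -/
def IsPoly (f : ℝ → ℝ) : Prop := ∃ P : Polynomial ℝ, ∀ t, f t = P.eval t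

variable {f g h p : ℝ → ℝ}

lemma IsPoly.const (c : ℝ) : IsPoly fun _ => c := ⟨Polynomial.C c, fun t => by simp⟩

lemma IsPoly.id : IsPoly fun t => t := ⟨Polynomial.X, fun t => by simp⟩

lemma IsPoly.add (hf : IsPoly f) (hg : IsPoly g) : IsPoly fun t => f t + g t := by
  obtain ⟨P, hP⟩ := hf
  obtain ⟨Q, hQ⟩ := hg
  exact ⟨P + Q, fun t => by simp [hP, hQ]⟩

lemma IsPoly.mul (hf : IsPoly f) (hg : IsPoly g) : IsPoly fun t => f t * g t := by
  obtain ⟨P, hP⟩ := hf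
  obtain ⟨Q, hQ⟩ := hg
  exact ⟨P * Q, fun t => by simp [hP, hQ]⟩

lemma IsPoly.sub (hf : IsPoly f) (hg : IsPoly g) : IsPoly fun t => f t - g t := by
  obtain ⟨P, hP⟩ := hf
  obtain ⟨Q, hQ⟩ := hg
  exact ⟨P - Q, fun t => by simp [hP, hQ]⟩

lemma IsPoly.pow (hf : IsPoly f) (k : ℕ) : IsPoly fun t => f t ^ k := by
  obtain ⟨P, hP⟩ := hf
  exact ⟨P ^ k, fun t => by simp [hP]⟩

lemma IsPoly.eq_zero (hf : IsPoly f) (h : ∀ᶠ t in 𝓝 (0 : ℝ), f t = 0) (t : ℝ) : f t = 0 := by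
  obtain ⟨P, hP⟩ := hf
  have : P = 0 := by
    refine Polynomial.eq_zero_of_infinite_isRoot P ?_
    refine (infinite_of_mem_nhds (0 : ℝ) h).mono fun s hs => ?_
    simpa [Polynomial.IsRoot, ← hP] using hs
  simp [hP, this]

lemma IsPoly.eq_zero_of_mul (hf : IsPoly f) (hg : IsPoly g) (h : ∀ t, f t * g t = 0)
    {t₀ : ℝ} (h0 : f t₀ ≠ 0) (t : ℝ) : g t = 0 := by
  obtain ⟨P, hP⟩ := hf
  obtain ⟨Q, hQ⟩ := hg
  have h1 : P * Q = 0 := Polynomial.funext fun t => by simp [← hP, ← hQ, h]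
  rcases mul_eq_zero.1 h1 with h2 | h2
  · exact absurd (by rw [hP, h2]; simp) h0
  · simp [hQ, h2]

/-- A double root would also be a root of the derivative, hence the real number `-b/a`; negative
discriminant rules out real roots. -/
lemma odd_rootMultiplicity_quadratic {a b c : ℝ} (ha : a ≠ 0) (hd : b ^ 2 < a * c) {w : ℂ}
    (hw : (a : ℂ) * w ^ 2 + 2 * b * w + c = 0) :
    ((Polynomial.C (a : ℂ) * Polynomial.X ^ 2 + Polynomial.C (2 * b : ℂ) * Polynomial.X +
      Polynomial.C (c : ℂ)).rootMultiplicity w) = 1 := by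
  have hne : (Polynomial.C (a : ℂ) * Polynomial.X ^ 2 + Polynomial.C (2 * b : ℂ) * Polynomial.X +
      Polynomial.C (c : ℂ)) ≠ 0 := by
    intro h
    have := congrArg (fun P => Polynomial.coeff P 2) h
    simp at this
    exact ha this
  refine le_antisymm ?_ ?_
  · by_contra hlt
    push Not at hlt
    have h1 := Polynomial.isRoot_iterate_derivative_of_lt_rootMultiplicity hlt
    simp [Polynomial.IsRoot] at h1
    have hac : (a : ℂ) ≠ 0 := by exact_mod_cast ha
    have h2 : w = ((-b / a : ℝ) : ℂ) := by
      push_cast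
      field_simp
      linear_combination h1 / 2
    rw [h2] at hw
    have h3 : a * (-b / a) ^ 2 + 2 * b * (-b / a) + c = 0 := by exact_mod_cast hw
    field_simp at h3
    nlinarith
  · rw [Nat.succ_le_iff, Polynomial.rootMultiplicity_pos hne]
    simpa [Polynomial.IsRoot] using hw

/-- The square root of a quadratic polynomial of negative discriminant is irrational over the
polynomials. -/
lemma IsPoly.eq_zero_of_add_sqrt_mul {a b c : ℝ} (ha : 0 < a) (hd : b ^ 2 < a * c)
    (hf : IsPoly f) (hg : IsPoly g)
    (h : ∀ᶠ t in 𝓝 (0 : ℝ), f t + √(a * t ^ 2 + 2 * b * t + c) * g t = 0) :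
    (∀ t, f t = 0) ∧ ∀ t, g t = 0 := by
  have hpos : ∀ t, 0 < a * t ^ 2 + 2 * b * t + c := fun t => by
    have : 0 < a * (a * t ^ 2 + 2 * b * t + c) := by nlinarith [sq_nonneg (a * t + b)]
    exact (mul_pos_iff_of_pos_left ha).1 this
  have hp : IsPoly fun t => a * t ^ 2 + 2 * b * t + c :=
    (((IsPoly.const a).mul (IsPoly.id.pow 2)).add ((IsPoly.const (2 * b)).mul IsPoly.id)).add
      (IsPoly.const c)
  -- Squaring gives a polynomial identity, which extends from a neighbourhood of `0` to all `t`.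
  have hsq : ∀ t, f t ^ 2 - (a * t ^ 2 + 2 * b * t + c) * g t ^ 2 = 0 := by
    refine ((hf.pow 2).sub (hp.mul (hg.pow 2))).eq_zero ?_
    filter_upwards [h] with t ht
    have h1 : f t = - (√(a * t ^ 2 + 2 * b * t + c) * g t) := by linarith
    rw [h1, neg_sq, mul_pow, Real.sq_sqrt (hpos t).le, sub_self]
  have hg0 : ∀ t, g t = 0 := by
    obtain ⟨P, hP⟩ := hf
    obtain ⟨Q, hQ⟩ := hg
    by_contra hne
    have hQ0 : Q ≠ 0 := by
      rintro rfl
      exact hne fun t => by simp [hQ]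
    have h1 : P ^ 2 = (Polynomial.C a * Polynomial.X ^ 2 + Polynomial.C (2 * b) * Polynomial.X +
        Polynomial.C c) * Q ^ 2 := by
      refine Polynomial.funext fun t => ?_
      have := hsq t
      rw [hP, hQ] at this
      simp
      linarith
    have h2 := congrArg (Polynomial.map (algebraMap ℝ ℂ)) h1
    simp only [Polynomial.map_pow, Polynomial.map_mul, Polynomial.map_add, Polynomial.map_C,
      Polynomial.map_X] at h2
    have hac : (a : ℂ) ≠ 0 := by exact_mod_cast ha.ne'
    obtain ⟨s, hs⟩ := IsAlgClosed.exists_pow_nat_eq (((b : ℂ) ^ 2 - a * c)) (n := 2) two_pos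
    set w : ℂ := (-b + s) / a
    have hw : (a : ℂ) * w ^ 2 + 2 * b * w + c = 0 := by
      simp only [w]
      field_simp
      linear_combination hs
    have h3 := odd_rootMultiplicity_quadratic ha.ne' hd hw
    set R := (Polynomial.C (a : ℂ) * Polynomial.X ^ 2 + Polynomial.C (2 * b : ℂ) * Polynomial.X +
      Polynomial.C (c : ℂ)) with hR
    set P' := P.map (algebraMap ℝ ℂ)
    set Q' := Q.map (algebraMap ℝ ℂ)
    have hQ' : Q' ≠ 0 := (Polynomial.map_ne_zero_iff (algebraMap ℝ ℂ).injective).2 hQ0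
    have h4 : P' ^ 2 = R * Q' ^ 2 := by
      rw [h2, hR]; simp
    have hR0 : R ≠ 0 := by
      intro h0; rw [h0] at h3; simp at h3
    have h5 : R * Q' ^ 2 ≠ 0 := mul_ne_zero hR0 (pow_ne_zero 2 hQ')
    have hP' : P' ≠ 0 := by
      intro h0; rw [h0] at h4; exact h5 (by rw [← h4]; simp)
    -- At a complex root of the quadratic, `P²` has even multiplicity while the quadratic times `Q²`
    -- has odd multiplicity.
    have h6 := congrArg (Polynomial.rootMultiplicity w) h4
    rw [Polynomial.rootMultiplicity_mul h5, h3, sq, sq,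
      Polynomial.rootMultiplicity_mul (mul_ne_zero hP' hP'),
      Polynomial.rootMultiplicity_mul (mul_ne_zero hQ' hQ')] at h6
    omega
  refine ⟨fun t => ?_, hg0⟩
  have := hsq t
  rw [hg0 t] at this
  simpa using this

end PolynomialFunctions

/-! ### Algebra on one tangent space: bivectors and skew operators -/

section FibreAlgebra

attribute [local instance] instNormedAddCommGroupBilin instNormedSpaceBilin

variable {n : ℕ}

/-- The components of the bivector `u ∧ v`. -/
def wedge (u v : Model n) (i j : Fin n) : ℝ := u i * v j - u j * v i

lemma wedge_add_left (u u' v : Model n) (i j : Fin n) :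
    wedge (u + u') v i j = wedge u v i j + wedge u' v i j := by
  simp [wedge]; ring

lemma wedge_sub_left (u u' v : Model n) (i j : Fin n) :
    wedge (u - u') v i j = wedge u v i j - wedge u' v i j := by
  simp [wedge]; ring

lemma wedge_smul_left (c : ℝ) (u v : Model n) (i j : Fin n) :
    wedge (c • u) v i j = c * wedge u v i j := by
  simp [wedge]; ring

lemma wedge_self (v : Model n) (i j : Fin n) : wedge v v i j = 0 := by
  simp [wedge]; ring

lemma exists_smul_of_wedge {u v : Model n} (hv : v ≠ 0) (h : ∀ i j, wedge u v i j = 0) :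
    ∃ c : ℝ, u = c • v := by
  obtain ⟨j, hj⟩ : ∃ j, v j ≠ 0 := by
    by_contra h0
    push Not at h0
    exact hv (by ext i; simpa using h0 i)
  refine ⟨u j / v j, ?_⟩
  ext i
  have := h i j
  simp only [wedge] at this
  simp only [PiLp.smul_apply, smul_eq_mul]
  field_simp
  linarith

/-- The algebraic data, on a tangent space, of a metric and a 1-form `B`: the vector `b` dual to
`B` and the skew operator `σ` with matrix `sⁱⱼ`. -/
structure FibreData (A : Model n →L[ℝ] Model n →L[ℝ] ℝ) (B : Model n →L[ℝ] ℝ) (b : Model n)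
    (σ : Model n →L[ℝ] Model n) : Prop where
  symm : ∀ u w, A u w = A w u
  pos : ∀ u, u ≠ 0 → 0 < A u u
  dual : ∀ w, A b w = B w
  skew : ∀ v w, A (σ v) w = - A (σ w) v

variable {A R : Model n →L[ℝ] Model n →L[ℝ] ℝ} {B : Model n →L[ℝ] ℝ} {b u : Model n}
  {σ : Model n →L[ℝ] Model n}

namespace FibreData

variable (h : FibreData A B b σ)
include h

lemma self_sigma (v : Model n) : A (σ v) v = 0 := by
  have := h.skew v v; linarith

lemma nonneg (v : Model n) : 0 ≤ A v v := by
  by_cases hv : v = 0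
  · simp [hv]
  · exact (h.pos v hv).le

lemma eq_zero_of_le {v : Model n} (hv : A v v ≤ 0) : v = 0 := by
  by_contra h0
  exact absurd (h.pos v h0) (not_lt.2 hv)

lemma bSq_pos (hu : B u ≠ 0) : 0 < B b := by
  rw [← h.dual]
  refine h.pos b ?_
  rintro rfl
  exact hu (by rw [← h.dual]; simp)

lemma right_sq_le (v : Model n) : B v ^ 2 ≤ B b * A v v := by
  by_cases hb : B b = 0
  · have hb0 : b = 0 := h.eq_zero_of_le (by rw [h.dual, hb])
    rw [← h.dual v, hb0]; simp
  · have hb1 : 0 < B b := h.bSq_pos hb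
    have h1 := h.nonneg (B b • v - B v • b)
    have h2 : A (B b • v - B v • b) (B b • v - B v • b) = B b * (B b * A v v - B v ^ 2) := by
      simp only [map_sub, map_smul, _root_.sub_apply, _root_.smul_apply, smul_eq_mul]
      rw [h.symm v b, h.dual, h.dual]
      ring
    rw [h2] at h1
    have := (mul_nonneg_iff_of_pos_left hb1).1 h1
    linarith

/-- A skew operator that preserves the direction of `b` modulo `b` and `y`, for `y ⊥ b`, is
`b ∧ σ b / b²`. -/
lemma sigma_eq (hb : 0 < B b)
    (hy : ∀ y, B y = 0 → ∀ i j, wedge (B b • σ y - B (σ y) • b) y i j = 0) (v : Model n) :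
    B b • σ v = B (σ v) • b + B v • σ b := by
  have key : ∀ y, B y = 0 → B b • σ y = B (σ y) • b := by
    intro y hBy
    by_cases h0 : y = 0
    · simp [h0]
    obtain ⟨c, hc⟩ := exists_smul_of_wedge h0 (hy y hBy)
    have h1 := congrArg (fun x => A x y) hc
    simp only [map_sub, map_smul, _root_.sub_apply, _root_.smul_apply, smul_eq_mul,
      h.self_sigma, h.dual, hBy] at h1
    -- Pairing with `y` kills the left side, because `σ` is skew and `y` is orthogonal to `b`.
    have h2 : c = 0 := by
      have := (h.pos y h0).ne'
      have h3 : c * A y y = 0 := by linarith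
      exact (mul_eq_zero.1 h3).resolve_right this
    rw [h2, zero_smul] at hc
    exact sub_eq_zero.1 hc
  have hσb : B (σ b) = 0 := by
    rw [← h.dual, h.symm, h.self_sigma]
  -- `key` is applied to the component of `v` orthogonal to `b`.
  have h1 := key (v - (B v / B b) • b) (by simp; field_simp; ring)
  simp only [map_sub, map_smul, smul_sub, smul_eq_mul, hσb, mul_zero, sub_zero, smul_smul] at h1
  have h2 : B b * (B v / B b) = B v := by field_simp
  rw [h2] at h1
  rw [← h1]; abel

end FibreData

/-! ### Restriction of tensors to affine lines -/

section Lines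

lemma IsPoly.clm (φ : Model n →L[ℝ] ℝ) (u w : Model n) : IsPoly fun t : ℝ => φ (u + t • w) := by
  have : (fun t : ℝ => φ (u + t • w)) = fun t => φ u + t * φ w := by
    ext t; simp
  rw [this]
  exact (IsPoly.const _).add (IsPoly.id.mul (IsPoly.const _))

lemma IsPoly.bilin (φ : Model n →L[ℝ] Model n →L[ℝ] ℝ) (u w : Model n) :
    IsPoly fun t : ℝ => φ (u + t • w) (u + t • w) := by
  have : (fun t : ℝ => φ (u + t • w) (u + t • w)) =
      fun t => (φ u u + t * (φ u w + φ w u)) + t * t * φ w w := by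
    ext t; simp; ring
  rw [this]
  exact ((IsPoly.const _).add (IsPoly.id.mul (IsPoly.const _))).add
    ((IsPoly.id.mul IsPoly.id).mul (IsPoly.const _))

lemma IsPoly.coord (u w : Model n) (i : Fin n) : IsPoly fun t : ℝ => (u + t • w) i :=
  IsPoly.clm (EuclideanSpace.proj i) u w

lemma IsPoly.clm_coord (σ : Model n →L[ℝ] Model n) (u w : Model n) (i : Fin n) :
    IsPoly fun t : ℝ => (σ (u + t • w)) i :=
  IsPoly.clm ((EuclideanSpace.proj i).comp σ) u w

lemma IsPoly.wedge_clm (σ : Model n →L[ℝ] Model n) (u w : Model n) (i j : Fin n) :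
    IsPoly fun t : ℝ => wedge (σ (u + t • w)) (u + t • w) i j :=
  ((IsPoly.clm_coord σ u w i).mul (IsPoly.coord u w j)).sub
    ((IsPoly.clm_coord σ u w j).mul (IsPoly.coord u w i))

lemma IsPoly.wedge_const (b u w : Model n) (i j : Fin n) :
    IsPoly fun t : ℝ => wedge b (u + t • w) i j :=
  ((IsPoly.const (b i)).mul (IsPoly.coord u w j)).sub
    ((IsPoly.const (b j)).mul (IsPoly.coord u w i))

lemma tendsto_line (u w : Model n) :
    Filter.Tendsto (fun t : ℝ => u + t • w) (𝓝 0) (𝓝 u) := by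
  have : Continuous fun t : ℝ => u + t • w := by fun_prop
  simpa using this.tendsto 0

/-- A quadratic form vanishing near a point vanishes. -/
lemma bilin_eq_zero_of_eventually {φ : Model n →L[ℝ] Model n →L[ℝ] ℝ} {u : Model n}
    (h : ∀ᶠ y in 𝓝 u, φ y y = 0) (v : Model n) : φ v v = 0 := by
  have := (IsPoly.bilin φ u (v - u)).eq_zero ((tendsto_line u (v - u)).eventually h) 1
  simpa using this

lemma clm_eq_zero_of_eventually {φ : Model n →L[ℝ] Model n} {u : Model n}
    (h : ∀ᶠ y in 𝓝 u, φ y = 0) (v : Model n) : φ v = 0 := by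
  ext i
  have h1 : ∀ᶠ t : ℝ in 𝓝 0, (φ (u + t • (v - u))) i = 0 :=
    ((tendsto_line u (v - u)).eventually h).mono fun t ht => by simp [ht]
  have := (IsPoly.clm_coord φ u (v - u) i).eq_zero h1 1
  simpa using this

end Lines

/-! ### Consequences of a polynomial Kropina correction -/

section KropinaCore

/-- The only denominator in the wedge that varies with `y` is `β`. If the wedge is nevertheless
polynomial, its numerator must vanish on `β = 0`, which is the hypothesis of `FibreData.sigma_eq`.
-/
lemma FibreData.sigma_eq_of_kropina (h : FibreData A B b σ) (hu : B u ≠ 0)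
    (hpoly : ∀ w i j, ∃ N, IsPoly N ∧ ∀ᶠ t : ℝ in 𝓝 0,
      wedge (kropinaCorr (A (u + t • w) (u + t • w)) (B (u + t • w)) (B b)
        (R (u + t • w) (u + t • w)) (B (σ (u + t • w))) (u + t • w) b (σ (u + t • w)))
        (u + t • w) i j = N t) (v : Model n) :
    B b • σ v = B (σ v) • b + B v • σ b := by
  have hb := h.bSq_pos hu
  refine h.sigma_eq hb (fun y hy i j => ?_) v
  by_cases hy0 : y = 0
  · simp [hy0, wedge]
  obtain ⟨N, hN, hev⟩ := hpoly (y - u) i j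
  set w := y - u with hw
  have hne : ∀ᶠ t : ℝ in 𝓝 0, B (u + t • w) ≠ 0 :=
    (tendsto_line u w).eventually (B.continuous.continuousAt.eventually_ne hu)
  have pB := IsPoly.clm B u w
  have pA := IsPoly.bilin A u w
  have pR := IsPoly.bilin R u w
  have ps := IsPoly.clm (B.comp σ) u w
  have pW := IsPoly.wedge_clm σ u w i j
  have pb := IsPoly.wedge_const b u w i j
  -- With denominators cleared, `(β r₀₀ + α² s₀) b ∧ y - b² α² σy ∧ y = 2 b² β N` holds along the
  -- whole line, including its end `t = 1`, where `β` vanishes and a factor `α²` cancels.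
  have h0 := (((((pB.mul pR).add (pA.mul ps)).mul pb).sub
    (((IsPoly.const (B b)).mul pA).mul pW)).sub
      (((IsPoly.const (2 * B b)).mul pB).mul hN)).eq_zero (by
    filter_upwards [hev, hne] with t ht hβ
    rw [← ht, kropinaCorr, wedge_add_left, wedge_add_left, wedge_smul_left, wedge_smul_left,
      wedge_smul_left, wedge_self]
    simp only [ContinuousLinearMap.comp_apply]
    generalize B (u + t • w) = β at *
    field_simp
    ring) 1
  have hyw : u + (1 : ℝ) • w = y := by simp [hw]
  simp only [hyw, hy, ContinuousLinearMap.comp_apply] at h0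
  have hp := (h.pos y hy0).ne'
  rw [wedge_sub_left, wedge_smul_left, wedge_smul_left]
  have : A y y * (B b * wedge (σ y) y i j - B (σ y) * wedge b y i j) = 0 := by linarith
  exact (mul_eq_zero.1 this).resolve_left hp

end KropinaCore

/-! ### Separation of the rational and irrational parts in the correction of `F` -/

section QCore

variable {q : ℝ}

/-- The identity obtained by separating the rational and the irrational parts, in `y`, of the
spray coefficients. -/
lemma FibreData.parity_identity (h : FibreData A B b σ) (hq : q ≠ 1) (hu : √(A u u) < B u)
    (hΔ : qDen q √(A u u) (B u) (B b) ≠ 0)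
    (hpoly : ∀ w i j, ∃ N, IsPoly N ∧ ∀ᶠ t : ℝ in 𝓝 0,
      B (u + t • w) * wedge (qCorr q √(A (u + t • w) (u + t • w)) (B (u + t • w)) (B b)
        (R (u + t • w) (u + t • w)) (B (σ (u + t • w))) (u + t • w) b (σ (u + t • w)))
        (u + t • w) i j = N t) {y : Model n} (hy : B y ^ 2 < A y y) (i j : Fin n) :
    2 * (B y ^ 6 - A y y * (q * B b * A y y - (1 + q) * B y ^ 2) ^ 2) * wedge (σ y) y i j +
      q * A y y * ((q - 1) * B y ^ 3 * R y y + 2 * A y y * B (σ y) *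
        (q * B y ^ 2 + (q * B b * A y y - (1 + q) * B y ^ 2))) * wedge b y i j = 0 := by
  obtain ⟨N, hN, hev⟩ := hpoly (y - u) i j
  set w := y - u with hw
  have hyw : u + (1 : ℝ) • w = y := by simp [hw]
  have hBu : 0 < B u := (Real.sqrt_nonneg _).trans_lt hu
  have hAu : A u u < B u ^ 2 := by
    have := (Real.sqrt_lt' hBu).1 hu
    exact this
  have hu0 : u ≠ 0 := by rintro rfl; simp at hBu
  have hAu0 := h.pos u hu0
  -- `y` is not a multiple of `u`
  have hind : ∀ c : ℝ, y ≠ c • u := by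
    rintro c rfl
    simp only [map_smul, _root_.smul_apply, smul_eq_mul] at hy
    nlinarith [sq_nonneg c]
  have hw0 : w ≠ 0 := by
    intro h0
    exact hind 1 (by rw [one_smul]; exact sub_eq_zero.1 h0)
  have ha := h.pos w hw0
  -- Strict Cauchy–Schwarz: since `u` and `w` are independent, `α²` restricted to the line has
  -- negative discriminant.
  have hd : A u w ^ 2 < A w w * A u u := by
    by_contra hle
    push Not at hle
    have h1 : A (A u u • w - A u w • u) (A u u • w - A u w • u) ≤ 0 := by
      have : A (A u u • w - A u w • u) (A u u • w - A u w • u) =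
          A u u * (A w w * A u u - A u w ^ 2) := by
        simp only [map_sub, map_smul, _root_.sub_apply, _root_.smul_apply, smul_eq_mul]
        rw [h.symm w u]
        ring
      rw [this]
      exact mul_nonpos_of_nonneg_of_nonpos hAu0.le (by linarith)
    have h2 := sub_eq_zero.1 (h.eq_zero_of_le h1)
    refine hind (1 + A u w / A u u) ?_
    have h3 : w = (A u w / A u u) • u := by
      rw [div_eq_inv_mul, mul_smul, ← h2, smul_smul, inv_mul_cancel₀ hAu0.ne', one_smul]
    rw [add_smul, one_smul, ← h3, hw]
    abel
  have hquad : ∀ t : ℝ, A (u + t • w) (u + t • w) =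
      A w w * t ^ 2 + 2 * A u w * t + A u u := by
    intro t
    simp only [map_add, map_smul, _root_.add_apply, _root_.smul_apply, smul_eq_mul]
    rw [h.symm w u]
    ring
  have hlt : ∀ᶠ t : ℝ in 𝓝 0, √(A (u + t • w) (u + t • w)) < B (u + t • w) := by
    have c1 : Continuous fun t : ℝ => √(A (u + t • w) (u + t • w)) := by fun_prop
    have c2 : Continuous fun t : ℝ => B (u + t • w) := by fun_prop
    exact c1.continuousAt.eventually_lt c2.continuousAt (by simpa using hu)
  have hne : ∀ᶠ t : ℝ in 𝓝 0,
      qDen q √(A (u + t • w) (u + t • w)) (B (u + t • w)) (B b) ≠ 0 := by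
    have c1 : Continuous fun t : ℝ =>
        qDen q √(A (u + t • w) (u + t • w)) (B (u + t • w)) (B b) := by
      unfold qDen; fun_prop
    exact c1.continuousAt.eventually_ne (by simpa using hΔ)
  have pB := IsPoly.clm B u w
  have pA := IsPoly.bilin A u w
  have pR := IsPoly.bilin R u w
  have ps := IsPoly.clm (B.comp σ) u w
  have pW := IsPoly.wedge_clm σ u w i j
  have pb := IsPoly.wedge_const b u w i j
  -- With `E` for this expression, `qDen` splits as `β³ + α E`.
  have pE : IsPoly fun t : ℝ =>
      q * B b * A (u + t • w) (u + t • w) - (1 + q) * B (u + t • w) ^ 2 :=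
    ((IsPoly.const _).mul pA).sub ((IsPoly.const _).mul (pB.pow 2))
  -- Multiplying the hypothesis by `2(q - 1)` times `qDen` gives an equation polynomial in `α`;
  -- `pev` collects its even powers and `pod` the odd ones with one `α` removed.
  have pev := ((((IsPoly.const 2).mul pA).mul
    ((pB.mul pE).sub ((IsPoly.const q).mul (pB.pow 3)))).mul pW).sub
    (((((IsPoly.const (2 * q)).mul (pA.pow 2)).mul pB).mul ps).mul pb) |>.sub
    (((IsPoly.const (2 * (q - 1))).mul (pB.pow 3)).mul hN)
  have pod := ((((IsPoly.const 2).mul ((pB.pow 4).sub (((IsPoly.const q).mul pA).mul pE))).mul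
    pW).add ((((IsPoly.const q).mul pA).mul ((((IsPoly.const (q - 1)).mul pB).mul pR).add
      (((IsPoly.const (2 * q)).mul pA).mul ps))).mul pb)).sub
    (((IsPoly.const (2 * (q - 1))).mul pE).mul hN)
  obtain ⟨h1, h2⟩ := IsPoly.eq_zero_of_add_sqrt_mul ha hd pev pod (by
    filter_upwards [hev, hlt, hne] with t ht hlt hne
    rw [← hquad, ← ht, qCorr, wedge_add_left, wedge_add_left, wedge_smul_left, wedge_smul_left,
      wedge_smul_left, wedge_self]
    simp only [ContinuousLinearMap.comp_apply]
    have hβ : B (u + t • w) ≠ 0 := ((Real.sqrt_nonneg _).trans_lt hlt).ne'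
    have hsq := Real.sq_sqrt (h.nonneg (u + t • w))
    rw [← hsq, Real.sqrt_sq (Real.sqrt_nonneg _)]
    generalize √(A (u + t • w) (u + t • w)) = α at *
    have hq' : q - 1 ≠ 0 := sub_ne_zero.2 hq
    have hD : ∀ D, D = qDen q α (B (u + t • w)) (B b) → D ≠ 0 := by
      rintro D rfl; exact hne
    generalize hDD : qDen q α (B (u + t • w)) (B b) = D at *
    generalize B (u + t • w) = β at *
    have hD0 : D ≠ 0 := hne
    have e1 : q * B b * α ^ 2 * α - (1 + q) * β ^ 2 * α + β ^ 3 = D := by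
      rw [← hDD, qDen]; ring
    generalize wedge (σ (u + t • w)) (u + t • w) i j = S at *
    generalize wedge b (u + t • w) i j = T at *
    generalize B (σ (u + t • w)) = s at *
    generalize R (u + t • w) (u + t • w) = r at *
    have e2 : 2 * (q - 1) * D * (β * (α * (β - q * α) / (β * (q - 1)) * S +
        q * α ^ 3 * ((q - 1) * β * r - 2 * α * (β - q * α) * s) / (2 * (q - 1) * β * D) * T +
        (β - 2 * q * α) * ((q - 1) * β * r - 2 * α * (β - q * α) * s) / (2 * (q - 1) * D) * 0)) =
        2 * α * (β - q * α) * D * S +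
          q * α ^ 3 * ((q - 1) * β * r - 2 * α * (β - q * α) * s) * T := by
      field_simp
      ring
    rw [← e1] at e2
    rw [← e1]
    linear_combination -e2)
  -- The combination `-E` times the even part plus `β³` times the odd part eliminates `N` and equals
  -- `β` times the claim; `β` is not identically zero on the line, so it cancels.
  have h3 := IsPoly.eq_zero_of_mul pB (((((IsPoly.const 2).mul ((pB.pow 6).sub (pA.mul
    (pE.pow 2)))).mul pW).add ((((IsPoly.const q).mul pA).mul
      ((((IsPoly.const (q - 1)).mul (pB.pow 3)).mul pR).add
      ((((IsPoly.const 2).mul pA).mul ps).mul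
        (((IsPoly.const q).mul (pB.pow 2)).add pE)))).mul pb))) (fun t => by
      have h1 := h1 t
      have h2 := h2 t
      simp only [ContinuousLinearMap.comp_apply] at h1 h2 ⊢
      linear_combination
        -(q * B b * A (u + t • w) (u + t • w) - (1 + q) * B (u + t • w) ^ 2) * h1 +
          B (u + t • w) ^ 3 * h2) (t₀ := 0) (by simpa using hBu.ne') 1
  simp only [hyw, ContinuousLinearMap.comp_apply] at h3
  linarith

end QCore

end FibreAlgebra

/-! ### The parity identity forces `s = 0` and `q r₀₀ = 0` -/

section QCoreConclusion

attribute [local instance] instNormedAddCommGroupBilin instNormedSpaceBilin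

variable {n : ℕ} {A R : Model n →L[ℝ] Model n →L[ℝ] ℝ} {B : Model n →L[ℝ] ℝ} {b u : Model n}
  {σ : Model n →L[ℝ] Model n} {q : ℝ}

lemma FibreData.one_lt_bSq (h : FibreData A B b σ) (hu : √(A u u) < B u) : 1 < B b := by
  have hBu : 0 < B u := (Real.sqrt_nonneg _).trans_lt hu
  have hAu : A u u < B u ^ 2 := (Real.sqrt_lt' hBu).1 hu
  have hu0 : u ≠ 0 := by rintro rfl; simp at hBu
  have h1 := h.right_sq_le u
  have h2 := h.pos u hu0
  by_contra hle
  push Not at hle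
  nlinarith

/-- In dimension at least three, two vectors have a common nonzero orthogonal vector. -/
lemma FibreData.exists_orthogonal (h : FibreData A B b σ) (hn : 3 ≤ n) (τ : Model n) :
    ∃ e : Model n, 0 < A e e ∧ A e τ = 0 ∧ B e = 0 := by
  have hker : LinearMap.ker ((A τ).prod B).toLinearMap ≠ ⊥ := by
    refine LinearMap.ker_ne_bot_of_finrank_lt ?_
    simp
    omega
  obtain ⟨e, he, he0⟩ := Submodule.exists_mem_ne_zero_of_ne_bot hker
  have h1 : A τ e = 0 ∧ B e = 0 := by
    simpa using he
  exact ⟨e, h.pos e he0, by rw [h.symm]; exact h1.1, h1.2⟩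

lemma FibreData.self_add_smul (h : FibreData A B b σ) {e : Model n} (he : B e = 0) (ε : ℝ) :
    B (e + ε • b) = ε * B b ∧ A (e + ε • b) (e + ε • b) = A e e + ε ^ 2 * B b := by
  constructor
  · simp [he]
  · simp only [map_add, map_smul, _root_.add_apply, _root_.smul_apply, smul_eq_mul]
    rw [h.symm e b, h.dual, h.dual, he]
    ring

lemma FibreData.exists_right_sq_lt (h : FibreData A B b σ) (hn : 3 ≤ n) (hb : 0 < B b) :
    ∃ y, B y ≠ 0 ∧ B y ^ 2 < A y y := by
  obtain ⟨e, he0, -, he⟩ := h.exists_orthogonal hn 0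
  -- A nonzero `e` orthogonal to `b` satisfies the strict inequality; tilting it slightly towards
  -- `b` keeps it and makes `β` nonzero.
  have hc : Continuous fun ε : ℝ => (ε * B b) ^ 2 - (A e e + ε ^ 2 * B b) := by fun_prop
  have h1 : ∀ᶠ ε : ℝ in 𝓝 0, (ε * B b) ^ 2 - (A e e + ε ^ 2 * B b) < 0 :=
    hc.continuousAt.eventually_lt_const (by simpa using he0)
  obtain ⟨ε, hε, hε0⟩ := ((h1.filter_mono nhdsWithin_le_nhds).and
    (self_mem_nhdsWithin : {(0 : ℝ)}ᶜ ∈ 𝓝[≠] (0 : ℝ))).exists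
  obtain ⟨h2, h3⟩ := h.self_add_smul he ε
  refine ⟨e + ε • b, ?_, ?_⟩
  · rw [h2]; exact mul_ne_zero hε0 hb.ne'
  · rw [h2, h3]; linarith

lemma eventually_right_sq_lt (A : Model n →L[ℝ] Model n →L[ℝ] ℝ) (B : Model n →L[ℝ] ℝ)
    {y : Model n} (hy : B y ≠ 0) (hy' : B y ^ 2 < A y y) :
    ∀ᶠ x in 𝓝 y, B x ≠ 0 ∧ B x ^ 2 < A x x := by
  have c1 : Continuous fun x => B x := B.continuous
  have c2 : Continuous fun x => A x x := by fun_prop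
  exact (c1.continuousAt.eventually_ne hy).and
    ((c1.pow 2).continuousAt.eventually_lt c2.continuousAt hy')

variable (h : FibreData A B b σ) (hn : 3 ≤ n) (hq : q ≠ 1) (hb : 1 < B b)
  (hstar : ∀ y, B y ^ 2 < A y y → ∀ i j,
    2 * (B y ^ 6 - A y y * (q * B b * A y y - (1 + q) * B y ^ 2) ^ 2) * wedge (σ y) y i j +
      q * A y y * ((q - 1) * B y ^ 3 * R y y + 2 * A y y * B (σ y) *
        (q * B y ^ 2 + (q * B b * A y y - (1 + q) * B y ^ 2))) * wedge b y i j = 0)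

include h hn hb hstar

/-- On `β = 0` the identity shows that `σ` is determined by `σ b`. Just off that hyperplane, in a
direction orthogonal to both `b` and `σ b`, it then shows `σ b = 0`. -/
lemma FibreData.sigma_eq_zero (v : Model n) : σ v = 0 := by
  have hb0 : 0 < B b := by linarith
  by_cases hq0 : q = 0
  -- For `q = 0` the `b`-term is absent, so `σ y` is parallel to `y` on an open set, and skewness
  -- makes it zero.
  · subst hq0
    obtain ⟨y₀, hy0, hy1⟩ := h.exists_right_sq_lt hn hb0
    refine clm_eq_zero_of_eventually (u := y₀) ?_ v
    filter_upwards [eventually_right_sq_lt A B hy0 hy1] with y ⟨h1, h2⟩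
    have hyne : y ≠ 0 := by rintro rfl; simp at h1
    have h3 : ∀ i j, wedge (σ y) y i j = 0 := fun i j => by
      have h4 := hstar y h2 i j
      have h5 : (B y ^ 4 * (B y ^ 2 - A y y)) * wedge (σ y) y i j = 0 := by linarith
      refine (mul_eq_zero.1 h5).resolve_left (mul_ne_zero (pow_ne_zero 4 h1) ?_)
      linarith
    obtain ⟨c, hc⟩ := exists_smul_of_wedge hyne h3
    have h4 := congrArg (fun x => A x y) hc
    simp only [h.self_sigma, map_smul, _root_.smul_apply, smul_eq_mul] at h4
    have h5 : c = 0 := (mul_eq_zero.1 h4.symm).resolve_right (h.pos y hyne).ne'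
    rw [hc, h5, zero_smul]
  -- For `β(y) = 0` the identity becomes `q² b² α⁶ (b² σy - β(σy) b) ∧ y = 0`.
  · have hK := h.sigma_eq hb0 (fun y hy i j => by
      by_cases hy0 : y = 0
      · simp [hy0, wedge]
      have hp := h.pos y hy0
      have h1 := hstar y (by rw [hy]; simpa using hp) i j
      rw [hy] at h1
      rw [wedge_sub_left, wedge_smul_left, wedge_smul_left]
      have h2 : (q ^ 2 * B b * A y y ^ 3) *
          (B b * wedge (σ y) y i j - B (σ y) * wedge b y i j) = 0 := by
        linear_combination -h1 / 2
      refine (mul_eq_zero.1 h2).resolve_left ?_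
      positivity)
    have hσb : σ b = 0 := by
      obtain ⟨e, he0, heτ, he⟩ := h.exists_orthogonal hn (σ b)
      have hc1 : Continuous fun ε : ℝ => (ε * B b) ^ 2 - (A e e + ε ^ 2 * B b) := by fun_prop
      -- The coefficient of `σ y ∧ y` at `y = e + ε b` is nonzero at `ε = 0`, hence for small `ε`; a
      -- nonzero `ε` is then chosen so that `β(y) ≠ 0`.
      have hc2 : Continuous fun ε : ℝ => 2 * ((ε * B b) ^ 6 - (A e e + ε ^ 2 * B b) *
        (q * B b * (A e e + ε ^ 2 * B b) - (1 + q) * (ε * B b) ^ 2) ^ 2) := by fun_prop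
      have h1 : ∀ᶠ ε : ℝ in 𝓝 0, (ε * B b) ^ 2 - (A e e + ε ^ 2 * B b) < 0 :=
        hc1.continuousAt.eventually_lt_const (by simpa using he0)
      have h2 : ∀ᶠ ε : ℝ in 𝓝 0, 2 * ((ε * B b) ^ 6 - (A e e + ε ^ 2 * B b) *
        (q * B b * (A e e + ε ^ 2 * B b) - (1 + q) * (ε * B b) ^ 2) ^ 2) ≠ 0 :=
        hc2.continuousAt.eventually_ne (by
          simp [hq0, hb0.ne', he0.ne'])
      obtain ⟨ε, ⟨hε1, hε2⟩, hε0⟩ := (((h1.and h2).filter_mono nhdsWithin_le_nhds).and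
        (self_mem_nhdsWithin : {(0 : ℝ)}ᶜ ∈ 𝓝[≠] (0 : ℝ))).exists
      obtain ⟨hBy, hAy⟩ := h.self_add_smul he ε
      set y := e + ε • b with hy
      rw [← hBy, ← hAy] at hε1 hε2
      have hyne : y ≠ 0 := by
        intro h0
        have : ε * B b = 0 := by rw [← hBy, h0]; simp
        exact (mul_ne_zero hε0 hb0.ne') this
      set c1 := 2 * (B y ^ 6 - A y y * (q * B b * A y y - (1 + q) * B y ^ 2) ^ 2) with hc1
      set c2 := q * A y y * ((q - 1) * B y ^ 3 * R y y + 2 * A y y * B (σ y) *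
        (q * B y ^ 2 + (q * B b * A y y - (1 + q) * B y ^ 2))) with hc2
      have h3 : ∀ i j, wedge (c1 • σ y + c2 • b) y i j = 0 := fun i j => by
        rw [wedge_add_left, wedge_smul_left, wedge_smul_left]
        exact hstar y (by linarith) i j
      -- In `c1 σy + c2 b = c y`, pairing with `e` gives `c = 0`, and pairing with `σ b` then leaves
      -- `c1 β(y) |σ b|² = 0`.
      obtain ⟨c, hc⟩ := exists_smul_of_wedge hyne h3
      have hKy := hK y
      have hbτ : A b (σ b) = 0 := by rw [h.symm]; exact h.self_sigma b
      have hσe : A (σ y) e = 0 := by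
        have := congrArg (fun x => A x e) hKy
        simp only [map_add, map_smul, _root_.add_apply, _root_.smul_apply, smul_eq_mul, h.dual, he,
          h.symm (σ b) e, heτ] at this
        have h4 : B b * A (σ y) e = 0 := by linarith
        exact (mul_eq_zero.1 h4).resolve_left hb0.ne'
      have hye : A y e = A e e := by
        rw [hy]
        simp only [map_add, map_smul, _root_.add_apply, _root_.smul_apply, smul_eq_mul, h.dual, he]
        ring
      have hcz : c = 0 := by
        have := congrArg (fun x => A x e) hc
        simp only [map_add, map_smul, _root_.add_apply, _root_.smul_apply, smul_eq_mul, h.dual, he,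
          hσe, hye] at this
        have h4 : c * A e e = 0 := by linarith
        exact (mul_eq_zero.1 h4).resolve_right he0.ne'
      have h5 : c1 * (B y * A (σ b) (σ b)) = 0 := by
        have e1 := congrArg (fun x => A x (σ b)) hc
        have e2 := congrArg (fun x => A x (σ b)) hKy
        simp only [map_add, map_smul, _root_.add_apply, _root_.smul_apply, smul_eq_mul, hbτ,
          hcz] at e1 e2
        linear_combination B b * e1 - c1 * e2
      have h6 := (mul_eq_zero.1 ((mul_eq_zero.1 h5).resolve_left hε2)).resolve_left (by
        rw [hBy]; exact mul_ne_zero hε0 hb0.ne')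
      exact h.eq_zero_of_le h6.le
    have hB0 : ∀ v, B (σ v) = 0 := fun v => by
      rw [← h.dual, h.symm, h.skew, hσb]; simp
    have h1 := hK v
    rw [hσb, hB0, zero_smul, smul_zero, add_zero] at h1
    exact (smul_eq_zero.1 h1).resolve_left hb0.ne'

-- With `σ = 0` the identity is `q(q - 1) α² β³ r₀₀ b ∧ y = 0`. Where `r₀₀` is nonzero, `y` would be
-- parallel to `b`, so that `β² = b² α² > α²`, against the choice of `y`.
include hq in
lemma FibreData.sym_eq_zero (hq0 : q ≠ 0) (v : Model n) : R v v = 0 := by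
  have hb0 : 0 < B b := by linarith
  obtain ⟨y₀, hy0, hy1⟩ := h.exists_right_sq_lt hn hb0
  refine bilin_eq_zero_of_eventually (u := y₀) ?_ v
  filter_upwards [eventually_right_sq_lt A B hy0 hy1] with y ⟨h1, h2⟩
  have hyne : y ≠ 0 := by rintro rfl; simp at h1
  have hp := h.pos y hyne
  by_contra hR
  have h3 : ∀ i j, wedge b y i j = 0 := fun i j => by
    have h4 := hstar y h2 i j
    rw [h.sigma_eq_zero hn hb hstar y] at h4
    have h5 : (q * A y y * (q - 1) * B y ^ 3 * R y y) * wedge b y i j = 0 := by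
      have h6 : wedge (0 : Model n) y i j = 0 := by simp [wedge]
      rw [h6, map_zero] at h4
      linear_combination h4
    refine (mul_eq_zero.1 h5).resolve_left ?_
    have : q - 1 ≠ 0 := sub_ne_zero.2 hq
    positivity
  obtain ⟨c, hc⟩ := exists_smul_of_wedge hyne h3
  have h4 : B b = c * B y := by
    conv_lhs => rw [hc]
    simp
  have h5 : B y = c * A y y := by
    rw [← h.dual y]
    conv_lhs => rw [hc]
    simp
  have h6 : A y y * (B b - 1) < 0 := by
    have : B y ^ 2 = B b * A y y := by rw [h4, sq, mul_comm c, mul_assoc, ← h5]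
    linarith
  nlinarith

end QCoreConclusion

/-! ### Antiderivatives of polynomial functions -/

section Integration

lemma exists_derivative_eq (P : Polynomial ℝ) : ∃ Q : Polynomial ℝ, Q.derivative = P := by
  induction P using Polynomial.induction_on' with
  | add p q hp hq =>
    obtain ⟨P, hP⟩ := hp
    obtain ⟨Q, hQ⟩ := hq
    exact ⟨P + Q, by simp [hP, hQ]⟩
  | monomial k a =>
    refine ⟨Polynomial.monomial (k + 1) (a / (k + 1)), ?_⟩
    rw [Polynomial.derivative_monomial]
    have : ((k : ℝ) + 1) ≠ 0 := by positivity
    simp [this]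

lemma exists_isPoly_of_hasDerivAt {f g : ℝ → ℝ} (hg : IsPoly g)
    (h : ∀ᶠ t in 𝓝 (0 : ℝ), HasDerivAt f (g t) t) :
    ∃ N, IsPoly N ∧ ∀ᶠ t in 𝓝 (0 : ℝ), f t = N t := by
  obtain ⟨P, hP⟩ := hg
  obtain ⟨Q, hQ⟩ := exists_derivative_eq P
  obtain ⟨ε, hε, hball⟩ := Metric.eventually_nhds_iff_ball.1 h
  have hd : ∀ t ∈ Metric.ball (0 : ℝ) ε, HasDerivAt (fun t => f t - Q.eval t) 0 t := fun t ht => by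
    have := (hball t ht).fun_sub (Q.hasDerivAt t)
    rwa [hQ, hP, sub_self] at this
  have hconst : ∀ t ∈ Metric.ball (0 : ℝ) ε, f t - Q.eval t = f 0 - Q.eval 0 := fun t ht =>
    Metric.isOpen_ball.is_const_of_deriv_eq_zero (convex_ball _ _).isPreconnected
      (fun s hs => (hd s hs).differentiableAt.differentiableWithinAt)
      (fun s hs => (hd s hs).deriv) ht (Metric.mem_ball_self hε)
  refine ⟨fun t => (Q + Polynomial.C (f 0 - Q.eval 0)).eval t, ⟨_, fun t => rfl⟩, ?_⟩
  filter_upwards [Metric.ball_mem_nhds (0 : ℝ) hε] with t ht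
  have := hconst t ht
  simp
  linarith

end Integration

/-! ### The Douglas tensor and polynomiality along lines -/

section Partials

variable {n : ℕ}

/-- The `i`-th coordinate, as a continuous linear map. -/
noncomputable def coordCLM (i : Fin n) : Model n →L[ℝ] ℝ := EuclideanSpace.proj i

@[simp] lemma coordCLM_apply (i : Fin n) (v : Model n) : coordCLM i v = v i := rfl

lemma ContDiffAt.partialD {f : Model n → ℝ} {u : Model n} {k : WithTop ℕ∞}
    (hf : ContDiffAt ℝ (k + 1) f u) (l : Fin n) : ContDiffAt ℝ k (partialD l f) u :=
  (hf.fderiv_right (m := k) le_rfl).clm_apply contDiffAt_const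

/-- Along the line the derivative of `S` is a constant-coefficient combination of its partial
derivatives, so `S` is found by integrating a polynomial. -/
lemma exists_isPoly_of_partialD {S : Model n → ℝ} {u w : Model n}
    (hS : ContDiffAt ℝ 1 S u)
    (h : ∀ l, ∃ N, IsPoly N ∧ ∀ᶠ t in 𝓝 (0 : ℝ), partialD l S (u + t • w) = N t) :
    ∃ N, IsPoly N ∧ ∀ᶠ t in 𝓝 (0 : ℝ), S (u + t • w) = N t := by
  choose N hN hev using h
  have hsum : IsPoly fun t => ∑ l, w l * N l t := by
    choose P hP using hN
    refine ⟨∑ l, Polynomial.C (w l) * P l, fun t => ?_⟩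
    simp [Polynomial.eval_finsetSum, hP]
  refine exists_isPoly_of_hasDerivAt hsum ?_
  have hd : ∀ᶠ t in 𝓝 (0 : ℝ), DifferentiableAt ℝ S (u + t • w) :=
    (tendsto_line u w).eventually ((hS.eventually (by simp)).mono fun x hx =>
      hx.differentiableAt (by norm_num))
  filter_upwards [hd, Filter.eventually_all.2 hev] with t h1 h2
  have hl : HasDerivAt (fun t : ℝ => u + t • w) w t := by
    simpa using ((hasDerivAt_id t).smul_const w).const_add u
  have h3 := h1.hasFDerivAt.comp_hasDerivAt t hl
  have h4 : ∑ l, w l * N l t = fderiv ℝ S (u + t • w) w := by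
    rw [clm_eq_sum (fderiv ℝ S (u + t • w)) w]
    refine Finset.sum_congr rfl fun l _ => ?_
    rw [← h2 l]
    rfl
  rw [h4]
  exact h3

/-- A function whose third partial derivatives vanish near `u` is polynomial along lines. -/
lemma exists_isPoly_of_third_partials {T : Model n → ℝ} {u : Model n} (hT : ContDiffAt ℝ 3 T u)
    (h : ∀ᶠ v in 𝓝 u, ∀ j k l, partialD j (partialD k (partialD l T)) v = 0) (w : Model n) :
    ∃ N, IsPoly N ∧ ∀ᶠ t in 𝓝 (0 : ℝ), T (u + t • w) = N t := by
  refine exists_isPoly_of_partialD (hT.of_le (by norm_num)) fun l => ?_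
  have h1 : ContDiffAt ℝ 2 (partialD l T) u := ContDiffAt.partialD (by norm_num; exact hT) l
  refine exists_isPoly_of_partialD (h1.of_le (by norm_num)) fun k => ?_
  have h2 : ContDiffAt ℝ 1 (partialD k (partialD l T)) u :=
    ContDiffAt.partialD (by norm_num; exact h1) k
  refine exists_isPoly_of_partialD h2 fun j => ?_
  exact ⟨fun _ => 0, IsPoly.const 0, ((tendsto_line u w).eventually h).mono fun t ht => ht j k l⟩

/-- The vector field `Gⁱ - (1/(n+1)) (∂Gᵐ/∂yᵐ) yⁱ` on a tangent space. -/
noncomputable def traceFree (G : Fin n → Model n → ℝ) (i : Fin n) (v : Model n) : ℝ :=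
  G i v - (1 / ((n : ℝ) + 1)) * (∑ m, partialD m (G m) v) * v i

lemma douglasOf_eq (G : Fin n → Model n → Model n → ℝ) (i j k l : Fin n) (z v : Model n) :
    douglasOf G i j k l z v =
      partialD j (partialD k (partialD l (traceFree (fun i => G i z) i))) v := rfl

lemma contDiffAt_traceFree {G : Fin n → Model n → ℝ} {u : Model n}
    (hG : ∀ i, ContDiffAt ℝ 4 (G i) u) (i : Fin n) : ContDiffAt ℝ 3 (traceFree G i) u := by
  have h1 : ContDiffAt ℝ 3 (fun v : Model n => v i) u :=
    (coordCLM i).contDiff.contDiffAt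
  have h2 : ContDiffAt ℝ 3 (fun v => ∑ m, partialD m (G m) v) u :=
    ContDiffAt.sum fun m _ => ContDiffAt.partialD (by norm_num; exact hG m) m
  exact ((hG i).of_le (by norm_num)).sub ((contDiffAt_const.mul h2).mul h1)

/-- The trace-free part of `G` has zero third derivatives, hence is polynomial along lines, and
wedging with `y` removes the trace term. Four derivatives of `G` are needed because the trace
already uses one. -/
lemma exists_isPoly_wedge_of_douglas {G : Fin n → Model n → Model n → ℝ} {z u : Model n}
    (hG : ∀ i, ContDiffAt ℝ 4 (G i z) u)
    (hD : ∀ᶠ v in 𝓝 u, ∀ i j k l, douglasOf G i j k l z v = 0) (w : Model n) (i j : Fin n) :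
    ∃ N, IsPoly N ∧ ∀ᶠ t in 𝓝 (0 : ℝ),
      wedge (WithLp.toLp 2 fun i => G i z (u + t • w)) (u + t • w) i j = N t := by
  have h : ∀ i, ∃ N, IsPoly N ∧ ∀ᶠ t in 𝓝 (0 : ℝ),
      traceFree (fun i => G i z) i (u + t • w) = N t := fun i =>
    exists_isPoly_of_third_partials (contDiffAt_traceFree hG i)
      (hD.mono fun v hv j k l => hv i j k l) w
  obtain ⟨N₁, hN₁, h1⟩ := h i
  obtain ⟨N₂, hN₂, h2⟩ := h j
  refine ⟨_, (hN₁.mul (IsPoly.coord u w j)).sub (hN₂.mul (IsPoly.coord u w i)), ?_⟩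
  filter_upwards [h1, h2] with t h1 h2
  rw [← h1, ← h2, wedge, traceFree, traceFree]
  ring

lemma partialD_congr {f g : Model n → ℝ} {u : Model n} (h : f =ᶠ[𝓝 u] g) (k : Fin n) :
    partialD k f =ᶠ[𝓝 u] partialD k g := by
  filter_upwards [h.eventuallyEq_nhds] with v hv
  rw [partialD, partialD, hv.fderiv_eq]

lemma partialD_bilin (φ : Model n →L[ℝ] Model n →L[ℝ] ℝ) (k : Fin n) (v : Model n) :
    partialD k (fun v => φ v v) v =
      φ v (EuclideanSpace.single k 1) + φ (EuclideanSpace.single k 1) v := by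
  have h1 : HasFDerivAt (fun v : Model n => φ v v) _ v :=
    φ.hasFDerivAt.clm_apply (hasFDerivAt_id v)
  rw [partialD, h1.fderiv]
  simp

lemma partialD_clm (φ : Model n →L[ℝ] ℝ) (k : Fin n) (v : Model n) :
    partialD k (fun v => φ v) v = φ (EuclideanSpace.single k 1) := by
  rw [partialD, φ.hasFDerivAt.fderiv]

lemma third_partials_bilin (φ : Model n →L[ℝ] Model n →L[ℝ] ℝ) (j k l : Fin n) (v : Model n) :
    partialD j (partialD k (partialD l (fun v => φ v v))) v = 0 := by
  have h1 : partialD l (fun v => φ v v) =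
      fun v => (φ.flip (EuclideanSpace.single l 1) + φ (EuclideanSpace.single l 1)) v := by
    ext v; rw [partialD_bilin]; simp
  have h2 : partialD k (partialD l (fun v => φ v v)) = fun _ =>
      (φ.flip (EuclideanSpace.single l 1) + φ (EuclideanSpace.single l 1))
        (EuclideanSpace.single k 1) := by
    ext v; rw [h1]; exact partialD_clm _ k v
  rw [h2, partialD]
  simp

/-- A spray that is quadratic up to a multiple of `y` has vanishing Douglas tensor. -/
lemma douglasOf_eq_zero {G : Fin n → Model n → Model n → ℝ} {z u : Model n}
    {Q : Fin n → Model n →L[ℝ] Model n →L[ℝ] ℝ} {μ : Model n → ℝ}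
    (hG : ∀ᶠ v in 𝓝 u, ∀ i, G i z v = Q i v v + μ v * v i)
    (hμ : ∀ᶠ v in 𝓝 u, DifferentiableAt ℝ μ v ∧ fderiv ℝ μ v v = μ v) (i j k l : Fin n) :
    douglasOf G i j k l z u = 0 := by
  rw [douglasOf_eq]
  have hT : traceFree (fun i => G i z) i =ᶠ[𝓝 u] fun v =>
      (Q i - (1 / ((n : ℝ) + 1)) • (∑ m, ((Q m).flip (EuclideanSpace.single m 1) +
        (Q m) (EuclideanSpace.single m 1))).smulRight
          (coordCLM i)) v v := by
    filter_upwards [hG, hG.eventually_nhds, hμ] with v h1 h2 ⟨h3, h4⟩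
    have hdiv : ∀ m, partialD m (fun v => G m z v) v =
        (Q m v (EuclideanSpace.single m 1) + Q m (EuclideanSpace.single m 1) v) +
          (fderiv ℝ μ v (EuclideanSpace.single m 1) * v m + μ v) := by
      intro m
      have e1 : (fun v => G m z v) =ᶠ[𝓝 v] fun v => Q m v v + μ v * v m :=
        h2.mono fun x hx => hx m
      have e2 : HasFDerivAt (fun v : Model n => Q m v v) _ v :=
        (Q m).hasFDerivAt.clm_apply (hasFDerivAt_id v)
      have e3 : HasFDerivAt (fun v : Model n => v m)
          (coordCLM m) v :=
        (coordCLM m).hasFDerivAt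
      rw [partialD, e1.fderiv_eq, (e2.fun_add (h3.hasFDerivAt.fun_mul e3)).fderiv]
      simp
      ring
    -- By Euler's relation the divergence of `μ y` is `(n + 1) μ`, which is what the trace term
    -- subtracts; only a quadratic field remains.
    have hE : ∑ m, fderiv ℝ μ v (EuclideanSpace.single m 1) * v m = μ v := by
      conv_rhs => rw [← h4, clm_eq_sum (fderiv ℝ μ v) v]
      simp [mul_comm]
    rw [traceFree, h1 i, Finset.sum_congr rfl fun m _ => hdiv m, Finset.sum_add_distrib,
      Finset.sum_add_distrib, Finset.sum_add_distrib, hE]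
    have hn : ((n : ℝ) + 1) ≠ 0 := by positivity
    simp [_root_.sum_apply, Finset.sum_add_distrib]
    field_simp
    ring
  have := (partialD_congr (partialD_congr (partialD_congr hT l) k) j).self_of_nhds
  rw [this]
  exact third_partials_bilin _ j k l u

lemma fderiv_self_of_homogeneous {μ : Model n → ℝ} {v : Model n} (hμ : DifferentiableAt ℝ μ v)
    (h : ∀ t : ℝ, 0 < t → μ (t • v) = t * μ v) : fderiv ℝ μ v v = μ v := by
  have hl : HasDerivAt (fun t : ℝ => t • v) v 1 := by
    simpa using (hasDerivAt_id (1 : ℝ)).smul_const v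
  have h1 : HasFDerivAt μ (fderiv ℝ μ v) ((1 : ℝ) • v) := by simpa using hμ.hasFDerivAt
  have h2 := h1.comp_hasDerivAt (1 : ℝ) hl
  have h3 : (μ ∘ fun t : ℝ => t • v) =ᶠ[𝓝 1] fun t => t * μ v := by
    filter_upwards [lt_mem_nhds (zero_lt_one' ℝ)] with t ht using h t ht
  have h4 : HasDerivAt (fun t : ℝ => t * μ v) (μ v) 1 := by
    simpa using (hasDerivAt_id (1 : ℝ)).mul_const (μ v)
  exact (h2.congr_of_eventuallyEq h3.symm).unique h4

end Partials

/-! ### Smoothness of the corrections in the fibre variable -/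

section Smoothness

attribute [local instance] instNormedAddCommGroupBilin instNormedSpaceBilin

variable {n : ℕ} {A R : Model n →L[ℝ] Model n →L[ℝ] ℝ} {B : Model n →L[ℝ] ℝ} {b v : Model n}
  {σ : Model n →L[ℝ] Model n} {q b2 : ℝ} {k : WithTop ℕ∞}

lemma contDiff_bilin (φ : Model n →L[ℝ] Model n →L[ℝ] ℝ) : ContDiff ℝ k fun v => φ v v :=
  φ.contDiff.clm_apply contDiff_id

lemma contDiffAt_kropinaCorr (hB : B v ≠ 0) (hA : A v v ≠ 0) :
    ContDiffAt ℝ k (fun v => kropinaCorr (A v v) (B v) b2 (R v v) (B (σ v)) v b (σ v)) v := by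
  have cA : ContDiffAt ℝ k (fun v => A v v) v := (contDiff_bilin A).contDiffAt
  have cR : ContDiffAt ℝ k (fun v => R v v) v := (contDiff_bilin R).contDiffAt
  have cB : ContDiffAt ℝ k (fun v => B v) v := B.contDiff.contDiffAt
  have cσ : ContDiffAt ℝ k (fun v => σ v) v := σ.contDiff.contDiffAt
  have cs : ContDiffAt ℝ k (fun v => B (σ v)) v := (B.comp σ).contDiff.contDiffAt
  have c1 : ContDiffAt ℝ k (fun v => -(A v v / (2 * B v))) v :=
    (cA.div (contDiffAt_const.mul cB) (mul_ne_zero two_ne_zero hB)).neg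
  have c2 : ContDiffAt ℝ k (fun v => (R v v + A v v * B (σ v) / B v) / (2 * b2)) v :=
    (cR.add ((cA.mul cs).div cB hB)).div_const _
  have c3 : ContDiffAt ℝ k (fun v => -((B (σ v) + B v * R v v / A v v) / b2)) v :=
    ((cs.add ((cB.mul cR).div cA hA)).div_const _).neg
  exact ((c1.smul cσ).add (c2.smul contDiffAt_const)).add (c3.smul contDiffAt_id)

lemma contDiffAt_qDen (hA : A v v ≠ 0) : ContDiffAt ℝ k (fun v => qDen q √(A v v) (B v) b2) v := by
  have cA : ContDiffAt ℝ k (fun v => √(A v v)) v := (contDiff_bilin A).contDiffAt.sqrt hA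
  have cB : ContDiffAt ℝ k (fun v => B v) v := B.contDiff.contDiffAt
  unfold qDen
  exact ((cB.pow 3).sub ((contDiffAt_const.mul cA).mul (cB.pow 2))).add
    ((contDiffAt_const.mul (cA.pow 3)).mul contDiffAt_const)

lemma contDiffAt_qCorr (hq : q ≠ 1) (hB : B v ≠ 0) (hA : A v v ≠ 0)
    (hΔ : qDen q √(A v v) (B v) b2 ≠ 0) :
    ContDiffAt ℝ k (fun v => qCorr q √(A v v) (B v) b2 (R v v) (B (σ v)) v b (σ v)) v := by
  have cA : ContDiffAt ℝ k (fun v => √(A v v)) v := (contDiff_bilin A).contDiffAt.sqrt hA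
  have cR : ContDiffAt ℝ k (fun v => R v v) v := (contDiff_bilin R).contDiffAt
  have cB : ContDiffAt ℝ k (fun v => B v) v := B.contDiff.contDiffAt
  have cσ : ContDiffAt ℝ k (fun v => σ v) v := σ.contDiff.contDiffAt
  have cs : ContDiffAt ℝ k (fun v => B (σ v)) v := (B.comp σ).contDiff.contDiffAt
  have cD : ContDiffAt ℝ k (fun v => qDen q √(A v v) (B v) b2) v := contDiffAt_qDen hA
  have hq' : q - 1 ≠ 0 := sub_ne_zero.2 hq
  have c1 : ContDiffAt ℝ k (fun v => B v - q * √(A v v)) v := cB.sub (contDiffAt_const.mul cA)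
  have c2 : ContDiffAt ℝ k (fun v => (q - 1) * B v * R v v -
      2 * √(A v v) * (B v - q * √(A v v)) * B (σ v)) v :=
    ((contDiffAt_const.mul cB).mul cR).sub (((contDiffAt_const.mul cA).mul c1).mul cs)
  have c3 : ContDiffAt ℝ k (fun v => √(A v v) * (B v - q * √(A v v)) / (B v * (q - 1))) v :=
    (cA.mul c1).div (cB.mul contDiffAt_const) (mul_ne_zero hB hq')
  have c4 : ContDiffAt ℝ k (fun v => q * √(A v v) ^ 3 * ((q - 1) * B v * R v v -
      2 * √(A v v) * (B v - q * √(A v v)) * B (σ v)) /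
        (2 * (q - 1) * B v * qDen q √(A v v) (B v) b2)) v :=
    ((contDiffAt_const.mul (cA.pow 3)).mul c2).div ((contDiffAt_const.mul cB).mul cD)
      (mul_ne_zero (mul_ne_zero (mul_ne_zero two_ne_zero hq') hB) hΔ)
  have c5 : ContDiffAt ℝ k (fun v => (B v - 2 * q * √(A v v)) * ((q - 1) * B v * R v v -
      2 * √(A v v) * (B v - q * √(A v v)) * B (σ v)) /
        (2 * (q - 1) * qDen q √(A v v) (B v) b2)) v :=
    ((cB.sub (contDiffAt_const.mul cA)).mul c2).div (contDiffAt_const.mul cD)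
      (mul_ne_zero (mul_ne_zero two_ne_zero hq') hΔ)
  exact ((c3.smul cσ).add (c4.smul contDiffAt_const)).add (c5.smul contDiffAt_id)

end Smoothness

/-! ### Metrics, 1-forms and tangent vectors in charts; transition maps -/

section ChartCalculus

attribute [local instance] instNormedAddCommGroupBilin instNormedSpaceBilin

variable {n : ℕ} {M : Type*} [TopologicalSpace M] [ChartedSpace (Model n) M]
  [IsManifold 𝓘(ℝ, Model n) ∞ M]

/-- The derivative of the inverse of the chart `e`, as a map from the model space. -/
noncomputable def vecCLM (e : Chart n M) (z : Model n) :
    Model n →L[ℝ] TangentSpace 𝓘(ℝ, Model n) (e.symm z) :=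
  mfderiv 𝓘(ℝ, Model n) 𝓘(ℝ, Model n) e.symm z

lemma vecCLM_apply (e : Chart n M) (z v : Model n) : vecCLM e z v = vec e z v := rfl

/-- The metric `a`, in the chart `e`, as a function with values in bilinear forms. -/
noncomputable def metricForm (e : Chart n M) (a : RMetric n M) (z : Model n) :
    Model n →L[ℝ] Model n →L[ℝ] ℝ :=
  ContinuousLinearMap.bilinearComp (E := Model n) (F := Model n) (E' := Model n) (F' := Model n)
    (a.inner (e.symm z)) (vecCLM e z) (vecCLM e z)

/-- The 1-form `β`, in the chart `e`, as a function with values in linear forms. -/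
noncomputable def oneFormForm (e : Chart n M) (β : OneForm n M) (z : Model n) :
    Model n →L[ℝ] ℝ :=
  ContinuousLinearMap.comp (M₂ := Model n) (M₃ := ℝ) (β (e.symm z)) (vecCLM e z)

lemma metricForm_apply (e : Chart n M) (a : RMetric n M) (z u w : Model n) :
    metricForm e a z u w = a.inner (e.symm z) (vec e z u) (vec e z w) := rfl

lemma alpha_vec (e : Chart n M) (a : RMetric n M) (z v : Model n) :
    alpha a (e.symm z) (vec e z v) = √(metricForm e a z v v) := rfl

lemma metricForm_symm (e : Chart n M) (a : RMetric n M) (z u w : Model n) :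
    metricForm e a z u w = metricForm e a z w u := a.symm _ _ _

lemma metricForm_nonneg (e : Chart n M) (a : RMetric n M) (z u : Model n) :
    0 ≤ metricForm e a z u u := by
  rw [metricForm_apply]
  by_cases h : vec e z u = 0
  · rw [h]
    exact (ContinuousLinearMap.map_zero _).ge
  · exact (a.pos _ _ h).le

variable {e : Chart n M}

lemma contMDiffOn_vec (he : e ∈ IsManifold.maximalAtlas 𝓘(ℝ, Model n) ∞ M) (u : Model n) :
    ContMDiffOn 𝓘(ℝ, Model n) (𝓘(ℝ, Model n).prod 𝓘(ℝ, Model n)) ∞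
      (fun z => (Bundle.TotalSpace.mk' (Model n) (e.symm z) (vec e z u) :
        TangentBundle 𝓘(ℝ, Model n) M)) e.target := by
  have h1 := (contMDiffOn_symm_of_mem_maximalAtlas he).contMDiffOn_tangentMapWithin
    (m := ∞) le_rfl e.open_target.uniqueMDiffOn
  have h2 : ContMDiffOn 𝓘(ℝ, Model n) (𝓘(ℝ, Model n).prod 𝓘(ℝ, Model n)) ∞
      (fun z => (Bundle.TotalSpace.mk' (Model n) z u :
        TangentBundle 𝓘(ℝ, Model n) (Model n))) e.target :=
    contMDiffOn_vectorSpace_iff_contDiffOn.2 contDiffOn_const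
  have h3 := h1.comp h2 (fun z hz => hz)
  refine h3.congr fun z hz => ?_
  simp only [Function.comp_apply, tangentMapWithin]
  rw [mfderivWithin_of_mem_nhds (e.open_target.mem_nhds hz)]
  rfl

lemma contDiffOn_metricForm (he : e ∈ IsManifold.maximalAtlas 𝓘(ℝ, Model n) ∞ M)
    (a : RMetric n M) : ContDiffOn ℝ ∞ (metricForm e a) e.target := by
  refine contDiffOn_clm_apply.2 fun u => contDiffOn_clm_apply.2 fun w => ?_
  have h1 := a.contMDiff.comp_contMDiffOn (contMDiffOn_symm_of_mem_maximalAtlas he)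
  have h2 : ContMDiffOn 𝓘(ℝ, Model n) (𝓘(ℝ, Model n).prod 𝓘(ℝ, ℝ)) ∞
      (fun z => Bundle.TotalSpace.mk' ℝ (E := Bundle.Trivial M ℝ) (e.symm z)
        (a.inner (e.symm z) (vec e z u) (vec e z w))) e.target := by
    apply ContMDiffOn.clm_bundle_apply₂ (F₁ := Model n) (F₂ := Model n) (F₃ := ℝ)
    · exact h1
    · exact contMDiffOn_vec he u
    · exact contMDiffOn_vec he w
  intro z hz
  have h3 := (Bundle.contMDiffWithinAt_totalSpace.1 (h2 z hz)).2
  exact h3.contDiffWithinAt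

lemma contDiffOn_oneFormForm (he : e ∈ IsManifold.maximalAtlas 𝓘(ℝ, Model n) ∞ M)
    (β : OneForm n M) : ContDiffOn ℝ ∞ (oneFormForm e β) e.target := by
  refine contDiffOn_clm_apply.2 fun u => ?_
  have h1 := β.contMDiff.comp_contMDiffOn (contMDiffOn_symm_of_mem_maximalAtlas he)
  have h2 : ContMDiffOn 𝓘(ℝ, Model n) (𝓘(ℝ, Model n).prod 𝓘(ℝ, ℝ)) ∞
      (fun z => Bundle.TotalSpace.mk' ℝ (E := Bundle.Trivial M ℝ) (e.symm z)
        (β (e.symm z) (vec e z u))) e.target := by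
    apply ContMDiffOn.clm_bundle_apply (F₁ := Model n) (F₂ := ℝ)
    · exact h1
    · exact contMDiffOn_vec he u
  intro z hz
  have h3 := (Bundle.contMDiffWithinAt_totalSpace.1 (h2 z hz)).2
  exact h3.contDiffWithinAt

lemma mdifferentiable_of_mem (he : e ∈ IsManifold.maximalAtlas 𝓘(ℝ, Model n) ∞ M) :
    e.MDifferentiable 𝓘(ℝ, Model n) 𝓘(ℝ, Model n) :=
  ⟨(contMDiffOn_of_mem_maximalAtlas he).mdifferentiableOn (by simp),
    (contMDiffOn_symm_of_mem_maximalAtlas he).mdifferentiableOn (by simp)⟩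

lemma vecCLM_bijective (he : e ∈ IsManifold.maximalAtlas 𝓘(ℝ, Model n) ∞ M) {z : Model n}
    (hz : z ∈ e.target) : Function.Bijective (vecCLM e z) :=
  (mdifferentiable_of_mem he).symm.mfderiv_bijective hz

lemma vec_add (e : Chart n M) (z u w : Model n) : vec e z (u + w) = vec e z u + vec e z w :=
  map_add (vecCLM e z) u w

lemma vec_smul (e : Chart n M) (z : Model n) (c : ℝ) (u : Model n) :
    vec e z (c • u) = c • vec e z u := map_smul (vecCLM e z) c u

lemma metricForm_pos (he : e ∈ IsManifold.maximalAtlas 𝓘(ℝ, Model n) ∞ M) {z : Model n}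
    (hz : z ∈ e.target) (a : RMetric n M) {u : Model n} (hu : u ≠ 0) :
    0 < metricForm e a z u u := by
  refine a.pos _ _ fun h => hu ?_
  exact (vecCLM_bijective he hz).1 (h.trans (map_zero (vecCLM e z)).symm)

lemma contMDiffAt_transition {e e' : Chart n M}
    (he : e ∈ IsManifold.maximalAtlas 𝓘(ℝ, Model n) ∞ M)
    (he' : e' ∈ IsManifold.maximalAtlas 𝓘(ℝ, Model n) ∞ M) {z : Model n} (hz : z ∈ e'.target)
    (hz' : e'.symm z ∈ e.source) : ContDiffAt ℝ ∞ (fun z => e (e'.symm z)) z := by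
  have h1 := (contMDiffOn_symm_of_mem_maximalAtlas he').contMDiffAt (e'.open_target.mem_nhds hz)
  have h2 := (contMDiffOn_of_mem_maximalAtlas he).contMDiffAt (e.open_source.mem_nhds hz')
  exact (h2.comp z h1).contDiffAt

lemma eventually_mem_transition {e e' : Chart n M} {z : Model n} (hz : z ∈ e'.target)
    (hz' : e'.symm z ∈ e.source) : ∀ᶠ x in 𝓝 z, x ∈ e'.target ∧ e'.symm x ∈ e.source :=
  Filter.Eventually.and (e'.open_target.mem_nhds hz)
    ((e'.continuousAt_symm hz).eventually (e.open_source.mem_nhds hz'))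

/-- Transition maps relate the coordinates of tangent vectors. -/
lemma vec_transition {e e' : Chart n M} (he : e ∈ IsManifold.maximalAtlas 𝓘(ℝ, Model n) ∞ M)
    (he' : e' ∈ IsManifold.maximalAtlas 𝓘(ℝ, Model n) ∞ M) {z : Model n} (hz : z ∈ e'.target)
    (hz' : e'.symm z ∈ e.source) (v : Model n) :
    (Bundle.TotalSpace.mk' (Model n) (e.symm (e (e'.symm z)))
      (vec e (e (e'.symm z)) (fderiv ℝ (fun z => e (e'.symm z)) z v)) :
        TangentBundle 𝓘(ℝ, Model n) M) = Bundle.TotalSpace.mk' (Model n) (e'.symm z) (vec e' z v) := by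
  have hψ := (contMDiffAt_transition he he' hz hz').differentiableAt (by simp)
  have h1 : (fun x => e.symm (e (e'.symm x))) =ᶠ[𝓝 z] e'.symm := by
    filter_upwards [eventually_mem_transition hz hz'] with x hx
    exact e.left_inv hx.2
  have hd : MDifferentiableAt 𝓘(ℝ, Model n) 𝓘(ℝ, Model n) e.symm (e (e'.symm z)) :=
    (mdifferentiable_of_mem he).mdifferentiableAt_symm (e.map_source hz')
  have h2 : mfderiv 𝓘(ℝ, Model n) 𝓘(ℝ, Model n) (fun x => e.symm (e (e'.symm x))) z =
      (mfderiv 𝓘(ℝ, Model n) 𝓘(ℝ, Model n) e.symm (e (e'.symm z))).comp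
        (mfderiv 𝓘(ℝ, Model n) 𝓘(ℝ, Model n) (fun z => e (e'.symm z)) z) :=
    mfderiv_comp (f := fun z => e (e'.symm z)) z hd hψ.mdifferentiableAt
  rw [mfderiv_eq_fderiv] at h2
  have h3 := h1.mfderiv_eq (I := 𝓘(ℝ, Model n)) (I' := 𝓘(ℝ, Model n))
  refine Bundle.TotalSpace.ext (e.left_inv hz') (heq_of_eq ?_)
  have h4 : (mfderiv 𝓘(ℝ, Model n) 𝓘(ℝ, Model n) e.symm (e (e'.symm z)))
      (fderiv ℝ (fun z => e (e'.symm z)) z v) =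
      mfderiv 𝓘(ℝ, Model n) 𝓘(ℝ, Model n) (fun x => e.symm (e (e'.symm x))) z v := by
    rw [h2]; rfl
  exact h4.trans (congrArg (fun φ : Model n →L[ℝ] Model n => φ v) h3)

lemma tFun_transition {e e' : Chart n M} (he : e ∈ IsManifold.maximalAtlas 𝓘(ℝ, Model n) ∞ M)
    (he' : e' ∈ IsManifold.maximalAtlas 𝓘(ℝ, Model n) ∞ M) {z : Model n} (hz : z ∈ e'.target)
    (hz' : e'.symm z ∈ e.source) (v : Model n) (F : TFun n M) :
    F (e.symm (e (e'.symm z)))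
      (vec e (e (e'.symm z)) (fderiv ℝ (fun z => e (e'.symm z)) z v)) =
        F (e'.symm z) (vec e' z v) :=
  congrArg (fun p : TangentBundle 𝓘(ℝ, Model n) M => F p.1 p.2) (vec_transition he he' hz hz' v)

lemma bijective_fderiv_transition {e e' : Chart n M}
    (he : e ∈ IsManifold.maximalAtlas 𝓘(ℝ, Model n) ∞ M)
    (he' : e' ∈ IsManifold.maximalAtlas 𝓘(ℝ, Model n) ∞ M) {z : Model n} (hz : z ∈ e'.target)
    (hz' : e'.symm z ∈ e.source) :
    Function.Bijective (fderiv ℝ (fun z => e (e'.symm z)) z) := by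
  have hd := (mdifferentiable_of_mem he).mdifferentiableAt hz'
  have hd' := (mdifferentiable_of_mem he').mdifferentiableAt_symm hz
  have h2 : mfderiv 𝓘(ℝ, Model n) 𝓘(ℝ, Model n) (fun x => e (e'.symm x)) z =
      (mfderiv 𝓘(ℝ, Model n) 𝓘(ℝ, Model n) e (e'.symm z)).comp
        (mfderiv 𝓘(ℝ, Model n) 𝓘(ℝ, Model n) e'.symm z) :=
    mfderiv_comp (f := e'.symm) z hd hd'
  rw [mfderiv_eq_fderiv] at h2
  have h3 : (fderiv ℝ (fun z => e (e'.symm z)) z : Model n → Model n) =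
      (mfderiv 𝓘(ℝ, Model n) 𝓘(ℝ, Model n) e (e'.symm z)) ∘
        (mfderiv 𝓘(ℝ, Model n) 𝓘(ℝ, Model n) e'.symm z) := by
    funext v
    exact congrArg (fun φ : Model n →L[ℝ] Model n => φ v) h2
  rw [h3]
  exact ((mdifferentiable_of_mem he).mfderiv_bijective hz').comp
    ((mdifferentiable_of_mem he').symm.mfderiv_bijective hz)

end ChartCalculus

lemma two_le_infty : (2 : WithTop ℕ∞) ≤ ∞ := by
  have : ((2 : ℕ∞) : WithTop ℕ∞) ≤ ∞ := by
    exact WithTop.coe_le_coe.2 le_top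
  exact this

/-! ### Raising indices with the inverse matrix -/

section Sharp

attribute [local instance] instNormedAddCommGroupBilin instNormedSpaceBilin

variable {n : ℕ}

/-- Raising an index with the inverse of the matrix `m`. -/
noncomputable def sharp (m : Matrix (Fin n) (Fin n) ℝ) (φ : Model n →L[ℝ] ℝ) : Model n :=
  WithLp.toLp 2 fun i => ∑ j, m⁻¹ i j * φ (EuclideanSpace.single j 1)

/-- The matrix of a bilinear form. -/
noncomputable def bilinMatrix (A : Model n →L[ℝ] Model n →L[ℝ] ℝ) : Matrix (Fin n) (Fin n) ℝ :=
  Matrix.of fun i j => A (EuclideanSpace.single i 1) (EuclideanSpace.single j 1)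

variable {A : Model n →L[ℝ] Model n →L[ℝ] ℝ}

lemma bilin_eq_sum (A : Model n →L[ℝ] Model n →L[ℝ] ℝ) (u w : Model n) :
    A u w = ∑ i, ∑ j, bilinMatrix A i j * u i * w j := by
  rw [clm_eq_sum A u, _root_.sum_apply]
  refine Finset.sum_congr rfl fun i _ => ?_
  rw [_root_.smul_apply, clm_eq_sum (A (EuclideanSpace.single i 1)) w, Finset.smul_sum]
  refine Finset.sum_congr rfl fun j _ => ?_
  simp [bilinMatrix]
  ring

lemma isUnit_det_bilinMatrix (hA : ∀ u, u ≠ 0 → 0 < A u u) : IsUnit (bilinMatrix A).det := by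
  rw [isUnit_iff_ne_zero]
  intro h0
  obtain ⟨u, hu, hu0⟩ := Matrix.exists_mulVec_eq_zero_iff.2 h0
  have h1 : A (WithLp.toLp 2 u) (WithLp.toLp 2 u) = 0 := by
    rw [bilin_eq_sum]
    have : ∀ i, ∑ j, bilinMatrix A i j * u i * u j = u i * (bilinMatrix A).mulVec u i := by
      intro i
      rw [Matrix.mulVec, dotProduct, Finset.mul_sum]
      exact Finset.sum_congr rfl fun j _ => by ring
    simp [this, hu0]
  have h2 := hA (WithLp.toLp 2 u) fun h => hu (by simpa using congrArg WithLp.ofLp h)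
  exact h2.ne' h1

lemma bilin_sharp (hA : IsUnit (bilinMatrix A).det) (hs : ∀ u w, A u w = A w u)
    (φ : Model n →L[ℝ] ℝ) (w : Model n) : A (sharp (bilinMatrix A) φ) w = φ w := by
  have : A (sharp (bilinMatrix A) φ) = φ := clm_ext_single fun k => by
    rw [hs, clm_eq_sum (A (EuclideanSpace.single k 1))]
    have h1 : (bilinMatrix A).mulVec ((bilinMatrix A)⁻¹.mulVec
        fun j => φ (EuclideanSpace.single j 1)) k = φ (EuclideanSpace.single k 1) := by
      rw [Matrix.mulVec_mulVec, Matrix.mul_nonsing_inv _ hA, Matrix.one_mulVec]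
    rw [← h1]
    simp [Matrix.mulVec, dotProduct, sharp, bilinMatrix, mul_comm]
  rw [this]

lemma sharp_add (m : Matrix (Fin n) (Fin n) ℝ) (φ ψ : Model n →L[ℝ] ℝ) :
    sharp m (φ + ψ) = sharp m φ + sharp m ψ := by
  ext i
  simp [sharp, mul_add, Finset.sum_add_distrib]

lemma sharp_smul (m : Matrix (Fin n) (Fin n) ℝ) (c : ℝ) (φ : Model n →L[ℝ] ℝ) :
    sharp m (c • φ) = c • sharp m φ := by
  ext i
  simp [sharp, Finset.mul_sum]
  exact Finset.sum_congr rfl fun j _ => by ring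

/-- The bilinear form with coefficients `c i j`. -/
noncomputable def coordBilin (c : Fin n → Fin n → ℝ) : Model n →L[ℝ] Model n →L[ℝ] ℝ :=
  ∑ i, ∑ j, c i j • (coordCLM i).smulRight (coordCLM j)

lemma coordBilin_apply (c : Fin n → Fin n → ℝ) (u w : Model n) :
    coordBilin c u w = ∑ i, ∑ j, c i j * u i * w j := by
  simp [coordBilin, _root_.sum_apply, mul_assoc]

end Sharp

/-! ### Coordinate tensors of a metric and a 1-form as invariant data -/

section ChartFrame

attribute [local instance] instNormedAddCommGroupBilin instNormedSpaceBilin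

variable {n : ℕ} {M : Type*} [TopologicalSpace M] [ChartedSpace (Model n) M]
  [IsManifold 𝓘(ℝ, Model n) ∞ M]

/-- The vector `bⁱ`. -/
noncomputable def bVec (e : Chart n M) (a : RMetric n M) (β : OneForm n M) (z : Model n) :
    Model n := WithLp.toLp 2 fun i => bUp e a β i z

/-- The operator `v ↦ sⁱ₀(v)`. -/
noncomputable def sOp (e : Chart n M) (a : RMetric n M) (β : OneForm n M) (z : Model n) :
    Model n →L[ℝ] Model n :=
  LinearMap.toContinuousLinearMap
    { toFun := fun v => sharp (aLow e a z) ((1 / 2 : ℝ) • (fderiv ℝ (oneFormForm e β) z v -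
        (fderiv ℝ (oneFormForm e β) z).flip v))
      map_add' := fun u v => by
        rw [← sharp_add, ← smul_add, map_add, map_add]
        congr 2
        abel
      map_smul' := fun c v => by
        rw [RingHom.id_apply, ← sharp_smul, map_smul, map_smul]
        congr 1
        ext w
        simp
        ring }

/-- The bilinear map `Γ(u, w)` of the Christoffel symbols. -/
noncomputable def gammaVec (e : Chart n M) (a : RMetric n M) (z u w : Model n) : Model n :=
  WithLp.toLp 2 fun k => coordBilin (fun i j => christoffel e a k i j z) u w

/-- The spray coefficients of `α`. -/
noncomputable def geodVec (e : Chart n M) (a : RMetric n M) (z v : Model n) : Model n :=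
  (1 / 2 : ℝ) • gammaVec e a z v v

/-- The symmetric form `r_{ij}`. -/
noncomputable def rForm (e : Chart n M) (a : RMetric n M) (β : OneForm n M) (z : Model n) :
    Model n →L[ℝ] Model n →L[ℝ] ℝ := coordBilin fun i j => rLow e a β i j z

lemma rForm_self (e : Chart n M) (a : RMetric n M) (β : OneForm n M) (z v : Model n) :
    rForm e a β z v v = r00 e a β z v := by
  rw [rForm, coordBilin_apply]; rfl

lemma aLow_eq (e : Chart n M) (a : RMetric n M) (z : Model n) :
    aLow e a z = bilinMatrix (metricForm e a z) := rfl

lemma bLow_eq (e : Chart n M) (β : OneForm n M) (i : Fin n) (z : Model n) :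
    bLow e β i z = oneFormForm e β z (EuclideanSpace.single i 1) := rfl

lemma bVec_eq (e : Chart n M) (a : RMetric n M) (β : OneForm n M) (z : Model n) :
    bVec e a β z = sharp (aLow e a z) (oneFormForm e β z) := rfl

lemma bSq_eq (e : Chart n M) (a : RMetric n M) (β : OneForm n M) (z : Model n) :
    bSq e a β z = oneFormForm e β z (bVec e a β z) := by
  rw [clm_eq_sum (oneFormForm e β z)]
  rfl

variable {e : Chart n M} {z : Model n}

section AtPoint

variable (he : e ∈ IsManifold.maximalAtlas 𝓘(ℝ, Model n) ∞ M) (hz : z ∈ e.target)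
include he hz

lemma contDiffAt_metricForm (a : RMetric n M) : ContDiffAt ℝ ∞ (metricForm e a) z :=
  (contDiffOn_metricForm he a).contDiffAt (e.open_target.mem_nhds hz)

lemma contDiffAt_oneFormForm (β : OneForm n M) : ContDiffAt ℝ ∞ (oneFormForm e β) z :=
  (contDiffOn_oneFormForm he β).contDiffAt (e.open_target.mem_nhds hz)

lemma isUnit_det_aLow (a : RMetric n M) : IsUnit (aLow e a z).det := by
  rw [aLow_eq]
  exact isUnit_det_bilinMatrix fun u hu => metricForm_pos he hz a hu

lemma metricForm_sharp (a : RMetric n M) (φ : Model n →L[ℝ] ℝ) (w : Model n) :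
    metricForm e a z (sharp (aLow e a z) φ) w = φ w := by
  have h := isUnit_det_aLow he hz a
  rw [aLow_eq] at h ⊢
  exact bilin_sharp h (metricForm_symm e a z) φ w

lemma metricForm_bVec (a : RMetric n M) (β : OneForm n M) (w : Model n) :
    metricForm e a z (bVec e a β z) w = oneFormForm e β z w := by
  rw [bVec_eq, metricForm_sharp he hz]

lemma metricForm_sOp (a : RMetric n M) (β : OneForm n M) (v w : Model n) :
    2 * metricForm e a z (sOp e a β z v) w =
      fderiv ℝ (oneFormForm e β) z v w - fderiv ℝ (oneFormForm e β) z w v := by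
  have : sOp e a β z v = sharp (aLow e a z) ((1 / 2 : ℝ) • (fderiv ℝ (oneFormForm e β) z v -
        (fderiv ℝ (oneFormForm e β) z).flip v)) := rfl
  rw [this, metricForm_sharp he hz]
  simp

lemma partialD_aLow (a : RMetric n M) (i j l : Fin n) :
    partialD i (fun z' => aLow e a z' l j) z = fderiv ℝ (metricForm e a) z
      (EuclideanSpace.single i 1) (EuclideanSpace.single l 1) (EuclideanSpace.single j 1) := by
  have h1 := ((contDiffAt_metricForm he hz a).differentiableAt (by simp)).hasFDerivAt
  have h2 := (h1.clm_apply (hasFDerivAt_const (EuclideanSpace.single l (1 : ℝ)) z)).clm_apply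
    (hasFDerivAt_const (EuclideanSpace.single j (1 : ℝ)) z)
  have h3 := h2.fderiv
  rw [partialD]
  refine (congrArg (fun φ => φ (EuclideanSpace.single i (1 : ℝ))) h3).trans ?_
  simp

lemma partialD_bLow (β : OneForm n M) (i j : Fin n) :
    partialD j (bLow e β i) z = fderiv ℝ (oneFormForm e β) z
      (EuclideanSpace.single j 1) (EuclideanSpace.single i 1) := by
  have h1 := ((contDiffAt_oneFormForm he hz β).differentiableAt (by simp)).hasFDerivAt
  have h2 := h1.clm_apply (hasFDerivAt_const (EuclideanSpace.single i (1 : ℝ)) z)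
  have h3 := h2.fderiv
  rw [partialD]
  refine (congrArg (fun φ => φ (EuclideanSpace.single j (1 : ℝ))) h3).trans ?_
  simp

lemma fderiv_metricForm_symm (a : RMetric n M) (x u w : Model n) :
    fderiv ℝ (metricForm e a) z x u w = fderiv ℝ (metricForm e a) z x w u := by
  have h1 := ((contDiffAt_metricForm he hz a).differentiableAt (by simp)).hasFDerivAt
  have h2 := (h1.clm_apply (hasFDerivAt_const u z)).clm_apply (hasFDerivAt_const w z)
  have h3 := (h1.clm_apply (hasFDerivAt_const w z)).clm_apply (hasFDerivAt_const u z)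
  have h4 : (fun z => metricForm e a z u w) = fun z => metricForm e a z w u :=
    funext fun z => metricForm_symm e a z u w
  rw [h4] at h2
  have h5 := congrArg (fun φ => φ x) (h2.unique h3)
  simpa using h5

/-- Lowering the index cancels the inverse matrix and leaves the Christoffel symbols of the first
kind; this is checked on basis vectors and extended bilinearly. -/
lemma metricForm_gammaVec (a : RMetric n M) (u w x : Model n) :
    2 * metricForm e a z (gammaVec e a z u w) x = fderiv ℝ (metricForm e a) z u x w +
      fderiv ℝ (metricForm e a) z w x u - fderiv ℝ (metricForm e a) z x u w := by
  have h1 : ∀ i j : Fin n, gammaVec e a z (EuclideanSpace.single i 1) (EuclideanSpace.single j 1) =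
      sharp (aLow e a z) ((1 / 2 : ℝ) • (
        (fderiv ℝ (metricForm e a) z (EuclideanSpace.single i 1)).flip (EuclideanSpace.single j 1) +
        (fderiv ℝ (metricForm e a) z (EuclideanSpace.single j 1)).flip (EuclideanSpace.single i 1) -
        ((fderiv ℝ (metricForm e a) z).flip (EuclideanSpace.single i 1)).flip
          (EuclideanSpace.single j 1))) := by
    intro i j
    ext k
    simp only [gammaVec, coordBilin_apply, sharp]
    have : ∀ i' j' : Fin n, christoffel e a k i' j' z * (EuclideanSpace.single i (1 : ℝ) : Model n) i'
        * (EuclideanSpace.single j (1 : ℝ) : Model n) j' =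
        if i' = i then (if j' = j then christoffel e a k i j z else 0) else 0 := by
      intro i' j'
      simp only [PiLp.single_apply]
      split_ifs with h1 h2 <;> simp_all
    simp only [this, Finset.sum_ite_irrel, Finset.sum_const_zero, Finset.sum_ite_eq',
      Finset.mem_univ, if_true]
    rw [christoffel, Finset.mul_sum]
    refine Finset.sum_congr rfl fun l _ => ?_
    rw [partialD_aLow he hz, partialD_aLow he hz, partialD_aLow he hz]
    simp
    ring
  have h2 : ∀ i j : Fin n, 2 * metricForm e a z
      (gammaVec e a z (EuclideanSpace.single i 1) (EuclideanSpace.single j 1)) x =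
      fderiv ℝ (metricForm e a) z (EuclideanSpace.single i 1) x (EuclideanSpace.single j 1) +
      fderiv ℝ (metricForm e a) z (EuclideanSpace.single j 1) x (EuclideanSpace.single i 1) -
      fderiv ℝ (metricForm e a) z x (EuclideanSpace.single i 1) (EuclideanSpace.single j 1) := by
    intro i j
    rw [h1, metricForm_sharp he hz]
    simp
  have h3 : ∀ u w : Model n, gammaVec e a z u w = ∑ i, ∑ j, (u i * w j) •
      gammaVec e a z (EuclideanSpace.single i 1) (EuclideanSpace.single j 1) := by
    intro u w
    ext k
    have hk : ∀ u w, (gammaVec e a z u w) k =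
      coordBilin (fun i j => christoffel e a k i j z) u w := fun _ _ => rfl
    have hs : ∀ f : Fin n → Fin n → Model n, (∑ i, ∑ j, f i j) k = ∑ i, ∑ j, f i j k := by
      intro f
      simp
    rw [hs, hk, clm_eq_sum _ u, _root_.sum_apply]
    refine Finset.sum_congr rfl fun i _ => ?_
    rw [_root_.smul_apply, clm_eq_sum _ w, Finset.smul_sum]
    refine Finset.sum_congr rfl fun j _ => ?_
    rw [PiLp.smul_apply, hk]
    simp [mul_assoc]
  have h4 : ∀ φ : Model n →L[ℝ] Model n →L[ℝ] ℝ, φ u w = ∑ i, ∑ j, (u i * w j) *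
      φ (EuclideanSpace.single i 1) (EuclideanSpace.single j 1) := by
    intro φ
    rw [bilin_eq_sum]
    refine Finset.sum_congr rfl fun i _ => Finset.sum_congr rfl fun j _ => ?_
    simp [bilinMatrix]; ring
  have h5 := h4 (((fderiv ℝ (metricForm e a) z).flip x))
  have h6 := h4 (((fderiv ℝ (metricForm e a) z).flip x).flip)
  have h7 := h4 (fderiv ℝ (metricForm e a) z x)
  simp only [ContinuousLinearMap.flip_apply] at h5 h6
  rw [h5, h6, h7, h3, metricForm_symm]
  simp only [map_sum, map_smul, smul_eq_mul, Finset.mul_sum]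
  rw [← Finset.sum_add_distrib, ← Finset.sum_sub_distrib]
  refine Finset.sum_congr rfl fun i _ => ?_
  rw [← Finset.sum_add_distrib, ← Finset.sum_sub_distrib]
  refine Finset.sum_congr rfl fun j _ => ?_
  rw [metricForm_symm]
  linear_combination (u i * w j) * h2 i j

lemma christoffel_symm (a : RMetric n M) (k i j : Fin n) :
    christoffel e a k i j z = christoffel e a k j i z := by
  rw [christoffel, christoffel]
  congr 1
  refine Finset.sum_congr rfl fun l _ => ?_
  rw [partialD_aLow he hz a i j l, partialD_aLow he hz a j i l, partialD_aLow he hz a l j i,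
    partialD_aLow he hz a l i j]
  have h := fderiv_metricForm_symm he hz a (EuclideanSpace.single l 1)
    (EuclideanSpace.single i 1) (EuclideanSpace.single j 1)
  rw [h]
  ring

lemma isGeod_geodVec (a : RMetric n M) (v : Model n) :
    IsGeod (metricForm e a) z v (geodVec e a z v) := by
  intro w
  have := metricForm_gammaVec he hz a v v w
  rw [fderiv_metricForm_symm he hz a v w v] at this
  rw [geodVec, map_smul, _root_.smul_apply, smul_eq_mul]
  linarith

lemma sum_bCov (a : RMetric n M) (β : OneForm n M) (u w : Model n) :
    coordBilin (fun i j => bCov e a β i j z) u w =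
      fderiv ℝ (oneFormForm e β) z w u - oneFormForm e β z (gammaVec e a z u w) := by
  have h1 : oneFormForm e β z (gammaVec e a z u w) =
      ∑ i, ∑ j, (∑ k, christoffel e a k i j z * bLow e β k z) * u i * w j := by
    rw [clm_eq_sum (oneFormForm e β z)]
    have : ∀ k, (gammaVec e a z u w) k = ∑ i, ∑ j, christoffel e a k i j z * u i * w j :=
      fun k => coordBilin_apply _ u w
    simp only [this, ← bLow_eq, smul_eq_mul, Finset.sum_mul]
    rw [Finset.sum_comm]
    refine Finset.sum_congr rfl fun i _ => ?_
    rw [Finset.sum_comm]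
    refine Finset.sum_congr rfl fun j _ => Finset.sum_congr rfl fun k _ => ?_
    ring
  have h2 : fderiv ℝ (oneFormForm e β) z w u =
      ∑ i, ∑ j, partialD j (bLow e β i) z * u i * w j := by
    have := bilin_eq_sum (fderiv ℝ (oneFormForm e β) z).flip u w
    rw [ContinuousLinearMap.flip_apply] at this
    rw [this]
    refine Finset.sum_congr rfl fun i _ => Finset.sum_congr rfl fun j _ => ?_
    rw [partialD_bLow he hz]
    simp [bilinMatrix]
  rw [coordBilin_apply, h1, h2, ← Finset.sum_sub_distrib]
  refine Finset.sum_congr rfl fun i _ => ?_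
  rw [← Finset.sum_sub_distrib]
  refine Finset.sum_congr rfl fun j _ => ?_
  rw [bCov]
  ring

lemma r00_eq (a : RMetric n M) (β : OneForm n M) (v : Model n) :
    r00 e a β z v = fderiv ℝ (oneFormForm e β) z v v -
      2 * oneFormForm e β z (geodVec e a z v) := by
  have h1 := sum_bCov he hz a β v v
  rw [geodVec, map_smul, smul_eq_mul]
  have h2 : r00 e a β z v = coordBilin (fun i j => bCov e a β i j z) v v := by
    rw [coordBilin_apply, r00]
    have h3 : ∑ i, ∑ j, bCov e a β j i z * v i * v j =
        ∑ i, ∑ j, bCov e a β i j z * v i * v j := by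
      rw [Finset.sum_comm]
      exact Finset.sum_congr rfl fun i _ => Finset.sum_congr rfl fun j _ => by ring
    have h4 : ∑ i, ∑ j, rLow e a β i j z * v i * v j =
        (1 / 2 : ℝ) * (∑ i, ∑ j, bCov e a β i j z * v i * v j) +
        (1 / 2 : ℝ) * (∑ i, ∑ j, bCov e a β j i z * v i * v j) := by
      rw [Finset.mul_sum, Finset.mul_sum, ← Finset.sum_add_distrib]
      refine Finset.sum_congr rfl fun i _ => ?_
      rw [Finset.mul_sum, Finset.mul_sum, ← Finset.sum_add_distrib]
      refine Finset.sum_congr rfl fun j _ => ?_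
      rw [rLow]; ring
    rw [h4, h3]; ring
  rw [h2, h1]; ring

lemma sLow_eq (a : RMetric n M) (β : OneForm n M) (i j : Fin n) :
    sLow e a β i j z = (1 / 2 : ℝ) * (fderiv ℝ (oneFormForm e β) z
      (EuclideanSpace.single j 1) (EuclideanSpace.single i 1) -
        fderiv ℝ (oneFormForm e β) z (EuclideanSpace.single i 1) (EuclideanSpace.single j 1)) := by
  rw [sLow, bCov, bCov, partialD_bLow he hz, partialD_bLow he hz]
  have : ∀ k, christoffel e a k j i z = christoffel e a k i j z := fun k =>
    christoffel_symm he hz a k j i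
  simp only [this]
  ring

/-- `s_j = bⁱ s_{ij}` contracts the first index, whereas `sOp` contracts the second; skewness
produces the sign. -/
lemma sVecUp_eq (a : RMetric n M) (β : OneForm n M) :
    (WithLp.toLp 2 fun i => sVecUp e a β i z) = - sOp e a β z (bVec e a β z) := by
  have h1 : (WithLp.toLp 2 fun i => sVecUp e a β i z) = sharp (aLow e a z)
      ((-1 : ℝ) • ((1 / 2 : ℝ) • (fderiv ℝ (oneFormForm e β) z (bVec e a β z) -
        (fderiv ℝ (oneFormForm e β) z).flip (bVec e a β z)))) := by
    rw [sharp]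
    ext i
    simp only [sVecUp]
    refine Finset.sum_congr rfl fun j _ => ?_
    congr 1
    rw [sVecLow, clm_eq_sum (fderiv ℝ (oneFormForm e β) z) (bVec e a β z),
      clm_eq_sum ((fderiv ℝ (oneFormForm e β) z).flip) (bVec e a β z)]
    simp only [_root_.smul_apply, _root_.sub_apply, _root_.sum_apply, smul_eq_mul,
      ContinuousLinearMap.flip_apply]
    rw [← Finset.sum_sub_distrib, Finset.mul_sum, Finset.mul_sum]
    refine Finset.sum_congr rfl fun k _ => ?_
    rw [sLow_eq he hz]
    have : (bVec e a β z) k = bUp e a β k z := rfl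
    rw [this]
    ring
  rw [h1, sharp_smul, neg_one_smul]
  rfl

lemma isFrame_chart (a : RMetric n M) (β : OneForm n M) (v : Model n) :
    IsFrame (metricForm e a) (oneFormForm e β) z v (bVec e a β z) (sOp e a β z v)
      (geodVec e a z v) (r00 e a β z v) where
  symm := metricForm_symm e a
  pos _ hu := metricForm_pos he hz a hu
  contDiffAt_left := (contDiffAt_metricForm he hz a).of_le two_le_infty
  contDiffAt_right := (contDiffAt_oneFormForm he hz β).of_le two_le_infty
  dual := metricForm_bVec he hz a β
  curl := metricForm_sOp he hz a β v
  geod := isGeod_geodVec he hz a v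
  sym := r00_eq he hz a β v

lemma fibreData_chart (a : RMetric n M) (β : OneForm n M) :
    FibreData (metricForm e a z) (oneFormForm e β z) (bVec e a β z) (sOp e a β z) where
  symm := metricForm_symm e a z
  pos _ hu := metricForm_pos he hz a hu
  dual := metricForm_bVec he hz a β
  skew v w := by
    have h1 := metricForm_sOp he hz a β v w
    have h2 := metricForm_sOp he hz a β w v
    linarith

end AtPoint

end ChartFrame

/-! ### Sprays and domains of the two metrics in a chart -/

section ChartSprays

attribute [local instance] instNormedAddCommGroupBilin instNormedSpaceBilin

variable {n : ℕ} {M : Type*} [TopologicalSpace M] [ChartedSpace (Model n) M]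
  [IsManifold 𝓘(ℝ, Model n) ∞ M]

variable {e : Chart n M} {z : Model n}

/-- The square of the Kropina metric in a chart. -/
lemma kropina_vec_sq (e : Chart n M) (a : RMetric n M) (β : OneForm n M) (z v : Model n) :
    kropina a β (e.symm z) (vec e z v) ^ 2 =
      kropinaFun (metricForm e a z v v, oneFormForm e β z v) := by
  rw [kropina, alpha_vec, Real.sq_sqrt (metricForm_nonneg e a z v)]
  rfl

lemma qMetric_vec_sq (e : Chart n M) (q : ℝ) (a : RMetric n M) (β : OneForm n M) (z v : Model n) :
    qMetric q a β (e.symm z) (vec e z v) ^ 2 =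
      qFun q (metricForm e a z v v, oneFormForm e β z v) := rfl

variable (he : e ∈ IsManifold.maximalAtlas 𝓘(ℝ, Model n) ∞ M) (hz : z ∈ e.target)
include he hz

lemma spray_alpha (a : RMetric n M) (v : Model n) (i : Fin n) :
    spray e (alpha a) i z v = geodVec e a z v i := by
  have hL : (fun z v => alpha a (e.symm z) (vec e z v) ^ 2) = fun z v => metricForm e a z v v := by
    funext z v
    rw [alpha_vec, Real.sq_sqrt (metricForm_nonneg e a z v)]
  have hA := (contDiffAt_metricForm he hz a).of_le two_le_infty
  rw [spray, hL]
  exact sprayOf_eq_of_isSpray (contDiffAt_quad hA)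
    (fibreNondeg_quad (metricForm_symm e a) hA fun u hu => metricForm_pos he hz a hu)
    ((isSpray_quad_iff (metricForm_symm e a) hA).2 (isGeod_geodVec he hz a v)) i

lemma contDiffAt_kropina_vec (a : RMetric n M) (β : OneForm n M) {v : Model n}
    (hv : oneFormForm e β z v ≠ 0) : ContDiffAt ℝ 2
      (fun x : Model n × Model n => kropina a β (e.symm x.1) (vec e x.1 x.2) ^ 2) (z, v) := by
  simp only [kropina_vec_sq]
  exact (hasJet_kropinaFun hv).contDiffAt.comp (z, v)
    (contDiffAt_data ((contDiffAt_metricForm he hz a).of_le two_le_infty)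
      ((contDiffAt_oneFormForm he hz β).of_le two_le_infty))

lemma contDiffAt_qMetric_vec (q : ℝ) (a : RMetric n M) (β : OneForm n M) {v : Model n}
    (hv : √(metricForm e a z v v) < oneFormForm e β z v) : ContDiffAt ℝ 2
      (fun x : Model n × Model n => qMetric q a β (e.symm x.1) (vec e x.1 x.2) ^ 2) (z, v) := by
  simp only [qMetric_vec_sq]
  exact (hasJet_qFun ((isFrame_chart he hz a β v).sq_pos hv) hv).contDiffAt.comp (z, v)
    (contDiffAt_data ((contDiffAt_metricForm he hz a).of_le two_le_infty)
      ((contDiffAt_oneFormForm he hz β).of_le two_le_infty))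

lemma fibreNondeg_kropina_vec (a : RMetric n M) (β : OneForm n M) {v : Model n}
    (hv : oneFormForm e β z v ≠ 0) : FibreNondeg
      (fun x : Model n × Model n => kropina a β (e.symm x.1) (vec e x.1 x.2) ^ 2) z v := by
  simp only [kropina_vec_sq]
  exact (isFrame_chart he hz a β v).fibreNondeg_kropina hv

lemma isSpray_kropina_vec (a : RMetric n M) (β : OneForm n M) {v : Model n}
    (hv : oneFormForm e β z v ≠ 0) : IsSpray
      (fun x : Model n × Model n => kropina a β (e.symm x.1) (vec e x.1 x.2) ^ 2) z v
      (geodVec e a z v + kropinaCorr (metricForm e a z v v) (oneFormForm e β z v) (bSq e a β z)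
        (r00 e a β z v) (oneFormForm e β z (sOp e a β z v)) v (bVec e a β z) (sOp e a β z v)) := by
  simp only [kropina_vec_sq]
  rw [bSq_eq]
  exact (isFrame_chart he hz a β v).isSpray_kropina hv

lemma spray_kropina (a : RMetric n M) (β : OneForm n M) {v : Model n}
    (hv : oneFormForm e β z v ≠ 0) (i : Fin n) : spray e (kropina a β) i z v =
      (geodVec e a z v + kropinaCorr (metricForm e a z v v) (oneFormForm e β z v) (bSq e a β z)
        (r00 e a β z v) (oneFormForm e β z (sOp e a β z v)) v (bVec e a β z)
          (sOp e a β z v)) i :=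
  sprayOf_eq_of_isSpray (contDiffAt_kropina_vec he hz a β hv) (fibreNondeg_kropina_vec he hz a β hv)
    (isSpray_kropina_vec he hz a β hv) i

lemma fibreNondeg_qMetric_vec {q : ℝ} (hq : q ≠ 1) (a : RMetric n M) (β : OneForm n M) {v : Model n}
    (hv : √(metricForm e a z v v) < oneFormForm e β z v) : FibreNondeg
      (fun x : Model n × Model n => qMetric q a β (e.symm x.1) (vec e x.1 x.2) ^ 2) z v ↔
      qDen q √(metricForm e a z v v) (oneFormForm e β z v) (bSq e a β z) ≠ 0 := by
  simp only [qMetric_vec_sq]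
  rw [bSq_eq]
  exact (isFrame_chart he hz a β v).fibreNondeg_q hq hv

lemma isSpray_qMetric_vec {q : ℝ} (hq : q ≠ 1) (a : RMetric n M) (β : OneForm n M) {v : Model n}
    (hv : √(metricForm e a z v v) < oneFormForm e β z v)
    (hΔ : qDen q √(metricForm e a z v v) (oneFormForm e β z v) (bSq e a β z) ≠ 0) : IsSpray
      (fun x : Model n × Model n => qMetric q a β (e.symm x.1) (vec e x.1 x.2) ^ 2) z v
      (geodVec e a z v + qCorr q √(metricForm e a z v v) (oneFormForm e β z v) (bSq e a β z)
        (r00 e a β z v) (oneFormForm e β z (sOp e a β z v)) v (bVec e a β z) (sOp e a β z v)) := by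
  simp only [qMetric_vec_sq]
  rw [bSq_eq] at hΔ ⊢
  exact (isFrame_chart he hz a β v).isSpray_q hq hv hΔ

lemma spray_qMetric {q : ℝ} (hq : q ≠ 1) (a : RMetric n M) (β : OneForm n M) {v : Model n}
    (hv : √(metricForm e a z v v) < oneFormForm e β z v)
    (hΔ : qDen q √(metricForm e a z v v) (oneFormForm e β z v) (bSq e a β z) ≠ 0) (i : Fin n) :
    spray e (qMetric q a β) i z v =
      (geodVec e a z v + qCorr q √(metricForm e a z v v) (oneFormForm e β z v) (bSq e a β z)
        (r00 e a β z v) (oneFormForm e β z (sOp e a β z v)) v (bVec e a β z)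
          (sOp e a β z v)) i :=
  sprayOf_eq_of_isSpray (contDiffAt_qMetric_vec he hz q a β hv)
    ((fibreNondeg_qMetric_vec he hz hq a β hv).2 hΔ) (isSpray_qMetric_vec he hz hq a β hv hΔ) i

lemma nondeg_vec_iff {F : TFun n M} {v : Model n} (hL : ContDiffAt ℝ 2
    (fun x : Model n × Model n => F (e.symm x.1) (vec e x.1 x.2) ^ 2) (z, v)) :
    Nondeg F (e.symm z) (vec e z v) ↔ FibreNondeg
      (fun x : Model n × Model n => F (e.symm x.1) (vec e x.1 x.2) ^ 2) z v := by
  have key : ∀ u w : Model n, fundTensor F (e.symm z) (vec e z v) (vec e z u) (vec e z w) =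
      (1 / 2 : ℝ) * fderiv ℝ (fderiv ℝ
        (fun x : Model n × Model n => F (e.symm x.1) (vec e x.1 x.2) ^ 2)) (z, v) (0, u) (0, w) := by
    intro u w
    rw [← deriv_deriv_fibre hL, fundTensor]
    simp only [vec_add, vec_smul]
  have hb := vecCLM_bijective he hz
  constructor
  · intro h u hu
    have h1 : vec e z u = 0 := by
      refine h _ fun w => ?_
      obtain ⟨w, rfl⟩ := hb.2 w
      rw [vecCLM_apply, key, hu, mul_zero]
    exact hb.1 (h1.trans (map_zero (vecCLM e z)).symm)
  · intro h u hu
    obtain ⟨u, rfl⟩ := hb.2 u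
    have : u = 0 := h u fun w => by
      have := hu (vec e z w)
      rw [vecCLM_apply, key] at this
      linarith
    rw [this, map_zero]

/-- Nondegeneracy becomes an open condition that is explicit in `v`, so the domain can be handled as
an open set of coordinates. -/
lemma vec_mem_qDomain_iff {q : ℝ} (hq : q ≠ 1) (a : RMetric n M) (β : OneForm n M) {v : Model n} :
    vec e z v ∈ qDomain q a β (e.symm z) ↔ √(metricForm e a z v v) < oneFormForm e β z v ∧
      qDen q √(metricForm e a z v v) (oneFormForm e β z v) (bSq e a β z) ≠ 0 := by
  refine and_congr_right fun hv => ?_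
  rw [nondeg_vec_iff he hz (contDiffAt_qMetric_vec he hz q a β hv),
    fibreNondeg_qMetric_vec he hz hq a β hv]

omit he hz in
lemma eventually_qSet (A : Model n →L[ℝ] Model n →L[ℝ] ℝ) (B : Model n →L[ℝ] ℝ) {q b2 : ℝ}
    {u : Model n} (hu : √(A u u) < B u ∧ qDen q √(A u u) (B u) b2 ≠ 0) :
    ∀ᶠ v in 𝓝 u, √(A v v) < B v ∧ qDen q √(A v v) (B v) b2 ≠ 0 := by
  have c2 : Continuous fun x => √(A x x) := by fun_prop
  have c3 : Continuous fun x => qDen q √(A x x) (B x) b2 := by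
    unfold qDen
    fun_prop
  exact (c2.continuousAt.eventually_lt B.continuous.continuousAt hu.1).and
    (c3.continuousAt.eventually_ne hu.2)

-- The domain is nonempty for every `q`: at `y = b`, with `s = √(b²)`, one has `α = s` and `β = s²`,
-- the terms in `q` cancel, and `qDen` equals `s⁵ (s - 1)`.
omit he hz in
lemma FibreData.bVec_mem_qSet {A : Model n →L[ℝ] Model n →L[ℝ] ℝ} {B : Model n →L[ℝ] ℝ}
    {b : Model n} {σ : Model n →L[ℝ] Model n} (h : FibreData A B b σ) (hb : 1 < B b) (q : ℝ) :
    √(A b b) < B b ∧ qDen q √(A b b) (B b) (B b) ≠ 0 := by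
  rw [h.dual]
  have h0 : (0 : ℝ) ≤ B b := by linarith
  have h1 : 1 < √(B b) := by rwa [Real.lt_sqrt zero_le_one, one_pow]
  have h2 : B b = √(B b) ^ 2 := (Real.sq_sqrt h0).symm
  generalize √(B b) = s at *
  rw [h2]
  refine ⟨by nlinarith, ?_⟩
  have : qDen q s (s ^ 2) (s ^ 2) = s ^ 5 * (s - 1) := by rw [qDen]; ring
  rw [this]
  have : 0 < s - 1 := by linarith
  positivity

lemma one_lt_bSq_chart {a : RMetric n M} {β : OneForm n M}
    (hF : ∃ y : TangentSpace 𝓘(ℝ, Model n) (e.symm z), alpha a _ y < beta β _ y) :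
    1 < oneFormForm e β z (bVec e a β z) := by
  obtain ⟨y, hy⟩ := hF
  obtain ⟨u, rfl⟩ := (vecCLM_bijective he hz).2 y
  exact (fibreData_chart he hz a β).one_lt_bSq (u := u) hy

lemma exists_smul_oneFormForm {β β' : OneForm n M} (hβ' : β' (e.symm z) ≠ 0)
    (hcol : ∃ c : ℝ, β' (e.symm z) = c • β (e.symm z)) :
    ∃ c : ℝ, c ≠ 0 ∧ oneFormForm e β' z = c • oneFormForm e β z := by
  obtain ⟨c, hc⟩ := hcol
  refine ⟨c, ?_, ?_⟩
  · rintro rfl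
    exact hβ' (hc.trans (zero_smul ℝ _))
  · ext v
    exact congrArg (fun φ => φ (vec e z v)) hc

end ChartSprays

/-! ### The corrections after the rigidity conditions are imposed -/

section Corrections

variable {n : ℕ} {q α p β b2 r s0 : ℝ} {v b sv τ : Model n}

/-- The multiple of `v` in the spray coefficients of the Kropina metric. -/
noncomputable def kropinaMul (p β b2 r s0 : ℝ) : ℝ := -((s0 + β * r / p) / b2)

/-- The multiple of `v` in the spray coefficients of `β^q / (β - α)^(q-1)`, when `s_{ij} = 0`. -/
noncomputable def qMul (q α β b2 r : ℝ) : ℝ := (β - 2 * q * α) * (β * r) / (2 * qDen q α β b2)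

/-- The coefficient of `b` contains the factor `q r` once `s` vanishes, so only the multiple of `v`
survives. Keeping the product `q r` covers `q = 0` without a condition on `r`. -/
lemma qCorr_eq_smul (hq : q ≠ 1) (hr : q * r = 0) :
    qCorr q α β b2 r 0 v b 0 = qMul q α β b2 r • v := by
  have hq' : q - 1 ≠ 0 := sub_ne_zero.2 hq
  have h1 : q * α ^ 3 * ((q - 1) * β * r - 2 * α * (β - q * α) * 0) /
      (2 * (q - 1) * β * qDen q α β b2) = 0 := by
    rw [show q * α ^ 3 * ((q - 1) * β * r - 2 * α * (β - q * α) * 0) =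
      α ^ 3 * ((q - 1) * β) * (q * r) by ring, hr]
    simp
  rw [qCorr, h1, smul_zero, zero_smul, zero_add, zero_add, qMul]
  congr 1
  rw [show (β - 2 * q * α) * ((q - 1) * β * r - 2 * α * (β - q * α) * 0) =
    (q - 1) * ((β - 2 * q * α) * (β * r)) by ring,
    show 2 * (q - 1) * qDen q α β b2 = (q - 1) * (2 * qDen q α β b2) by ring,
    mul_div_mul_left _ _ hq']

/-- Substituting `hs` cancels the two terms with `β` in the denominator, leaving a field quadratic
in `y` and a multiple of `y`. -/
lemma kropinaCorr_eq (hβ : β ≠ 0) (hb : b2 ≠ 0) (hs : b2 • sv = s0 • b + β • τ) :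
    kropinaCorr p β b2 r s0 v b sv =
      (1 / (2 * b2)) • (p • (-τ) + r • b) + kropinaMul p β b2 r s0 • v := by
  have : sv = (1 / b2) • (s0 • b + β • τ) := by
    rw [← hs, smul_smul, one_div, inv_mul_cancel₀ hb, one_smul]
  rw [kropinaCorr, kropinaMul, this]
  congr 1
  ext i
  simp
  field_simp
  ring

lemma mul_wedge_kropinaCorr (hβ : β ≠ 0) (hb : b2 ≠ 0) (i j : Fin n) :
    β * wedge (kropinaCorr p β b2 r s0 v b sv) v i j =
      -(1 / 2) * (p * wedge sv v i j) + 1 / (2 * b2) * ((β * r + p * s0) * wedge b v i j) := by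
  rw [kropinaCorr, wedge_add_left, wedge_add_left, wedge_smul_left, wedge_smul_left,
    wedge_smul_left, wedge_self]
  field_simp
  ring

lemma qMul_smul {t : ℝ} (ht : t ≠ 0) :
    qMul q (t * α) (t * β) b2 (t ^ 2 * r) = t * qMul q α β b2 r := by
  have h : qDen q (t * α) (t * β) b2 = t ^ 3 * qDen q α β b2 := by rw [qDen, qDen]; ring
  rw [qMul, qMul, h, show (t * β - 2 * q * (t * α)) * (t * β * (t ^ 2 * r)) =
    t ^ 3 * (t * ((β - 2 * q * α) * (β * r))) by ring,
    show 2 * (t ^ 3 * qDen q α β b2) = t ^ 3 * (2 * qDen q α β b2) by ring,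
    mul_div_mul_left _ _ (pow_ne_zero 3 ht), mul_div_assoc]

lemma kropinaMul_smul {t : ℝ} (ht : t ≠ 0) :
    kropinaMul (t ^ 2 * p) (t * β) b2 (t ^ 2 * r) (t * s0) = t * kropinaMul p β b2 r s0 := by
  rw [kropinaMul, kropinaMul]
  rw [show t * β * (t ^ 2 * r) = t ^ 2 * (t * (β * r)) by ring,
    mul_div_mul_left _ _ (pow_ne_zero 2 ht)]
  ring

end Corrections

/-! ### The rigidity argument in a chart -/

section ChartCore

attribute [local instance] instNormedAddCommGroupBilin instNormedSpaceBilin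

variable {n : ℕ} {M : Type*} [TopologicalSpace M] [ChartedSpace (Model n) M]
  [IsManifold 𝓘(ℝ, Model n) ∞ M]

variable {e : Chart n M} {z : Model n}

/-- The difference of the spray coefficients of `β^q / (β - α)^(q-1)` and of `α` in a chart. -/
noncomputable def qCorrAt (e : Chart n M) (q : ℝ) (a : RMetric n M) (β : OneForm n M)
    (z v : Model n) : Model n :=
  qCorr q √(metricForm e a z v v) (oneFormForm e β z v) (bSq e a β z) (r00 e a β z v)
    (oneFormForm e β z (sOp e a β z v)) v (bVec e a β z) (sOp e a β z v)

/-- The difference of the spray coefficients of `α² / β` and of `α` in a chart. -/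
noncomputable def kropinaCorrAt (e : Chart n M) (a : RMetric n M) (β : OneForm n M)
    (z v : Model n) : Model n :=
  kropinaCorr (metricForm e a z v v) (oneFormForm e β z v) (bSq e a β z)
    (r00 e a β z v) (oneFormForm e β z (sOp e a β z v)) v (bVec e a β z) (sOp e a β z v)

/-- The coordinates of the vectors in the domain of `β^q / (β - α)^(q-1)`. -/
def qSet (e : Chart n M) (q : ℝ) (a : RMetric n M) (β : OneForm n M) (z : Model n) :
    Set (Model n) :=
  {v | √(metricForm e a z v v) < oneFormForm e β z v ∧
    qDen q √(metricForm e a z v v) (oneFormForm e β z v) (bSq e a β z) ≠ 0}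

lemma eventually_mem_qSet {q : ℝ} {a : RMetric n M} {β : OneForm n M} {u : Model n}
    (hu : u ∈ qSet e q a β z) : ∀ᶠ v in 𝓝 u, v ∈ qSet e q a β z :=
  eventually_qSet (metricForm e a z) (oneFormForm e β z) hu

lemma pos_of_mem_qSet {q : ℝ} {a : RMetric n M} {β : OneForm n M} {u : Model n}
    (hu : u ∈ qSet e q a β z) : 0 < oneFormForm e β z u := (Real.sqrt_nonneg _).trans_lt hu.1

lemma isPoly_geodVec (e : Chart n M) (a : RMetric n M) (z u w : Model n) (i : Fin n) :
    IsPoly fun t : ℝ => geodVec e a z (u + t • w) i :=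
  (IsPoly.const (1 / 2)).mul (IsPoly.bilin (coordBilin fun j k => christoffel e a i j k z) u w)

lemma isPoly_wedge_geodVec (e : Chart n M) (a : RMetric n M) (z u w : Model n) (i j : Fin n) :
    IsPoly fun t : ℝ => wedge (geodVec e a z (u + t • w)) (u + t • w) i j :=
  ((isPoly_geodVec e a z u w i).mul (IsPoly.coord u w j)).sub
    ((isPoly_geodVec e a z u w j).mul (IsPoly.coord u w i))

variable (he : e ∈ IsManifold.maximalAtlas 𝓘(ℝ, Model n) ∞ M) (hz : z ∈ e.target)
include he hz

lemma bSq_pos_chart (a : RMetric n M) (β : OneForm n M) {u : Model n}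
    (hu : oneFormForm e β z u ≠ 0) : 0 < bSq e a β z := by
  rw [bSq_eq]
  exact (fibreData_chart he hz a β).bSq_pos hu

lemma exists_isPoly_wedge_kropinaCorrAt (a : RMetric n M) (β : OneForm n M) {u : Model n}
    (hu : oneFormForm e β z u ≠ 0) (w : Model n) (i j : Fin n) :
    ∃ N, IsPoly N ∧ ∀ᶠ t : ℝ in 𝓝 0, oneFormForm e β z (u + t • w) *
      wedge (kropinaCorrAt e a β z (u + t • w)) (u + t • w) i j = N t := by
  have hb := (bSq_pos_chart he hz a β hu).ne'
  have pB := IsPoly.clm (oneFormForm e β z) u w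
  have pA := IsPoly.bilin (metricForm e a z) u w
  have pR := IsPoly.bilin (rForm e a β z) u w
  have ps := IsPoly.clm ((oneFormForm e β z).comp (sOp e a β z)) u w
  have pW := IsPoly.wedge_clm (sOp e a β z) u w i j
  have pb := IsPoly.wedge_const (bVec e a β z) u w i j
  refine ⟨_, ((IsPoly.const (-(1 / 2))).mul (pA.mul pW)).add
    ((IsPoly.const (1 / (2 * bSq e a β z))).mul (((pB.mul pR).add (pA.mul ps)).mul pb)), ?_⟩
  filter_upwards [(tendsto_line u w).eventually
    ((oneFormForm e β z).continuous.continuousAt.eventually_ne hu)] with t ht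
  rw [kropinaCorrAt, mul_wedge_kropinaCorr ht hb]
  simp only [rForm_self]
  rfl

variable {q : ℝ} {a a' : RMetric n M} {β β' : OneForm n M}

lemma bVec_mem_qSet (hF : ∃ y : TangentSpace 𝓘(ℝ, Model n) (e.symm z), alpha a _ y < beta β _ y)
    (q : ℝ) : bVec e a β z ∈ qSet e q a β z := by
  have h := (fibreData_chart he hz a β).bVec_mem_qSet (one_lt_bSq_chart he hz hF) q
  rw [qSet, bSq_eq]
  exact h

/-- If the spray coefficients of `β^q / (β - α)^(q-1)` are, up to multiples of `y` and a factor
`β`, polynomial in `y`, then `β` is closed, and moreover parallel when `q ≠ 0`. -/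
lemma sOp_eq_zero_and_r00_eq_zero (hn : 3 ≤ n) (hq : q ≠ 1)
    (hF : ∃ y : TangentSpace 𝓘(ℝ, Model n) (e.symm z), alpha a _ y < beta β _ y)
    (hpoly : ∀ u ∈ qSet e q a β z, ∀ w i j, ∃ N, IsPoly N ∧ ∀ᶠ t : ℝ in 𝓝 0,
      oneFormForm e β z (u + t • w) *
        wedge (qCorrAt e q a β z (u + t • w)) (u + t • w) i j = N t) :
    (∀ v, sOp e a β z v = 0) ∧ ∀ v, q * r00 e a β z v = 0 := by
  have h := fibreData_chart he hz a β
  have hu := bVec_mem_qSet he hz hF q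
  have hp := hpoly _ hu
  simp only [qCorrAt, ← rForm_self, bSq_eq] at hp
  have hΔ := hu.2
  rw [bSq_eq] at hΔ
  have hstar := fun y hy i j => h.parity_identity hq hu.1 hΔ hp (y := y) hy i j
  have hb := one_lt_bSq_chart he hz hF
  refine ⟨fun v => h.sigma_eq_zero hn hb hstar v, fun v => ?_⟩
  by_cases hq0 : q = 0
  · rw [hq0, zero_mul]
  · rw [← rForm_self, h.sym_eq_zero hn hq hb hstar hq0, mul_zero]

lemma sOp_eq_of_poly {u : Model n} (hu : oneFormForm e β z u ≠ 0)
    (hpoly : ∀ w i j, ∃ N, IsPoly N ∧ ∀ᶠ t : ℝ in 𝓝 0,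
      wedge (kropinaCorrAt e a β z (u + t • w)) (u + t • w) i j = N t) (v : Model n) :
    bSq e a β z • sOp e a β z v = oneFormForm e β z (sOp e a β z v) • bVec e a β z +
      oneFormForm e β z v • sOp e a β z (bVec e a β z) := by
  simp only [kropinaCorrAt, ← rForm_self, bSq_eq] at hpoly ⊢
  exact (fibreData_chart he hz a β).sigma_eq_of_kropina hu hpoly v

end ChartCore

/-! ### Rigidity implies that both metrics are Douglas -/

section Quadratic

attribute [local instance] instNormedAddCommGroupBilin instNormedSpaceBilin

variable {n : ℕ} {M : Type*} [TopologicalSpace M] [ChartedSpace (Model n) M]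
  [IsManifold 𝓘(ℝ, Model n) ∞ M]

variable {e : Chart n M} {z : Model n}

/-- The quadratic vector field `(1 / 2b²) (α² sⁱ + r₀₀ bⁱ)`. -/
noncomputable def kropinaQuad (e : Chart n M) (a : RMetric n M) (β : OneForm n M)
    (z v : Model n) : Model n :=
  (1 / (2 * bSq e a β z)) • (metricForm e a z v v • (WithLp.toLp 2 fun i => sVecUp e a β i z) +
    r00 e a β z v • bVec e a β z)

variable (he : e ∈ IsManifold.maximalAtlas 𝓘(ℝ, Model n) ∞ M) (hz : z ∈ e.target)
include he hz

variable {q : ℝ} {a a' : RMetric n M} {β β' : OneForm n M}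

lemma qCorrAt_eq (hq : q ≠ 1) (hs : ∀ v, sOp e a β z v = 0) (hr : ∀ v, q * r00 e a β z v = 0)
    (v : Model n) : qCorrAt e q a β z v =
      qMul q √(metricForm e a z v v) (oneFormForm e β z v) (bSq e a β z) (r00 e a β z v) • v := by
  rw [qCorrAt, hs, map_zero, qCorr_eq_smul hq (hr v)]

lemma kropinaCorrAt_eq (hs : ∀ v, bSq e a β z • sOp e a β z v =
      oneFormForm e β z (sOp e a β z v) • bVec e a β z +
        oneFormForm e β z v • sOp e a β z (bVec e a β z)) {v : Model n}
    (hv : oneFormForm e β z v ≠ 0) : kropinaCorrAt e a β z v = kropinaQuad e a β z v +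
      kropinaMul (metricForm e a z v v) (oneFormForm e β z v) (bSq e a β z) (r00 e a β z v)
        (oneFormForm e β z (sOp e a β z v)) • v := by
  rw [kropinaCorrAt, kropinaCorr_eq hv (bSq_pos_chart he hz a β hv).ne' (hs v), kropinaQuad,
    sVecUp_eq he hz]

lemma douglasOf_qMetric (hq : q ≠ 1) (hs : ∀ v, sOp e a β z v = 0)
    (hr : ∀ v, q * r00 e a β z v = 0) {u : Model n} (hu : u ∈ qSet e q a β z) (i j k l : Fin n) :
    douglasOf (spray e (qMetric q a β)) i j k l z u = 0 := by
  refine douglasOf_eq_zero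
    (Q := fun i => (1 / 2 : ℝ) • coordBilin fun j k => christoffel e a i j k z)
    (μ := fun v => qMul q √(metricForm e a z v v) (oneFormForm e β z v) (bSq e a β z)
      (r00 e a β z v)) ?_ ?_ i j k l
  · filter_upwards [eventually_mem_qSet hu] with v hv i
    rw [spray_qMetric he hz hq a β hv.1 hv.2]
    have := qCorrAt_eq he hz hq hs hr v
    rw [qCorrAt] at this
    rw [this]
    rfl
  · filter_upwards [eventually_mem_qSet hu] with v hv
    have hp := ((isFrame_chart he hz a β v).sq_pos hv.1).ne'
    have hd : DifferentiableAt ℝ (fun v => qMul q √(metricForm e a z v v) (oneFormForm e β z v)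
        (bSq e a β z) (r00 e a β z v)) v := by
      simp only [← rForm_self]
      have cA : ContDiffAt ℝ 1 (fun v => √(metricForm e a z v v)) v :=
        (contDiff_bilin _).contDiffAt.sqrt hp
      have cR : ContDiffAt ℝ 1 (fun v => rForm e a β z v v) v := (contDiff_bilin _).contDiffAt
      have cB : ContDiffAt ℝ 1 (fun v => oneFormForm e β z v) v :=
        (oneFormForm e β z).contDiff.contDiffAt
      have cD : ContDiffAt ℝ 1 (fun v => qDen q √(metricForm e a z v v) (oneFormForm e β z v)
        (bSq e a β z)) v := contDiffAt_qDen hp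
      exact (((cB.sub (contDiffAt_const.mul cA)).mul (cB.mul cR)).div (contDiffAt_const.mul cD)
        (mul_ne_zero two_ne_zero hv.2)).differentiableAt one_ne_zero
    refine ⟨hd, fderiv_self_of_homogeneous hd fun t ht => ?_⟩
    rw [← qMul_smul ht.ne', ← rForm_self, ← rForm_self]
    simp only [map_smul, _root_.smul_apply, smul_eq_mul]
    rw [← mul_assoc t t, ← mul_assoc t t, ← sq, Real.sqrt_mul (sq_nonneg t), Real.sqrt_sq ht.le]

lemma douglasOf_kropina (hs : ∀ v, bSq e a β z • sOp e a β z v =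
      oneFormForm e β z (sOp e a β z v) • bVec e a β z +
        oneFormForm e β z v • sOp e a β z (bVec e a β z)) {u : Model n}
    (hu : oneFormForm e β z u ≠ 0) (i j k l : Fin n) :
    douglasOf (spray e (kropina a β)) i j k l z u = 0 := by
  have hev : ∀ᶠ v in 𝓝 u, oneFormForm e β z v ≠ 0 :=
    (oneFormForm e β z).continuous.continuousAt.eventually_ne hu
  refine douglasOf_eq_zero
    (Q := fun i => ((1 / 2 : ℝ) • coordBilin fun j k => christoffel e a i j k z) +
      (1 / (2 * bSq e a β z)) • (sVecUp e a β i z • metricForm e a z +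
        bUp e a β i z • rForm e a β z))
    (μ := fun v => kropinaMul (metricForm e a z v v) (oneFormForm e β z v) (bSq e a β z)
      (r00 e a β z v) (oneFormForm e β z (sOp e a β z v))) ?_ ?_ i j k l
  · filter_upwards [hev] with v hv i
    rw [spray_kropina he hz a β hv]
    have := kropinaCorrAt_eq he hz hs hv
    rw [kropinaCorrAt] at this
    rw [this, kropinaQuad, ← rForm_self]
    simp only [PiLp.add_apply, PiLp.smul_apply, _root_.add_apply, _root_.smul_apply, smul_eq_mul,
      geodVec, gammaVec, bVec]
    ring
  · filter_upwards [hev] with v hv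
    have hp := (metricForm_pos he hz a (IsFrame.ne_zero_of_right hv)).ne'
    have hb := (bSq_pos_chart he hz a β hv).ne'
    have hd : DifferentiableAt ℝ (fun v => kropinaMul (metricForm e a z v v) (oneFormForm e β z v)
        (bSq e a β z) (r00 e a β z v) (oneFormForm e β z (sOp e a β z v))) v := by
      simp only [← rForm_self]
      have cA : ContDiffAt ℝ 1 (fun v => metricForm e a z v v) v := (contDiff_bilin _).contDiffAt
      have cR : ContDiffAt ℝ 1 (fun v => rForm e a β z v v) v := (contDiff_bilin _).contDiffAt
      have cB : ContDiffAt ℝ 1 (fun v => oneFormForm e β z v) v :=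
        (oneFormForm e β z).contDiff.contDiffAt
      have cs : ContDiffAt ℝ 1 (fun v => oneFormForm e β z (sOp e a β z v)) v :=
        ((oneFormForm e β z).comp (sOp e a β z)).contDiff.contDiffAt
      exact ((cs.add ((cB.mul cR).div cA hp)).div_const _).neg.differentiableAt one_ne_zero
    refine ⟨hd, fderiv_self_of_homogeneous hd fun t ht => ?_⟩
    rw [← kropinaMul_smul ht.ne', ← rForm_self, ← rForm_self]
    simp only [map_smul, _root_.smul_apply, smul_eq_mul]
    rw [← mul_assoc t t, ← mul_assoc t t, ← sq]

end Quadratic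

/-! ### The derivative of the determinant -/

section Jacobi

variable {n : ℕ}

lemma contDiff_det {k : WithTop ℕ∞} :
    ContDiff ℝ k fun m : Fin n → Fin n → ℝ => (Matrix.of m).det := by
  simp only [Matrix.det_apply]
  refine ContDiff.sum fun σ _ => ContDiff.const_smul _ (contDiff_prod fun i _ => ?_)
  exact (contDiff_apply_apply ℝ ℝ (σ i) i)

/-- Jacobi's formula for the derivative of the determinant. -/
lemma fderiv_det {m : Fin n → Fin n → ℝ} (hm : IsUnit (Matrix.of m).det) (h : Fin n → Fin n → ℝ) :
    fderiv ℝ (fun m : Fin n → Fin n → ℝ => (Matrix.of m).det) m h =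
      (Matrix.of m).det * ∑ k, ∑ l, (Matrix.of m)⁻¹ k l * h l k := by
  have h1 : HasFDerivAt (fun m : Fin n → Fin n → ℝ => (Matrix.of m).det)
      (fderiv ℝ (fun m : Fin n → Fin n → ℝ => (Matrix.of m).det) m) (m + (0 : ℝ) • h) := by
    have := ((contDiff_det (n := n) (k := 1)).differentiable one_ne_zero m).hasFDerivAt
    simpa using this
  have h2 : HasDerivAt (fun t : ℝ => m + t • h) h 0 := by
    simpa using ((hasDerivAt_id (0 : ℝ)).smul_const h).const_add m
  have h3 := h1.comp_hasDerivAt (0 : ℝ) h2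
  have h4 : ∀ t : ℝ, (Matrix.of (m + t • h)).det =
      (Matrix.of m).det * (1 + t • ((Matrix.of m)⁻¹ * Matrix.of h)).det := by
    intro t
    rw [← Matrix.det_mul, mul_add, mul_one, Matrix.mul_smul, ← mul_assoc,
      Matrix.mul_nonsing_inv _ hm, one_mul]
    rfl
  have h5 : HasDerivAt (fun t : ℝ => (Matrix.of m).det *
      (1 + t • ((Matrix.of m)⁻¹ * Matrix.of h)).det)
      ((Matrix.of m).det * Matrix.trace ((Matrix.of m)⁻¹ * Matrix.of h)) 0 := by
    refine HasDerivAt.const_mul _ ?_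
    -- Here `det (1 + t K) = 1 + t tr K + t² P(t)` with `P` polynomial, so the derivative at `0` is
    -- the trace.
    have h6 := fun t : ℝ => Matrix.det_one_add_smul t ((Matrix.of m)⁻¹ * Matrix.of h)
    simp only [h6]
    set P := (1 + (Polynomial.X : Polynomial ℝ) • ((Matrix.of m)⁻¹ * Matrix.of h).map
      Polynomial.C).det.divX.divX
    have h7 := (((hasDerivAt_id (0 : ℝ)).const_mul
      (Matrix.trace ((Matrix.of m)⁻¹ * Matrix.of h))).const_add 1).fun_add
      ((P.hasDerivAt 0).fun_mul (hasDerivAt_pow 2 (0 : ℝ)))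
    simpa using h7
  have h8 := h3.unique (h5.congr_of_eventuallyEq (Filter.Eventually.of_forall h4))
  rw [h8]
  simp [Matrix.trace, Matrix.mul_apply]

end Jacobi

/-! ### The potential of the 1-form `θ` -/

section Potential

attribute [local instance] instNormedAddCommGroupBilin instNormedSpaceBilin

variable {n : ℕ} {M : Type*} [TopologicalSpace M] [ChartedSpace (Model n) M]
  [IsManifold 𝓘(ℝ, Model n) ∞ M]

variable {e : Chart n M} {z : Model n}

/-- Twice the logarithm of the ratio of the volume densities of `a` and `a'`, corrected by the
length of `β`. -/
noncomputable def potential (e : Chart n M) (a a' : RMetric n M) (β : OneForm n M)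
    (z : Model n) : ℝ :=
  Real.log ((aLow e a z).det / ((aLow e a' z).det * bSq e a' β z))

section Calculus

variable (he : e ∈ IsManifold.maximalAtlas 𝓘(ℝ, Model n) ∞ M) (hz : z ∈ e.target)
include he hz

lemma contDiffAt_entries (a : RMetric n M) : ContDiffAt ℝ ∞
    (fun z => fun i j : Fin n => aLow e a z i j) z := by
  refine contDiffAt_pi.2 fun i => contDiffAt_pi.2 fun j => ?_
  exact ((contDiffAt_metricForm he hz a).clm_apply contDiffAt_const).clm_apply contDiffAt_const

lemma contDiffAt_det_aLow (a : RMetric n M) : ContDiffAt ℝ ∞ (fun z => (aLow e a z).det) z :=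
  contDiff_det.contDiffAt.comp z (contDiffAt_entries he hz a)

/-- Of the three terms in the Christoffel symbols, two are antisymmetric together in the contracted
indices and drop out against the symmetric inverse metric. -/
lemma trace_gammaVec (a : RMetric n M) (v : Model n) :
    2 * ∑ k, gammaVec e a z v (EuclideanSpace.single k 1) k = ∑ k, ∑ l, (aLow e a z)⁻¹ k l *
      fderiv ℝ (metricForm e a) z v (EuclideanSpace.single l 1) (EuclideanSpace.single k 1) := by
  have h1 : ∀ k, 2 * gammaVec e a z v (EuclideanSpace.single k 1) k = ∑ l, (aLow e a z)⁻¹ k l *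
      (fderiv ℝ (metricForm e a) z v (EuclideanSpace.single l 1) (EuclideanSpace.single k 1) +
       (fderiv ℝ (metricForm e a) z (EuclideanSpace.single k 1) (EuclideanSpace.single l 1) v -
       fderiv ℝ (metricForm e a) z (EuclideanSpace.single l 1) (EuclideanSpace.single k 1) v)) := by
    intro k
    set X := gammaVec e a z v (EuclideanSpace.single k 1)
    have h2 : X = sharp (aLow e a z) (metricForm e a z X) := by
      have h3 : metricForm e a z (X - sharp (aLow e a z) (metricForm e a z X)) = 0 := by
        ext w
        rw [map_sub, _root_.sub_apply, metricForm_sharp he hz, sub_self]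
        rfl
      by_contra h4
      have h5 := metricForm_pos he hz a (sub_ne_zero.2 h4)
      rw [h3] at h5
      simp at h5
    have h6 : X k = ∑ l, (aLow e a z)⁻¹ k l * metricForm e a z X (EuclideanSpace.single l 1) := by
      conv_lhs => rw [h2]
      rfl
    rw [h6, Finset.mul_sum]
    refine Finset.sum_congr rfl fun l _ => ?_
    have h7 := metricForm_gammaVec he hz a v (EuclideanSpace.single k 1) (EuclideanSpace.single l 1)
    rw [fderiv_metricForm_symm he hz a (EuclideanSpace.single l 1)
      (EuclideanSpace.single k 1) v]
    linear_combination (aLow e a z)⁻¹ k l * h7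
  have hsymm : ∀ k l, (aLow e a z)⁻¹ k l = (aLow e a z)⁻¹ l k := by
    have h2 : (aLow e a z).transpose = aLow e a z := by
      ext i j
      exact metricForm_symm e a z _ _
    intro k l
    conv_rhs => rw [← h2, ← Matrix.transpose_nonsing_inv, Matrix.transpose_apply]
  rw [Finset.mul_sum]
  simp only [h1, mul_add, mul_sub, Finset.sum_add_distrib, Finset.sum_sub_distrib]
  have h8 : ∑ k, ∑ l, (aLow e a z)⁻¹ k l *
      fderiv ℝ (metricForm e a) z (EuclideanSpace.single l 1) (EuclideanSpace.single k 1) v =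
      ∑ k, ∑ l, (aLow e a z)⁻¹ k l *
      fderiv ℝ (metricForm e a) z (EuclideanSpace.single k 1) (EuclideanSpace.single l 1) v := by
    rw [Finset.sum_comm]
    exact Finset.sum_congr rfl fun k _ => Finset.sum_congr rfl fun l _ => by rw [hsymm l k]
  rw [h8, sub_self, add_zero]

lemma fderiv_det_aLow (a : RMetric n M) (v : Model n) :
    fderiv ℝ (fun z => (aLow e a z).det) z v =
      (aLow e a z).det * (2 * ∑ k, gammaVec e a z v (EuclideanSpace.single k 1) k) := by
  have h1 := ((contDiffAt_entries he hz a).differentiableAt (by simp)).hasFDerivAt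
  have h2 := ((contDiff_det (n := n) (k := 1)).differentiable one_ne_zero
    (fun i j => aLow e a z i j)).hasFDerivAt
  have h3 := h2.comp z h1
  have h4 := congrArg (fun φ => φ v) h3.fderiv
  refine Eq.trans h4 ?_
  rw [ContinuousLinearMap.comp_apply]
  refine (fderiv_det (isUnit_det_aLow he hz a) _).trans ?_
  rw [trace_gammaVec he hz]
  have h5 : ∀ l k, fderiv ℝ (fun z => fun i j : Fin n => aLow e a z i j) z v l k =
      fderiv ℝ (metricForm e a) z v (EuclideanSpace.single l 1) (EuclideanSpace.single k 1) := by
    intro l k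
    have e1 := hasFDerivAt_pi'.1 (hasFDerivAt_pi'.1 h1 l) k
    have h1 := ((contDiffAt_metricForm he hz a).differentiableAt (by simp)).hasFDerivAt
    have e2 := (h1.clm_apply (hasFDerivAt_const (EuclideanSpace.single l (1 : ℝ)) z)).clm_apply
      (hasFDerivAt_const (EuclideanSpace.single k (1 : ℝ)) z)
    have e3 := congrArg (fun φ => φ v) (e1.unique e2)
    simpa using e3
  simp only [h5]
  rfl

lemma exists_equiv_metricForm (a : RMetric n M) :
    ∃ E : Model n ≃L[ℝ] (Model n →L[ℝ] ℝ), (E : Model n →L[ℝ] Model n →L[ℝ] ℝ) =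
      metricForm e a z := by
  refine ⟨ContinuousLinearEquiv.ofBijective (metricForm e a z) ?_ ?_,
    ContinuousLinearEquiv.coe_ofBijective _ _ _⟩
  · refine LinearMap.ker_eq_bot'.2 fun u hu => ?_
    by_contra h0
    have h1 := metricForm_pos he hz a h0
    have h2 : metricForm e a z u = 0 := hu
    rw [h2] at h1
    simp at h1
  · refine LinearMap.range_eq_top.2 fun φ => ⟨sharp (aLow e a z) φ, ?_⟩
    ext w
    exact metricForm_sharp he hz a φ w

lemma bVec_eq_inverse (a : RMetric n M) (β : OneForm n M) :
    bVec e a β z = ContinuousLinearMap.inverse (metricForm e a z) (oneFormForm e β z) := by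
  obtain ⟨E, hE⟩ := exists_equiv_metricForm he hz a
  rw [← hE, ContinuousLinearMap.inverse_equiv]
  have : E (bVec e a β z) = oneFormForm e β z := by
    ext w
    rw [← metricForm_bVec he hz a β w, ← hE]
    rfl
  rw [← this]
  exact (E.symm_apply_apply _).symm

/-- The dual vector is obtained by applying the inverse of the metric as an operator, and inversion
is smooth at invertible operators. -/
lemma contDiffAt_bVec (a : RMetric n M) (β : OneForm n M) : ContDiffAt ℝ ∞ (bVec e a β) z := by
  obtain ⟨E, hE⟩ := exists_equiv_metricForm he hz a
  have h1 : ContDiffAt ℝ ∞ ContinuousLinearMap.inverse (metricForm e a z) := by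
    rw [← hE]
    exact contDiffAt_map_inverse E
  have h2 := (h1.comp z (contDiffAt_metricForm he hz a)).clm_apply
    (contDiffAt_oneFormForm he hz β)
  refine h2.congr_of_eventuallyEq ?_
  filter_upwards [e.open_target.mem_nhds hz] with z' hz'
  exact bVec_eq_inverse he hz' a β

lemma contDiffAt_bSq (a : RMetric n M) (β : OneForm n M) : ContDiffAt ℝ ∞ (bSq e a β) z := by
  have : bSq e a β = fun z => oneFormForm e β z (bVec e a β z) := funext fun z => bSq_eq e a β z
  rw [this]
  exact (contDiffAt_oneFormForm he hz β).clm_apply (contDiffAt_bVec he hz a β)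

/-- The derivative of `bⁱ` is never computed: differentiating `A(b, b₀) = β(b₀)` with `b₀` frozen at
its value at `z` expresses `β(∂_v b)` through derivatives of `A` and `β`. -/
lemma fderiv_bSq (a : RMetric n M) (β : OneForm n M) (v : Model n) :
    fderiv ℝ (bSq e a β) z v = 2 * (fderiv ℝ (oneFormForm e β) z v (bVec e a β z) -
      oneFormForm e β z (gammaVec e a z (bVec e a β z) v)) := by
  have hA := ((contDiffAt_metricForm he hz a).differentiableAt (by simp)).hasFDerivAt
  have hB := ((contDiffAt_oneFormForm he hz β).differentiableAt (by simp)).hasFDerivAt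
  have hb := ((contDiffAt_bVec he hz a β).differentiableAt (by simp)).hasFDerivAt
  set b := bVec e a β z with hbz
  have h1 := (hA.clm_apply hb).clm_apply (hasFDerivAt_const b z)
  have h2 := hB.clm_apply (hasFDerivAt_const b z)
  have h3 : (fun z => metricForm e a z (bVec e a β z) b) =ᶠ[𝓝 z]
      fun z => oneFormForm e β z b := by
    filter_upwards [e.open_target.mem_nhds hz] with z' hz'
    exact metricForm_bVec he hz' a β b
  have h4 := congrArg (fun φ => φ v) ((h2.congr_of_eventuallyEq h3).unique h1)
  have h5 := congrArg (fun φ => φ v) (hB.clm_apply hb).fderiv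
  have h6 : bSq e a β = fun z => oneFormForm e β z (bVec e a β z) := funext fun z => bSq_eq e a β z
  rw [← h6] at h5
  simp only [← hbz, _root_.add_apply, ContinuousLinearMap.comp_apply,
    ContinuousLinearMap.flip_apply, _root_.zero_apply, map_zero, zero_add] at h4 h5
  have h7 := metricForm_gammaVec he hz a b v b
  rw [metricForm_symm, metricForm_bVec he hz] at h7
  rw [metricForm_symm, metricForm_bVec he hz] at h4
  rw [h5]
  linarith

/-- The trace of the polarization of `kropinaQuad`. -/
lemma trace_kropinaQuad (a : RMetric n M) (β : OneForm n M) (v : Model n) :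
    metricForm e a z v (WithLp.toLp 2 fun i => sVecUp e a β i z) +
      rForm e a β z v (bVec e a β z) = (1 / 2 : ℝ) * fderiv ℝ (bSq e a β) z v := by
  have h1 : rForm e a β z v (bVec e a β z) = (1 / 2 : ℝ) *
      (coordBilin (fun i j => bCov e a β i j z) v (bVec e a β z) +
        coordBilin (fun i j => bCov e a β i j z) (bVec e a β z) v) := by
    simp only [rForm, coordBilin_apply]
    conv_rhs => rw [Finset.sum_comm (f := fun i j => bCov e a β i j z * (bVec e a β z) i * v j)]
    rw [← Finset.sum_add_distrib, Finset.mul_sum]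
    refine Finset.sum_congr rfl fun i _ => ?_
    rw [← Finset.sum_add_distrib, Finset.mul_sum]
    refine Finset.sum_congr rfl fun j _ => ?_
    rw [rLow]
    ring
  have h2 : gammaVec e a z v (bVec e a β z) = gammaVec e a z (bVec e a β z) v := by
    ext k
    simp only [gammaVec, coordBilin_apply]
    rw [Finset.sum_comm]
    refine Finset.sum_congr rfl fun i _ => Finset.sum_congr rfl fun j _ => ?_
    rw [christoffel_symm he hz a k j i]
    ring
  have h3 := metricForm_sOp he hz a β (bVec e a β z) v
  rw [h1, sum_bCov he hz, sum_bCov he hz, h2, sVecUp_eq he hz, metricForm_symm, map_neg,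
    _root_.neg_apply, fderiv_bSq he hz]
  linarith

lemma contDiffAt_potential (a a' : RMetric n M) (β : OneForm n M) (hb : bSq e a' β z ≠ 0) :
    ContDiffAt ℝ ∞ (potential e a a' β) z := by
  have h1 := (isUnit_det_aLow he hz a).ne_zero
  have h2 := (isUnit_det_aLow he hz a').ne_zero
  exact ((contDiffAt_det_aLow he hz a).div ((contDiffAt_det_aLow he hz a').mul
    (contDiffAt_bSq he hz a' β)) (mul_ne_zero h2 hb)).log (div_ne_zero h1 (mul_ne_zero h2 hb))

/-- The traces of the Christoffel symbols are logarithmic derivatives of the determinants, and the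
trace of the Kropina quadratic part is a logarithmic derivative of `b²`. The right side is thus
twice the divergence of the field to be identified with `θ y`. -/
lemma fderiv_potential (a a' : RMetric n M) (β : OneForm n M) (hb : bSq e a' β z ≠ 0)
    (v : Model n) : fderiv ℝ (potential e a a' β) z v =
      2 * ∑ k, gammaVec e a z v (EuclideanSpace.single k 1) k -
      2 * ∑ k, gammaVec e a' z v (EuclideanSpace.single k 1) k -
      2 / bSq e a' β z * (metricForm e a' z v (WithLp.toLp 2 fun i => sVecUp e a' β i z) +
        rForm e a' β z v (bVec e a' β z)) := by
  have h1 := (isUnit_det_aLow he hz a).ne_zero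
  have h2 := (isUnit_det_aLow he hz a').ne_zero
  have d1 := ((contDiffAt_det_aLow he hz a).differentiableAt (by simp)).hasFDerivAt.log h1
  have d2 := ((contDiffAt_det_aLow he hz a').differentiableAt (by simp)).hasFDerivAt.log h2
  have d3 := ((contDiffAt_bSq he hz a' β).differentiableAt (by simp)).hasFDerivAt.log hb
  have d4 := (d1.fun_sub d2).fun_sub d3
  have h3 : potential e a a' β =ᶠ[𝓝 z] fun z => Real.log (aLow e a z).det -
      Real.log (aLow e a' z).det - Real.log (bSq e a' β z) := by
    have c1 := (contDiffAt_det_aLow he hz a).continuousAt.eventually_ne h1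
    have c2 := (contDiffAt_det_aLow he hz a').continuousAt.eventually_ne h2
    have c3 := (contDiffAt_bSq he hz a' β).continuousAt.eventually_ne hb
    filter_upwards [c1, c2, c3] with z h1 h2 h3
    rw [potential, Real.log_div h1 (mul_ne_zero h2 h3), Real.log_mul h2 h3]
    ring
  have h4 := congrArg (fun φ => φ v) (d4.congr_of_eventuallyEq h3).fderiv
  simp only [_root_.sub_apply, _root_.smul_apply, smul_eq_mul, fderiv_det_aLow he hz] at h4
  rw [h4, trace_kropinaQuad he hz]
  field_simp

end Calculus

end Potential

/-! ### Independence of the potential from the chart -/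

section Transition

attribute [local instance] instNormedAddCommGroupBilin instNormedSpaceBilin

variable {n : ℕ} {M : Type*} [TopologicalSpace M] [ChartedSpace (Model n) M]
  [IsManifold 𝓘(ℝ, Model n) ∞ M]

variable {e e' : Chart n M} {z : Model n}
  (he : e ∈ IsManifold.maximalAtlas 𝓘(ℝ, Model n) ∞ M)
  (he' : e' ∈ IsManifold.maximalAtlas 𝓘(ℝ, Model n) ∞ M) (hz : z ∈ e'.target)
  (hz' : e'.symm z ∈ e.source)

include he he' hz hz'

lemma metricForm_transition (a : RMetric n M) (u w : Model n) :
    metricForm e a (e (e'.symm z)) (fderiv ℝ (fun z => e (e'.symm z)) z u)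
      (fderiv ℝ (fun z => e (e'.symm z)) z w) = metricForm e' a z u w := by
  have key : ∀ v, metricForm e a (e (e'.symm z)) (fderiv ℝ (fun z => e (e'.symm z)) z v)
      (fderiv ℝ (fun z => e (e'.symm z)) z v) = metricForm e' a z v v := fun v =>
    tFun_transition he he' hz hz' v fun x y => a.inner x y y
  -- Transition is known for functions of a single tangent vector; polarization gives the bilinear
  -- form.
  have h1 := key (u + w)
  have h2 := key u
  have h3 := key w
  simp only [map_add, _root_.add_apply] at h1
  have h4 := metricForm_symm e a (e (e'.symm z)) (fderiv ℝ (fun z => e (e'.symm z)) z u)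
    (fderiv ℝ (fun z => e (e'.symm z)) z w)
  have h5 := metricForm_symm e' a z u w
  linarith

lemma oneFormForm_transition (β : OneForm n M) (v : Model n) :
    oneFormForm e β (e (e'.symm z)) (fderiv ℝ (fun z => e (e'.symm z)) z v) =
      oneFormForm e' β z v :=
  tFun_transition he he' hz hz' v (beta β)

lemma bSq_transition (a : RMetric n M) (β : OneForm n M) :
    bSq e a β (e (e'.symm z)) = bSq e' a β z := by
  have hx := e.map_source hz'
  have h1 : bVec e a β (e (e'.symm z)) =
      fderiv ℝ (fun z => e (e'.symm z)) z (bVec e' a β z) := by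
    by_contra h0
    have h2 := metricForm_pos he hx a (sub_ne_zero.2 h0)
    have h3 : metricForm e a (e (e'.symm z)) (bVec e a β (e (e'.symm z)) -
        fderiv ℝ (fun z => e (e'.symm z)) z (bVec e' a β z)) = 0 := by
      ext w
      obtain ⟨w, rfl⟩ := (bijective_fderiv_transition he he' hz hz').2 w
      rw [map_sub, _root_.sub_apply, metricForm_bVec he hx, metricForm_transition he he' hz hz',
        oneFormForm_transition he he' hz hz', metricForm_bVec he' hz, sub_self]
      rfl
    rw [h3] at h2
    simp at h2
  rw [bSq_eq, bSq_eq, h1, oneFormForm_transition he he' hz hz']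

lemma det_aLow_transition (a : RMetric n M) :
    (aLow e' a z).det = (Matrix.of fun i j => fderiv ℝ (fun z => e (e'.symm z)) z
      (EuclideanSpace.single j 1) i).det ^ 2 * (aLow e a (e (e'.symm z))).det := by
  set J : Matrix (Fin n) (Fin n) ℝ := Matrix.of fun i j => fderiv ℝ (fun z => e (e'.symm z)) z
      (EuclideanSpace.single j 1) i with hJ
  have : aLow e' a z = J.transpose * aLow e a (e (e'.symm z)) * J := by
    ext i j
    refine (metricForm_transition he he' hz hz' a (EuclideanSpace.single i 1)
      (EuclideanSpace.single j 1)).symm.trans ?_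
    rw [bilin_eq_sum, Matrix.mul_apply, Finset.sum_comm]
    refine Finset.sum_congr rfl fun k _ => ?_
    rw [Matrix.mul_apply, Finset.sum_mul]
    refine Finset.sum_congr rfl fun l _ => ?_
    rw [aLow_eq, Matrix.transpose_apply, hJ, Matrix.of_apply, Matrix.of_apply]
    ring
  rw [this, Matrix.det_mul, Matrix.det_mul, Matrix.det_transpose]
  ring

/-- Both determinants acquire the same squared Jacobian factor, which cancels in the quotient, and
`b²` is a scalar. -/
lemma potential_transition (a a' : RMetric n M) (β : OneForm n M) :
    potential e a a' β (e (e'.symm z)) = potential e' a a' β z := by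
  have h0 := (isUnit_det_aLow he' hz a).ne_zero
  have h1 := det_aLow_transition he he' hz hz' a
  have h2 := det_aLow_transition he he' hz hz' a'
  rw [h1] at h0
  rw [potential, potential, h1, h2, bSq_transition he he' hz hz', mul_assoc,
    mul_div_mul_left _ _ (left_ne_zero_of_mul h0)]

end Transition

/-! ### Exact 1-forms -/

section Differential

attribute [local instance] instNormedAddCommGroupBilin instNormedSpaceBilin

variable {n : ℕ} {M : Type*} [TopologicalSpace M] [ChartedSpace (Model n) M]
  [IsManifold 𝓘(ℝ, Model n) ∞ M]

/-- The differential of a smooth function as a 1-form. -/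
noncomputable def differential (f : M → ℝ) (hf : ContMDiff 𝓘(ℝ, Model n) 𝓘(ℝ, ℝ) ∞ f) :
    OneForm n M where
  toFun x := mfderiv 𝓘(ℝ, Model n) 𝓘(ℝ, ℝ) f x
  contMDiff_toFun x₀ := by
    rw [contMDiffAt_hom_bundle]
    refine ⟨contMDiffAt_id, ?_⟩
    have h := (hf x₀).mfderiv_const (m := ∞) (by simp)
    refine h.congr_of_eventuallyEq (Filter.Eventually.of_forall fun x => ?_)
    ext v
    simp [inTangentCoordinates, ContinuousLinearMap.inCoordinates]
    rfl

lemma differential_vec {e : Chart n M} (he : e ∈ IsManifold.maximalAtlas 𝓘(ℝ, Model n) ∞ M)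
    {z : Model n} (hz : z ∈ e.target) (f : M → ℝ) (hf : ContMDiff 𝓘(ℝ, Model n) 𝓘(ℝ, ℝ) ∞ f)
    (v : Model n) :
    beta (differential f hf) (e.symm z) (vec e z v) = fderiv ℝ (fun z => f (e.symm z)) z v := by
  have h1 := (mdifferentiable_of_mem he).mdifferentiableAt_symm hz
  have h2 : mfderiv 𝓘(ℝ, Model n) 𝓘(ℝ, ℝ) (fun z => f (e.symm z)) z =
      (mfderiv 𝓘(ℝ, Model n) 𝓘(ℝ, ℝ) f (e.symm z)).comp
        (mfderiv 𝓘(ℝ, Model n) 𝓘(ℝ, Model n) e.symm z) :=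
    mfderiv_comp (f := e.symm) z ((hf (e.symm z)).mdifferentiableAt (by simp)) h1
  rw [mfderiv_eq_fderiv] at h2
  exact (congrArg (fun φ : Model n →L[ℝ] ℝ => φ v) h2).symm

end Differential

/-! ### Quadratic vector fields proportional to `y` -/

section Proportional

attribute [local instance] instNormedAddCommGroupBilin instNormedSpaceBilin

variable {n : ℕ}

/-- A quadratic vector field that is everywhere proportional to `y` is `y` times a linear form,
which is a multiple of its divergence. -/
lemma quad_of_wedge_eq_zero {Q : Fin n → Model n →L[ℝ] Model n →L[ℝ] ℝ}
    (hs : ∀ i u w, Q i u w = Q i w u) (h : ∀ v i j, Q i v v * v j - Q j v v * v i = 0)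
    (v : Model n) (i : Fin n) :
    ((n : ℝ) + 1) * Q i v v = (∑ j, 2 * Q j v (EuclideanSpace.single j 1)) * v i := by
  have h1 : ∀ w j, 2 * Q i v w * v j + Q i v v * w j = 2 * Q j v w * v i + Q j v v * w i := by
    intro w j
    have e1 := h (v + w) i j
    have e2 := h (v - w) i j
    have e3 := h w i j
    simp only [map_add, map_sub, _root_.add_apply, _root_.sub_apply, PiLp.add_apply,
      PiLp.sub_apply, hs i w v, hs j w v] at e1 e2
    linear_combination (1 / 2 : ℝ) * e1 - (1 / 2 : ℝ) * e2 - e3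
  -- The polarized relation is contracted by setting `w` to the `j`-th basis vector and summing over
  -- `j`; the coefficients of `Q i v v` combine to `2 + n - 1`.
  have h2 : ∑ j, (2 * Q i v (EuclideanSpace.single j 1) * v j +
      Q i v v * (EuclideanSpace.single j (1 : ℝ) : Model n) j) =
      ∑ j, (2 * Q j v (EuclideanSpace.single j 1) * v i +
      Q j v v * (EuclideanSpace.single j (1 : ℝ) : Model n) i) :=
    Finset.sum_congr rfl fun j _ => h1 _ j
  have h3 : ∑ j, 2 * Q i v (EuclideanSpace.single j 1) * v j = 2 * Q i v v := by
    conv_rhs => rw [clm_eq_sum (Q i v) v]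
    rw [Finset.mul_sum]
    exact Finset.sum_congr rfl fun j _ => by simp; ring
  rw [Finset.sum_add_distrib, Finset.sum_add_distrib, h3, ← Finset.sum_mul] at h2
  simp at h2
  linarith

end Proportional

/-! ### Construction of the global 1-form `θ` -/

section Construction

attribute [local instance] instNormedAddCommGroupBilin instNormedSpaceBilin

variable {n : ℕ} {M : Type*} [TopologicalSpace M] [ChartedSpace (Model n) M]
  [IsManifold 𝓘(ℝ, Model n) ∞ M]

/-- `potential`, as a function on the manifold. -/
noncomputable def globalPotential (a a' : RMetric n M) (β : OneForm n M) (x : M) : ℝ :=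
  potential (chartAt (Model n) x) a a' β (chartAt (Model n) x x)

lemma exists_oneFormForm_ne_zero {e : Chart n M}
    (he : e ∈ IsManifold.maximalAtlas 𝓘(ℝ, Model n) ∞ M) {z : Model n} (hz : z ∈ e.target)
    {β : OneForm n M} (hβ : β (e.symm z) ≠ 0) : ∃ u, oneFormForm e β z u ≠ 0 := by
  by_contra! h
  refine hβ ?_
  ext y
  obtain ⟨u, rfl⟩ := (vecCLM_bijective he hz).2 y
  exact h u

lemma bSq_ne_zero {e : Chart n M}
    (he : e ∈ IsManifold.maximalAtlas 𝓘(ℝ, Model n) ∞ M) {z : Model n} (hz : z ∈ e.target)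
    (a : RMetric n M) {β : OneForm n M} (hβ : β (e.symm z) ≠ 0) : bSq e a β z ≠ 0 := by
  obtain ⟨u, hu⟩ := exists_oneFormForm_ne_zero he hz hβ
  exact (bSq_pos_chart he hz a β hu).ne'

lemma globalPotential_symm {e : Chart n M}
    (he : e ∈ IsManifold.maximalAtlas 𝓘(ℝ, Model n) ∞ M) {z : Model n} (hz : z ∈ e.target)
    (a a' : RMetric n M) (β : OneForm n M) :
    globalPotential a a' β (e.symm z) = potential e a a' β z :=
  potential_transition (IsManifold.chart_mem_maximalAtlas _) he hz (mem_chart_source _ _) a a' β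

lemma contMDiff_globalPotential (a a' : RMetric n M) {β : OneForm n M} (hβ : ∀ x, β x ≠ 0) :
    ContMDiff 𝓘(ℝ, Model n) 𝓘(ℝ, ℝ) ∞ (globalPotential a a' β) := by
  intro x
  have he : chartAt (Model n) x ∈ IsManifold.maximalAtlas 𝓘(ℝ, Model n) ∞ M :=
    IsManifold.chart_mem_maximalAtlas x
  set e := chartAt (Model n) x
  have hx : x ∈ e.source := mem_chart_source _ x
  have hz := e.map_source hx
  have h1 := (contDiffAt_potential he hz a a' β (bSq_ne_zero he hz a' (hβ _))).contMDiffAt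
  have h2 := (contMDiffOn_of_mem_maximalAtlas he).contMDiffAt (e.open_source.mem_nhds hx)
  refine (h1.comp x h2).congr_of_eventuallyEq ?_
  filter_upwards [e.open_source.mem_nhds hx] with x' hx'
  rw [Function.comp_apply, ← globalPotential_symm he (e.map_source hx') a a' β,
    e.left_inv hx']

lemma gammaVec_symm {e : Chart n M} (he : e ∈ IsManifold.maximalAtlas 𝓘(ℝ, Model n) ∞ M)
    {z : Model n} (hz : z ∈ e.target) (a : RMetric n M) (u w : Model n) :
    gammaVec e a z u w = gammaVec e a z w u := by
  ext k
  simp only [gammaVec, coordBilin_apply]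
  rw [Finset.sum_comm]
  refine Finset.sum_congr rfl fun i _ => Finset.sum_congr rfl fun j _ => ?_
  rw [christoffel_symm he hz a k j i]
  ring

lemma rForm_symm (e : Chart n M) (a : RMetric n M) (β : OneForm n M) (z u w : Model n) :
    rForm e a β z u w = rForm e a β z w u := by
  rw [rForm, coordBilin_apply, coordBilin_apply, Finset.sum_comm]
  refine Finset.sum_congr rfl fun i _ => Finset.sum_congr rfl fun j _ => ?_
  rw [rLow, rLow]
  ring

/-- The linear factor of a quadratic field proportional to `y` is its divergence over `n + 1`, and
here the divergence is half the differential of the global potential. Thus `θ` can be fixed in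
advance, smooth and independent of the chart, with proportionality only a pointwise condition. -/
lemma exists_oneForm (a a' : RMetric n M) {β : OneForm n M} (hβ : ∀ x, β x ≠ 0) :
    ∃ θ : OneForm n M, ∀ e ∈ IsManifold.maximalAtlas 𝓘(ℝ, Model n) ∞ M, ∀ z ∈ e.target,
      (∀ v i j, wedge (geodVec e a z v - geodVec e a' z v - kropinaQuad e a' β z v) v i j = 0) →
      ∀ v i, (geodVec e a z v - geodVec e a' z v - kropinaQuad e a' β z v) i =
        beta θ (e.symm z) (vec e z v) * v i := by
  have hf := contMDiff_globalPotential a a' hβ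
  have hf' : ContMDiff 𝓘(ℝ, Model n) 𝓘(ℝ, ℝ) ∞
      (fun x => (1 / (2 * ((n : ℝ) + 1))) * globalPotential a a' β x) :=
    contMDiff_const.mul hf
  refine ⟨differential _ hf', fun e he z hz hw v i => ?_⟩
  have hb := bSq_ne_zero he hz a' (hβ (e.symm z))
  rw [differential_vec he hz]
  have h1 : (fun z => (1 / (2 * ((n : ℝ) + 1))) * globalPotential a a' β (e.symm z)) =ᶠ[𝓝 z]
      fun z => (1 / (2 * ((n : ℝ) + 1))) * potential e a a' β z := by
    filter_upwards [e.open_target.mem_nhds hz] with z hz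
    rw [globalPotential_symm he hz]
  have h2 := (contDiffAt_potential he hz a a' β hb).differentiableAt (by simp)
  have h3 : fderiv ℝ (fun z => (1 / (2 * ((n : ℝ) + 1))) * globalPotential a a' β (e.symm z)) z v =
      (1 / (2 * ((n : ℝ) + 1))) * fderiv ℝ (potential e a a' β) z v := by
    rw [h1.fderiv_eq, fderiv_const_mul h2]
    rfl
  rw [h3, fderiv_potential he hz a a' β hb]
  let Q : Fin n → Model n →L[ℝ] Model n →L[ℝ] ℝ := fun i =>
    (1 / 2 : ℝ) • (coordBilin fun j k => christoffel e a i j k z) -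
    (1 / 2 : ℝ) • (coordBilin fun j k => christoffel e a' i j k z) -
      (1 / (2 * bSq e a' β z)) • (sVecUp e a' β i z • metricForm e a' z +
        bUp e a' β i z • rForm e a' β z)
  have hQ : ∀ i u w, Q i u w = (1 / 2 : ℝ) * gammaVec e a z u w i - (1 / 2 : ℝ) *
      gammaVec e a' z u w i - 1 / (2 * bSq e a' β z) * (sVecUp e a' β i z * metricForm e a' z u w +
        bUp e a' β i z * rForm e a' β z u w) := fun i u w => rfl
  have hQ' : ∀ i v, (geodVec e a z v - geodVec e a' z v - kropinaQuad e a' β z v) i = Q i v v := by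
    intro i v
    rw [hQ]
    simp only [geodVec, kropinaQuad, PiLp.sub_apply, PiLp.add_apply, PiLp.smul_apply, smul_eq_mul,
      rForm_self, bVec]
    ring
  have h4 := quad_of_wedge_eq_zero (Q := Q) (fun i u w => by
    rw [hQ, hQ, gammaVec_symm he hz a u w, gammaVec_symm he hz a' u w, metricForm_symm e a' z u w,
      rForm_symm e a' β z u w]) (fun v i j => by
    have := hw v i j
    rw [wedge, hQ', hQ'] at this
    exact this) v i
  have h5 : metricForm e a' z v (WithLp.toLp 2 fun i => sVecUp e a' β i z) =
      ∑ j, sVecUp e a' β j z * metricForm e a' z v (EuclideanSpace.single j 1) := by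
    rw [clm_eq_sum (metricForm e a' z v) (WithLp.toLp 2 _)]
    rfl
  have h6 : rForm e a' β z v (bVec e a' β z) =
      ∑ j, bUp e a' β j z * rForm e a' β z v (EuclideanSpace.single j 1) := by
    rw [clm_eq_sum (rForm e a' β z v) (bVec e a' β z)]
    rfl
  have h7 : ∑ j, 2 * Q j v (EuclideanSpace.single j 1) =
      ∑ k, gammaVec e a z v (EuclideanSpace.single k 1) k -
      ∑ k, gammaVec e a' z v (EuclideanSpace.single k 1) k -
      1 / bSq e a' β z * (metricForm e a' z v (WithLp.toLp 2 fun i => sVecUp e a' β i z) +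
        rForm e a' β z v (bVec e a' β z)) := by
    rw [h5, h6, ← Finset.sum_add_distrib, Finset.mul_sum, ← Finset.sum_sub_distrib,
      ← Finset.sum_sub_distrib]
    refine Finset.sum_congr rfl fun j _ => ?_
    rw [hQ]
    field_simp
  rw [hQ', ← mul_right_inj' (show ((n : ℝ) + 1) ≠ 0 by positivity), h4, h7]
  field_simp

end Construction

/-! ### From either hypothesis to rigidity, and back to the sprays -/

section Rigidity

attribute [local instance] instNormedAddCommGroupBilin instNormedSpaceBilin

variable {n : ℕ} {M : Type*} [TopologicalSpace M] [ChartedSpace (Model n) M]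
  [IsManifold 𝓘(ℝ, Model n) ∞ M]

/-- The conditions, in the chart `e` at `z`, that make `β^q / (β - α)^(q-1)` and `α'² / β'`
Douglas metrics. -/
structure IsRigid (e : Chart n M) (q : ℝ) (a a' : RMetric n M) (β β' : OneForm n M)
    (z : Model n) : Prop where
  closed : ∀ v, sOp e a β z v = 0
  killing : ∀ v, q * r00 e a β z v = 0
  curl : ∀ v, bSq e a' β' z • sOp e a' β' z v =
    oneFormForm e β' z (sOp e a' β' z v) • bVec e a' β' z +
      oneFormForm e β' z v • sOp e a' β' z (bVec e a' β' z)

variable {e : Chart n M} {z : Model n} {q : ℝ} {a a' : RMetric n M} {β β' : OneForm n M}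

lemma wedge_toLp_add_smul {G : Fin n → ℝ} {X v : Model n} {c : ℝ} (h : ∀ i, G i = X i + c * v i)
    (i j : Fin n) : wedge (WithLp.toLp 2 G) v i j = wedge X v i j := by
  simp only [wedge, h]
  ring

lemma isPoly_kropinaQuad (e : Chart n M) (a : RMetric n M) (β : OneForm n M) (z u w : Model n)
    (i : Fin n) : IsPoly fun t : ℝ => kropinaQuad e a β z (u + t • w) i := by
  have h := (IsPoly.const (1 / (2 * bSq e a β z))).mul
    (((IsPoly.bilin (metricForm e a z) u w).mul (IsPoly.const (sVecUp e a β i z))).add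
      ((IsPoly.bilin (rForm e a β z) u w).mul (IsPoly.const (bUp e a β i z))))
  simp only [rForm_self] at h
  exact h

variable (he : e ∈ IsManifold.maximalAtlas 𝓘(ℝ, Model n) ∞ M) (hz : z ∈ e.target)
include he hz

lemma contDiffAt_spray_qMetric (hq : q ≠ 1) {u : Model n} (hu : u ∈ qSet e q a β z)
    (i : Fin n) : ContDiffAt ℝ 4 (spray e (qMetric q a β) i z) u := by
  have hp := ((isFrame_chart he hz a β u).sq_pos hu.1).ne'
  have h1 : ContDiffAt ℝ 4 (fun v => qCorrAt e q a β z v) u := by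
    have := contDiffAt_qCorr (A := metricForm e a z) (R := rForm e a β z) (b := bVec e a β z)
      (σ := sOp e a β z) (k := 4) hq (pos_of_mem_qSet hu).ne' hp hu.2
    simp only [rForm_self] at this
    exact this
  have h2 : ContDiffAt ℝ 4 (fun v => geodVec e a z v i) u :=
    (contDiff_const.mul (contDiff_bilin
      (coordBilin fun j k => christoffel e a i j k z))).contDiffAt
  refine (h2.add ((coordCLM i).contDiff.contDiffAt.comp u h1)).congr_of_eventuallyEq ?_
  filter_upwards [eventually_mem_qSet hu] with v hv
  exact spray_qMetric he hz hq a β hv.1 hv.2 i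

lemma contDiffAt_spray_kropina {u : Model n} (hu : oneFormForm e β z u ≠ 0)
    (i : Fin n) : ContDiffAt ℝ 4 (spray e (kropina a β) i z) u := by
  have hp := (metricForm_pos he hz a (IsFrame.ne_zero_of_right hu)).ne'
  have h1 : ContDiffAt ℝ 4 (fun v => kropinaCorrAt e a β z v) u := by
    have := contDiffAt_kropinaCorr (A := metricForm e a z) (R := rForm e a β z)
      (b := bVec e a β z) (σ := sOp e a β z) (k := 4) (b2 := bSq e a β z) hu hp
    simp only [rForm_self] at this
    exact this
  have h2 : ContDiffAt ℝ 4 (fun v => geodVec e a z v i) u :=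
    (contDiff_const.mul (contDiff_bilin
      (coordBilin fun j k => christoffel e a i j k z))).contDiffAt
  refine (h2.add ((coordCLM i).contDiff.contDiffAt.comp u h1)).congr_of_eventuallyEq ?_
  filter_upwards [(oneFormForm e β z).continuous.continuousAt.eventually_ne hu] with v hv
  exact spray_kropina he hz a β hv i

/-- Under the Douglas hypothesis the wedge is polynomial even without the factor `β`; the factor is
kept so that the Douglas and the projective hypotheses feed the same rigidity lemma. -/
lemma exists_isPoly_wedge_qCorrAt (hq : q ≠ 1)
    (hD : ∀ v ∈ qSet e q a β z, ∀ i j k l, douglasOf (spray e (qMetric q a β)) i j k l z v = 0)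
    {u : Model n} (hu : u ∈ qSet e q a β z) (w : Model n) (i j : Fin n) :
    ∃ N, IsPoly N ∧ ∀ᶠ t : ℝ in 𝓝 0, oneFormForm e β z (u + t • w) *
      wedge (qCorrAt e q a β z (u + t • w)) (u + t • w) i j = N t := by
  obtain ⟨N, hN, h1⟩ := exists_isPoly_wedge_of_douglas
    (fun i => contDiffAt_spray_qMetric he hz hq hu i)
    ((eventually_mem_qSet hu).mono fun v hv => hD v hv) w i j
  refine ⟨_, (IsPoly.clm (oneFormForm e β z) u w).mul
    (hN.sub (isPoly_wedge_geodVec e a z u w i j)), ?_⟩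
  filter_upwards [h1, (tendsto_line u w).eventually (eventually_mem_qSet hu)] with t ht hv
  rw [← ht]
  have h2 : (WithLp.toLp 2 fun i => spray e (qMetric q a β) i z (u + t • w)) =
      geodVec e a z (u + t • w) + qCorrAt e q a β z (u + t • w) := by
    ext i
    exact spray_qMetric he hz hq a β hv.1 hv.2 i
  rw [h2, wedge_add_left, add_sub_cancel_left]

lemma exists_isPoly_wedge_kropinaCorrAt_of_douglas
    (hD : ∀ v, oneFormForm e β z v ≠ 0 →
      ∀ i j k l, douglasOf (spray e (kropina a β)) i j k l z v = 0)
    {u : Model n} (hu : oneFormForm e β z u ≠ 0) (w : Model n) (i j : Fin n) :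
    ∃ N, IsPoly N ∧ ∀ᶠ t : ℝ in 𝓝 0,
      wedge (kropinaCorrAt e a β z (u + t • w)) (u + t • w) i j = N t := by
  have hev := (oneFormForm e β z).continuous.continuousAt.eventually_ne hu
  obtain ⟨N, hN, h1⟩ := exists_isPoly_wedge_of_douglas
    (fun i => contDiffAt_spray_kropina (a := a) he hz hu i) (hev.mono fun v hv => hD v hv) w i j
  refine ⟨_, hN.sub (isPoly_wedge_geodVec e a z u w i j), ?_⟩
  filter_upwards [h1, (tendsto_line u w).eventually hev] with t ht hv
  rw [← ht]
  have h2 : (WithLp.toLp 2 fun i => spray e (kropina a β) i z (u + t • w)) =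
      geodVec e a z (u + t • w) + kropinaCorrAt e a β z (u + t • w) := by
    ext i
    exact spray_kropina he hz a β hv i
  rw [h2, wedge_add_left, add_sub_cancel_left]

lemma isRigid_of_douglas (hn : 3 ≤ n) (hq : q ≠ 1)
    (hF : ∃ y : TangentSpace 𝓘(ℝ, Model n) (e.symm z), alpha a _ y < beta β _ y)
    (hβ' : β' (e.symm z) ≠ 0)
    (hD : ∀ v ∈ qSet e q a β z, ∀ i j k l, douglasOf (spray e (qMetric q a β)) i j k l z v = 0)
    (hD' : ∀ v, oneFormForm e β' z v ≠ 0 →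
      ∀ i j k l, douglasOf (spray e (kropina a' β')) i j k l z v = 0) :
    IsRigid e q a a' β β' z := by
  obtain ⟨h1, h2⟩ := sOp_eq_zero_and_r00_eq_zero he hz hn hq hF fun u hu w i j =>
    exists_isPoly_wedge_qCorrAt he hz hq hD hu w i j
  obtain ⟨u, hu⟩ := exists_oneFormForm_ne_zero he hz hβ'
  exact ⟨h1, h2, sOp_eq_of_poly he hz hu fun w i j =>
    exists_isPoly_wedge_kropinaCorrAt_of_douglas he hz hD' hu w i j⟩

/-- The relation equates the wedges of the two sprays with `y`. It first forces rigidity of `β`,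
which removes the correction of `F` from the equation; the Kropina correction is then polynomial,
hence rigid as well, and only quadratic fields remain. -/
lemma isRigid_of_projective (hn : 3 ≤ n) (hq : q ≠ 1)
    (hF : ∃ y : TangentSpace 𝓘(ℝ, Model n) (e.symm z), alpha a _ y < beta β _ y)
    {c : ℝ} (hc : c ≠ 0) (hcol : oneFormForm e β' z = c • oneFormForm e β z)
    (hP : ∀ v ∈ qSet e q a β z, ∃ P : ℝ, ∀ i, spray e (qMetric q a β) i z v =
      spray e (kropina a' β') i z v + P * v i) :
    IsRigid e q a a' β β' z ∧ ∀ v i j,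
      wedge (geodVec e a z v - geodVec e a' z v - kropinaQuad e a' β' z v) v i j = 0 := by
  have hne : ∀ v ∈ qSet e q a β z, oneFormForm e β' z v ≠ 0 := fun v hv => by
    rw [hcol]
    exact mul_ne_zero hc (pos_of_mem_qSet hv).ne'
  have hw : ∀ v ∈ qSet e q a β z, ∀ i j, wedge (geodVec e a z v) v i j +
      wedge (qCorrAt e q a β z v) v i j = wedge (geodVec e a' z v) v i j +
        wedge (kropinaCorrAt e a' β' z v) v i j := by
    intro v hv i j
    obtain ⟨P, hP⟩ := hP v hv
    rw [← wedge_add_left, ← wedge_add_left]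
    have h1 : (WithLp.toLp 2 fun i => spray e (qMetric q a β) i z v) =
        geodVec e a z v + qCorrAt e q a β z v := by
      ext i
      exact spray_qMetric he hz hq a β hv.1 hv.2 i
    rw [← h1]
    refine wedge_toLp_add_smul (c := P) (fun i => ?_) i j
    rw [hP, spray_kropina he hz a' β' (hne v hv)]
    rfl
  have hu := bVec_mem_qSet he hz hF q
  obtain ⟨h1, h2⟩ := sOp_eq_zero_and_r00_eq_zero he hz hn hq hF fun u hu w i j => by
    obtain ⟨N, hN, h1⟩ := exists_isPoly_wedge_kropinaCorrAt he hz a' β' (hne u hu) w i j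
    -- Since `β̄ = c β`, multiplication by `β` also clears the Kropina denominator; `c⁻¹` converts
    -- the one factor into the other.
    refine ⟨_, ((IsPoly.clm (oneFormForm e β z) u w).mul
      ((isPoly_wedge_geodVec e a' z u w i j).sub (isPoly_wedge_geodVec e a z u w i j))).add
        ((IsPoly.const c⁻¹).mul hN), ?_⟩
    filter_upwards [h1, (tendsto_line u w).eventually (eventually_mem_qSet hu)] with t ht hv
    rw [← ht, hcol, _root_.smul_apply, smul_eq_mul]
    have := hw _ hv i j
    field_simp
    linear_combination oneFormForm e β z (u + t • w) * this
  have hq0 : ∀ v i j, wedge (qCorrAt e q a β z v) v i j = 0 := fun v i j => by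
    rw [qCorrAt_eq he hz hq h1 h2, wedge_smul_left, wedge_self, mul_zero]
  have h3 := sOp_eq_of_poly (a := a') he hz (hne _ hu) fun w i j => by
    refine ⟨_, (isPoly_wedge_geodVec e a z (bVec e a β z) w i j).sub
      (isPoly_wedge_geodVec e a' z (bVec e a β z) w i j), ?_⟩
    filter_upwards [(tendsto_line _ w).eventually (eventually_mem_qSet hu)] with t hv
    have := hw _ hv i j
    rw [hq0] at this
    linarith
  refine ⟨⟨h1, h2, h3⟩, fun v i j => ?_⟩
  -- Proportionality is known near `b`, which lies in the domain of `F`; being polynomial, it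
  -- extends along the line from `b` to an arbitrary `v`.
  have h4 : ∀ k, IsPoly fun t : ℝ => (geodVec e a z (bVec e a β z + t • (v - bVec e a β z)) -
      geodVec e a' z (bVec e a β z + t • (v - bVec e a β z)) -
        kropinaQuad e a' β' z (bVec e a β z + t • (v - bVec e a β z))) k := fun k =>
    ((isPoly_geodVec e a z _ _ k).sub (isPoly_geodVec e a' z _ _ k)).sub
      (isPoly_kropinaQuad e a' β' z _ _ k)
  have h5 := (((h4 i).mul (IsPoly.coord (bVec e a β z) (v - bVec e a β z) j)).sub
    ((h4 j).mul (IsPoly.coord (bVec e a β z) (v - bVec e a β z) i))).eq_zero (by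
      filter_upwards [(tendsto_line _ (v - bVec e a β z)).eventually (eventually_mem_qSet hu)]
        with t hv
      have h6 := hw _ hv i j
      rw [hq0, kropinaCorrAt_eq he hz h3 (hne _ hv), wedge_add_left, wedge_smul_left,
        wedge_self] at h6
      change wedge (_ - _ - _) (bVec e a β z + t • (v - bVec e a β z)) i j = 0
      rw [wedge_sub_left, wedge_sub_left]
      linarith) 1
  rw [one_smul, add_sub_cancel] at h5
  exact h5

/-- Under `IsRigid`, the spray coefficients of the two metrics agree up to multiples of `v` as
soon as those of `α` do with the quadratic part of those of the Kropina metric. -/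
lemma IsRigid.spray_eq (h : IsRigid e q a a' β β' z) (hq : q ≠ 1) {v : Model n}
    (hv : v ∈ qSet e q a β z) (hv' : oneFormForm e β' z v ≠ 0) {c : ℝ}
    (hc : ∀ i, geodVec e a z v i - geodVec e a' z v i = kropinaQuad e a' β' z v i + c * v i) :
    ∃ P : ℝ, ∀ i, spray e (qMetric q a β) i z v = spray e (kropina a' β') i z v + P * v i := by
  refine ⟨c + qMul q √(metricForm e a z v v) (oneFormForm e β z v) (bSq e a β z) (r00 e a β z v) -
    kropinaMul (metricForm e a' z v v) (oneFormForm e β' z v) (bSq e a' β' z) (r00 e a' β' z v)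
        (oneFormForm e β' z (sOp e a' β' z v)), fun i => ?_⟩
  have h1 := spray_qMetric he hz hq a β hv.1 hv.2 i
  have h2 := spray_kropina he hz a' β' hv' i
  have h3 := qCorrAt_eq he hz hq h.closed h.killing v
  have h4 := kropinaCorrAt_eq he hz h.curl hv'
  rw [← qCorrAt, h3] at h1
  rw [← kropinaCorrAt, h4] at h2
  rw [h1, h2]
  have := hc i
  simp only [PiLp.add_apply, PiLp.smul_apply, smul_eq_mul]
  linear_combination this

end Rigidity

/-! ### Transformation law of sprays -/

section Naturality

attribute [local instance] instNormedAddCommGroupBilin instNormedSpaceBilin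

variable {n : ℕ} {M : Type*} [TopologicalSpace M] [ChartedSpace (Model n) M]
  [IsManifold 𝓘(ℝ, Model n) ∞ M]

variable {e e' : Chart n M} {z : Model n}
  (he : e ∈ IsManifold.maximalAtlas 𝓘(ℝ, Model n) ∞ M)
  (he' : e' ∈ IsManifold.maximalAtlas 𝓘(ℝ, Model n) ∞ M) (hz : z ∈ e'.target)
  (hz' : e'.symm z ∈ e.source)

lemma IsSpray.congr {E : Type*} [NormedAddCommGroup E] [NormedSpace ℝ E] {L L' : E × E → ℝ}
    {z v G : E} (h : L =ᶠ[𝓝 (z, v)] L') (hG : IsSpray L z v G) : IsSpray L' z v G := by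
  intro w
  rw [← h.fderiv_eq, ← h.fderiv.fderiv_eq]
  exact hG w

include he he' hz hz'

/-- The transformation law of spray coefficients. -/
lemma spray_transition {F : TFun n M} {v G : Model n}
    (hL : ContDiffAt ℝ 2 (fun x : Model n × Model n => F (e.symm x.1) (vec e x.1 x.2) ^ 2)
      (e (e'.symm z), fderiv ℝ (fun z => e (e'.symm z)) z v))
    (hn : FibreNondeg (fun x : Model n × Model n => F (e.symm x.1) (vec e x.1 x.2) ^ 2)
      (e (e'.symm z)) (fderiv ℝ (fun z => e (e'.symm z)) z v))
    (hG : IsSpray (fun x : Model n × Model n => F (e'.symm x.1) (vec e' x.1 x.2) ^ 2) z v G)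
    (i : Fin n) :
    spray e F i (e (e'.symm z)) (fderiv ℝ (fun z => e (e'.symm z)) z v) =
      (fderiv ℝ (fun z => e (e'.symm z)) z G - (1 / 2 : ℝ) •
        fderiv ℝ (fderiv ℝ (fun z => e (e'.symm z))) z v v) i := by
  refine sprayOf_eq_of_isSpray hL hn ?_ i
  have h3 : (3 : WithTop ℕ∞) ≤ ∞ := by
    have : ((3 : ℕ∞) : WithTop ℕ∞) ≤ ∞ := WithTop.coe_le_coe.2 le_top
    exact this
  refine IsSpray.pullback (ψ := fun z => e (e'.symm z))
    ((contMDiffAt_transition he he' hz hz').of_le h3)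
    (bijective_fderiv_transition he he' hz hz').2 hL (hG.congr ?_)
  have hev : ∀ᶠ x : Model n × Model n in 𝓝 (z, v), x.1 ∈ e'.target ∧ e'.symm x.1 ∈ e.source :=
    continuousAt_fst.eventually (eventually_mem_transition hz hz')
  filter_upwards [hev] with x hx
  have := tFun_transition he he' hx.1 hx.2 x.2 F
  exact (congrArg (· ^ 2) this).symm

lemma mem_transition (D : TDom n M) (v : Model n) :
    vec e (e (e'.symm z)) (fderiv ℝ (fun z => e (e'.symm z)) z v) ∈ D (e.symm (e (e'.symm z))) ↔
      vec e' z v ∈ D (e'.symm z) :=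
  (congrArg (fun p : TangentBundle 𝓘(ℝ, Model n) M => p.2 ∈ D p.1)
    (vec_transition he he' hz hz' v)).to_iff

lemma mfderiv_vec (v : Model n) : mfderiv 𝓘(ℝ, Model n) 𝓘(ℝ, Model n) e (e'.symm z) (vec e' z v) =
    fderiv ℝ (fun z => e (e'.symm z)) z v := by
  have hd := (mdifferentiable_of_mem he).mdifferentiableAt hz'
  have hd' := (mdifferentiable_of_mem he').mdifferentiableAt_symm hz
  have h2 : mfderiv 𝓘(ℝ, Model n) 𝓘(ℝ, Model n) (fun x => e (e'.symm x)) z =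
      (mfderiv 𝓘(ℝ, Model n) 𝓘(ℝ, Model n) e (e'.symm z)).comp
        (mfderiv 𝓘(ℝ, Model n) 𝓘(ℝ, Model n) e'.symm z) :=
    mfderiv_comp (f := e'.symm) z hd hd'
  rw [mfderiv_eq_fderiv] at h2
  exact (congrArg (fun φ : Model n →L[ℝ] Model n => φ v) h2).symm

end Naturality

/-! ### The projective factor as a function on the tangent bundle -/

section Factor

attribute [local instance] instNormedAddCommGroupBilin instNormedSpaceBilin

variable {n : ℕ} {M : Type*} [TopologicalSpace M] [ChartedSpace (Model n) M]
  [IsManifold 𝓘(ℝ, Model n) ∞ M]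

/-- The factor by which the spray coefficients of `F` and `F'`, if they differ by a multiple of
`y`, do so. -/
noncomputable def projectiveFactor (F F' : TFun n M) : TFun n M := fun x y =>
  let e := chartAt (Model n) x
  let v : Model n := mfderiv 𝓘(ℝ, Model n) 𝓘(ℝ, Model n) e x y
  (∑ i, (spray e F i (e x) v - spray e F' i (e x) v) * v i) / ∑ i, v i * v i

variable {q : ℝ} {a a' : RMetric n M} {β β' : OneForm n M}

/-- The inhomogeneous term in the transformation law depends on the coordinates and on `y` but not
on the metric, so it cancels in the difference of two sprays. The factor found in one chart is
therefore the factor in every chart. -/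
lemma projectivelyRelated_of_forall (hq : q ≠ 1)
    (h : ∀ e ∈ IsManifold.maximalAtlas 𝓘(ℝ, Model n) ∞ M, ∀ z ∈ e.target, ∀ v,
      v ∈ qSet e q a β z → oneFormForm e β' z v ≠ 0 →
      ∃ P : ℝ, ∀ i, spray e (qMetric q a β) i z v = spray e (kropina a' β') i z v + P * v i) :
    ProjectivelyRelated (qMetric q a β) (qDomain q a β) (kropina a' β') (kropinaDomain β') := by
  refine ⟨projectiveFactor (qMetric q a β) (kropina a' β'), fun e' he' z hz v hv hv' => ?_⟩
  have he : chartAt (Model n) (e'.symm z) ∈ IsManifold.maximalAtlas 𝓘(ℝ, Model n) ∞ M :=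
    IsManifold.chart_mem_maximalAtlas _
  have hz' : e'.symm z ∈ (chartAt (Model n) (e'.symm z)).source := mem_chart_source _ _
  have hs := (vec_mem_qDomain_iff he' hz hq a β).1 hv
  obtain ⟨P, hP⟩ := h e' he' z hz v hs hv'
  suffices hfac : projectiveFactor (qMetric q a β) (kropina a' β') (e'.symm z) (vec e' z v) = P by
    rw [hfac]; exact hP
  rw [projectiveFactor]
  generalize chartAt (Model n) (e'.symm z) = e at he hz'
  dsimp only
  rw [mfderiv_vec he he' hz hz' v]
  have hx := e.map_source hz'
  have hs1 := (vec_mem_qDomain_iff he hx hq a β).1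
    ((mem_transition he he' hz hz' (qDomain q a β) v).2 hv)
  have hs2 : oneFormForm e β' (e (e'.symm z)) (fderiv ℝ (fun z => e (e'.symm z)) z v) ≠ 0 :=
    (mem_transition he he' hz hz' (kropinaDomain β') v).2 hv'
  have g1 := isSpray_qMetric_vec he' hz hq a β hs.1 hs.2
  have g2 := isSpray_kropina_vec he' hz a' β' hv'
  have t1 := spray_transition he he' hz hz' (contDiffAt_qMetric_vec he hx q a β hs1.1)
    ((fibreNondeg_qMetric_vec he hx hq a β hs1.1).2 hs1.2) g1
  have t2 := spray_transition he he' hz hz' (contDiffAt_kropina_vec he hx a' β' hs2)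
    (fibreNondeg_kropina_vec he hx a' β' hs2) g2
  have s1 := spray_qMetric he' hz hq a β hs.1 hs.2
  have s2 := spray_kropina he' hz a' β' hv'
  generalize geodVec e' a z v + _ = X at t1 s1
  generalize geodVec e' a' z v + _ = Y at t2 s2
  have hXY : X = Y + P • v := by
    ext i
    rw [← s1, hP i, s2]
    rfl
  set w := fderiv ℝ (fun z => e (e'.symm z)) z v with hw
  have hd : ∀ i, spray e (qMetric q a β) i (e (e'.symm z)) w -
      spray e (kropina a' β') i (e (e'.symm z)) w = P * w i := by
    intro i
    rw [t1, t2, hXY, map_add, map_smul, ← hw]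
    simp only [PiLp.sub_apply, PiLp.add_apply, PiLp.smul_apply, smul_eq_mul]
    ring
  -- The coordinate inner product with `w`, divided by `|w|²`, recovers the factor from a multiple
  -- of `w`.
  simp only [hd, mul_assoc, ← Finset.mul_sum]
  have hw0 : w ≠ 0 := IsFrame.ne_zero_of_right hs2
  have hpos : ∑ i, w i * w i ≠ 0 := by
    intro h0
    refine hw0 ?_
    ext i
    have := (Finset.sum_eq_zero_iff_of_nonneg fun i _ => mul_self_nonneg (w i)).1 h0 i
      (Finset.mem_univ i)
    exact mul_self_eq_zero.1 this
  rw [mul_div_assoc, div_self hpos, mul_one]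

end Factor

end Kropina

/-! ### The equivalence -/

theorem theorem2 {n : ℕ} (hn : 3 ≤ n) {M : Type*} [TopologicalSpace M]
    [ChartedSpace (Kropina.Model n) M] [IsManifold 𝓘(ℝ, Kropina.Model n) ∞ M]
    (q : ℝ) (hq1 : q ≠ 1) (hq2 : q ≠ -1)
    -- the Riemannian metrics `α`, `ᾱ` and the 1-forms `β`, `β̄`
    (a a' : Kropina.RMetric n M) (β β' : Kropina.OneForm n M)
    -- the 1-forms are nowhere zero and collinear
    (hβ : ∀ x, β x ≠ 0) (hβ' : ∀ x, β' x ≠ 0) (hcol : ∀ x, ∃ c : ℝ, β' x = c • β x)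
    -- the metric `F` lives on all of `M`: the cone `α < β` is non-empty at every point
    (hF : ∀ x : M, ∃ y : TangentSpace 𝓘(ℝ, Kropina.Model n) x,
      Kropina.alpha a x y < Kropina.beta β x y) :
    Kropina.ProjectivelyRelated
        (Kropina.qMetric q a β) (Kropina.qDomain q a β)
        (Kropina.kropina a' β') (Kropina.kropinaDomain β') ↔
      Kropina.IsDouglas (Kropina.qMetric q a β) (Kropina.qDomain q a β) ∧
      Kropina.IsDouglas (Kropina.kropina a' β') (Kropina.kropinaDomain β') ∧
      ∃ θ : Kropina.OneForm n M,
        ∀ e ∈ IsManifold.maximalAtlas 𝓘(ℝ, Kropina.Model n) ∞ M, ∀ z ∈ e.target,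
        ∀ v : Kropina.Model n, Kropina.vec e z v ∈ Kropina.qDomain q a β (e.symm z) →
        ∀ i : Fin n,
          Kropina.spray e (Kropina.alpha a) i z v - Kropina.spray e (Kropina.alpha a') i z v =
            1 / (2 * Kropina.bSq e a' β' z) *
                (Kropina.alpha a' (e.symm z) (Kropina.vec e z v) ^ 2 *
                    Kropina.sVecUp e a' β' i z +
                  Kropina.r00 e a' β' z v * Kropina.bUp e a' β' i z)
              + Kropina.beta θ (e.symm z) (Kropina.vec e z v) * v i
              - q * Kropina.alpha a (e.symm z) (Kropina.vec e z v) ^ 3 * Kropina.r00 e a β z v /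
                  (2 * (Kropina.beta β (e.symm z) (Kropina.vec e z v) ^ 2 *
                        (Kropina.beta β (e.symm z) (Kropina.vec e z v)
                          - Kropina.alpha a (e.symm z) (Kropina.vec e z v))
                      + q * (Kropina.bSq e a β z *
                            Kropina.alpha a (e.symm z) (Kropina.vec e z v) ^ 2
                          - Kropina.beta β (e.symm z) (Kropina.vec e z v) ^ 2)
                        * Kropina.alpha a (e.symm z) (Kropina.vec e z v))) *
                Kropina.bUp e a β i z := by
  -- The domain of `F` lies in that of the Kropina metric: there `β > α ≥ 0`, and `β̄` is a nonzero
  -- multiple of `β`.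
  have hne : ∀ e ∈ IsManifold.maximalAtlas 𝓘(ℝ, Kropina.Model n) ∞ M, ∀ z ∈ e.target, ∀ v,
      v ∈ Kropina.qSet e q a β z → Kropina.oneFormForm e β' z v ≠ 0 := by
    intro e he z hz v hv
    obtain ⟨c, hc, h⟩ := Kropina.exists_smul_oneFormForm he hz (hβ' _) (hcol _)
    rw [h]
    exact mul_ne_zero hc (Kropina.pos_of_mem_qSet hv).ne'
  have hα : ∀ (e : Kropina.Chart n M) (z v : Kropina.Model n),
      Kropina.alpha a' (e.symm z) (Kropina.vec e z v) ^ 2 = Kropina.metricForm e a' z v v :=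
    fun e z v => by rw [Kropina.alpha_vec, Real.sq_sqrt (Kropina.metricForm_nonneg e a' z v)]
  have hquad : ∀ (e : Kropina.Chart n M) (z v : Kropina.Model n) (i : Fin n),
      1 / (2 * Kropina.bSq e a' β' z) *
        (Kropina.alpha a' (e.symm z) (Kropina.vec e z v) ^ 2 * Kropina.sVecUp e a' β' i z +
          Kropina.r00 e a' β' z v * Kropina.bUp e a' β' i z) =
        Kropina.kropinaQuad e a' β' z v i := fun e z v i => by rw [hα]; rfl
  -- In both directions rigidity gives `q r₀₀ = 0`, so the last term of the formula is zero.
  have hzero : ∀ {r α x y : ℝ}, q * r = 0 → q * α ^ 3 * r / x * y = 0 := fun {r α x y} h => by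
    rw [show q * α ^ 3 * r = α ^ 3 * (q * r) by ring, h, mul_zero, zero_div, zero_mul]
  constructor
  · rintro ⟨P, hP⟩
    have hrig : ∀ e ∈ IsManifold.maximalAtlas 𝓘(ℝ, Kropina.Model n) ∞ M, ∀ z ∈ e.target,
        Kropina.IsRigid e q a a' β β' z ∧ ∀ v i j, Kropina.wedge (Kropina.geodVec e a z v -
          Kropina.geodVec e a' z v - Kropina.kropinaQuad e a' β' z v) v i j = 0 := by
      intro e he z hz
      obtain ⟨c, hc, h⟩ := Kropina.exists_smul_oneFormForm he hz (hβ' _) (hcol _)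
      exact Kropina.isRigid_of_projective he hz hn hq1 (hF (e.symm z)) hc h fun v hv =>
        ⟨_, hP e he z hz v ((Kropina.vec_mem_qDomain_iff he hz hq1 a β).2 hv)
          (hne e he z hz v hv)⟩
    obtain ⟨θ, hθ⟩ := Kropina.exists_oneForm a a' hβ'
    refine ⟨fun e he z hz v hv i j k l => ?_, fun e he z hz v hv i j k l => ?_, θ,
      fun e he z hz v hv i => ?_⟩
    · exact Kropina.douglasOf_qMetric he hz hq1 (hrig e he z hz).1.closed
        (hrig e he z hz).1.killing ((Kropina.vec_mem_qDomain_iff he hz hq1 a β).1 hv) i j k l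
    · exact Kropina.douglasOf_kropina he hz (hrig e he z hz).1.curl hv i j k l
    · have h := hθ e he z hz (hrig e he z hz).2 v i
      rw [Kropina.spray_alpha he hz, Kropina.spray_alpha he hz, hquad,
        hzero ((hrig e he z hz).1.killing v)]
      simp only [PiLp.sub_apply] at h
      linarith
  · rintro ⟨hD, hD', θ, hθ⟩
    refine Kropina.projectivelyRelated_of_forall hq1 fun e he z hz v hv hv' => ?_
    -- The Douglas conditions alone give rigidity; the formula then only has to match the remaining
    -- quadratic parts.
    have hrig := Kropina.isRigid_of_douglas (a := a) (a' := a') he hz hn hq1 (hF (e.symm z))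
      (hβ' _) (fun v hv => hD e he z hz v ((Kropina.vec_mem_qDomain_iff he hz hq1 a β).2 hv))
      fun v hv => hD' e he z hz v hv
    refine hrig.spray_eq he hz hq1 hv hv'
      (c := Kropina.beta θ (e.symm z) (Kropina.vec e z v)) fun i => ?_
    have h := hθ e he z hz v ((Kropina.vec_mem_qDomain_iff he hz hq1 a β).2 hv) i
    rw [Kropina.spray_alpha he hz, Kropina.spray_alpha he hz, hquad,
      hzero (hrig.killing v)] at h
    linarith
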